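/- Let $K$ be a field of characteristic $0$ (for instance $\mathbb{Q}$ or $\mathbb{C}$). Graphs are finite, possibly empty or disconnected, may have loops, multiple edges and closed circle components without vertices, and carry a cyclic order of the edge ends at every vertex; they are considered up to isomorphisms preserving the cyclic orders. *The algebra $\mathcal{B}$.* Let $\tilde{\mathcal{B}}$ be the $K$-vector space with basis the graphs all of whose vertices are 1-valent or 3-valent and none of whose components is a single edge with two 1-valent ends; disjoint union makes it a commutative algebra. Let $\deg_1$ be the number of 1-valent vertices and $\deg_2$ the number of edges minus the number of 3-valent vertices (circles without vertices count $0$). Let $\mathcal{B}=\tilde{\mathcal{B}}/(\mathrm{AS}+\mathrm{IHX})$, where AS is spanned by the sums of two graphs differing only by the cyclic order at one 3-valent vertex, and IHX is spanned by the combinations $\Gamma_1-\Gamma_2+\Gamma_3$ for all graphs $\Gamma$ with one 4-valent vertex and otherwise as above: if the edge ends at the 4-valent vertex are $a,b,c,d$ in cyclic order, then $\Gamma_1,\Gamma_2,\Gamma_3$ arise by replacing it with two 3-valent vertices joined by a new edge with ends $p,q$, with cyclic orders $(a,b,p),(q,c,d)$, respectively $(b,c,p),(q,d,a)$, respectively $(c,a,p),(q,b,d)$.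 Let $\mathcal{B}_{m,n}$ be the span of the classes of graphs with $\deg_1=m$, $\deg_2=n$. *The algebra $\mathcal{D}$.* For a graph $D$ with only 3-valent vertices let $G_D$ be the (finite) group of its symmetries preserving the cyclic orders, taken modulo isotopy (so that the orientation reversal of a circle without vertices is included), and let $P_D$ be the averaging projector of $S^*H^1(D;K)$ onto its $G_D$-invariant part. Let $\tilde{\mathcal{D}}=\bigoplus_D \bigl(S^*H^1(D;K)\bigr)^{G_D}$, the sum over isomorphism classes of such graphs, with the product $x_1x_2=P_{D_1\cup D_2}(x_1\otimes x_2)$, where $S^*H^1(D_1\cup D_2)=S^*H^1(D_1)\otimes S^*H^1(D_2)$. Let $\mathcal{D}=\tilde{\mathcal{D}}/(\mathrm{AS}+\mathrm{IHX})$, where AS is spanned by the elements $P_{D_1}(x)+P_{D_2}(\hat f(x))$, with $D_2$ obtained from $D_1$ by changing the cyclic order at one vertex and $\hat f:S^*H^1(D_1;K)\to S^*H^1(D_2;K)$ the natural isomorphism, and IHX is spanned by the elements $P_{D_1}(f_1^*x)-P_{D_2}(f_2^*x)+P_{D_3}(f_3^*x)$, for $D$ with one 4-valent vertex and otherwise 3-valent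 vertices, $x\in S^*H^1(D;K)$, $D_1,D_2,D_3$ the three resolutions of $D$ as above, and $f_i^*:S^*H^1(D;K)\to S^*H^1(D_i;K)$ induced by the contraction $D_i\to D$ of the new edge. Let $\mathcal{D}_{m,k}$ be the image of $\bigoplus_{D:\,\chi(D)=k}\bigl(S^mH^1(D;K)\bigr)^{G_D}$, where $\chi(D)$ is the number of edges minus the number of vertices (circles without vertices count $0$); it is $0$ for $k<0$. **Theorem.** There is a unique isomorphism of $K$-algebras $\hat A:\mathcal{B}\to\mathcal{D}$ such that 1. $\hat A(\mathcal{B}_{m,n})=\mathcal{D}_{m,n-m}$ for all $m,n\ge 0$; 2. if $\Gamma$ is obtained from a graph $D$ with only 3-valent vertices by successively attaching legs (edges with a 1-valent end) to the edges of $D$, on the left-hand sides of the oriented edges $e_1,\dots,e_m$ of $D$ (that is, with cyclic order (forward, leg, backward) at the attaching vertex), then $\hat A$ sends the class of $\Gamma$ to the class of $P_D(f_{e_1}\cdots f_{e_m})$, where $f_e\in H^1(D;K)$ is the class of the 1-cochain dual to the oriented edge $e$. -/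

import Mathlib

noncomputable section

namespace Jacobi

/-! ### Graphs with cyclic orders at the vertices -/

/-- A finite graph (not necessarily connected, loops, multiple edges and closed circles without
vertices allowed) with a cyclic order of the edge ends at every vertex.
`E` is the set of oriented edges ("darts"), `rev` reverses the orientation.  A dart `e` with
`¬ free e` starts at a vertex; the darts that start at a given vertex form one orbit of `σ`, and
`σ` is their (counterclockwise) cyclic order.  The darts with `free e` are the two orientations of
the closed circles that carry no vertex. -/
structure OGraph : Type 1 where
  E : Type
  finite : Finite E
  σ : Equiv.Perm E
  rev : E → E
  rev_rev : ∀ e, rev (rev e) = e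
  rev_ne : ∀ e, rev e ≠ e
  free : E → Prop
  free_rev : ∀ e, free e → free (rev e)
  σ_free : ∀ e, free e → σ e = e

attribute [instance] OGraph.finite

/-- Isomorphisms of graphs that preserve the cyclic orders. -/
structure Iso (G H : OGraph) where
  toEquiv : G.E ≃ H.E
  map_σ : ∀ e, toEquiv (G.σ e) = H.σ (toEquiv e)
  map_rev : ∀ e, toEquiv (G.rev e) = H.rev (toEquiv e)
  map_free : ∀ e, H.free (toEquiv e) ↔ G.free e

namespace Iso

variable {G H J : OGraph}

theorem toEquiv_injective : Function.Injective (toEquiv : Iso G H → (G.E ≃ H.E)) := by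
  rintro ⟨f, _, _, _⟩ ⟨g, _, _, _⟩ h
  cases h
  rfl

instance : Finite (Iso G H) := Finite.of_injective _ toEquiv_injective

instance : Fintype (Iso G H) := Fintype.ofFinite _

def refl (G : OGraph) : Iso G G := ⟨Equiv.refl _, fun _ => rfl, fun _ => rfl, fun _ => Iff.rfl⟩

def symm (f : Iso G H) : Iso H G where
  toEquiv := f.toEquiv.symm
  map_σ e := by rw [Equiv.symm_apply_eq, f.map_σ, Equiv.apply_symm_apply]
  map_rev e := by rw [Equiv.symm_apply_eq, f.map_rev, Equiv.apply_symm_apply]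
  map_free e := by rw [← f.map_free, Equiv.apply_symm_apply]

def trans (f : Iso G H) (g : Iso H J) : Iso G J where
  toEquiv := f.toEquiv.trans g.toEquiv
  map_σ e := by simp [f.map_σ, g.map_σ]
  map_rev e := by simp [f.map_rev, g.map_rev]
  map_free e := by simp [f.map_free, g.map_free]

end Iso

namespace OGraph

/-- The empty graph. -/
abbrev empty : OGraph where
  E := Empty
  finite := inferInstance
  σ := 1
  rev := id
  rev_rev _ := rfl
  rev_ne e := e.elim
  free _ := False
  free_rev _ h := h
  σ_free _ _ := rfl

/-- Disjoint union. -/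
abbrev union (G H : OGraph) : OGraph where
  E := G.E ⊕ H.E
  finite := inferInstance
  σ := Equiv.sumCongr G.σ H.σ
  rev := Sum.map G.rev H.rev
  rev_rev := by rintro (e | e) <;> simp [G.rev_rev, H.rev_rev]
  rev_ne := by rintro (e | e) <;> simp [G.rev_ne, H.rev_ne]
  free := Sum.elim G.free H.free
  free_rev := by rintro (e | e) <;> simpa using fun h => OGraph.free_rev _ _ h
  σ_free := by rintro (e | e) <;> simpa using fun h => OGraph.σ_free _ _ h

/-- The number of 1-valent vertices. -/
def numLegs (G : OGraph) : ℕ := Nat.card {e : G.E // ¬ G.free e ∧ G.σ e = e}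

/-- The number of edges; closed circles without vertices are not counted (so that they contribute
`0` to the Euler characteristic).  The division is exact. -/
def numEdges (G : OGraph) : ℕ := Nat.card {e : G.E // ¬ G.free e} / 2

/-- The number of 3-valent vertices of a graph with 1- and 3-valent vertices only.
The division is exact. -/
def numTri (G : OGraph) : ℕ := Nat.card {e : G.E // ¬ G.free e ∧ G.σ e ≠ e} / 3

/-- The second degree: number of edges minus number of 3-valent vertices. -/
def deg₂ (G : OGraph) : ℤ := G.numEdges - G.numTri

/-- The Euler characteristic with the opposite sign (1- and 3-valent vertices). -/
def chi (G : OGraph) : ℤ := G.numEdges - (G.numTri + G.numLegs)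

/-- All vertices are 1-valent or 3-valent, and no component is a single edge with two
1-valent ends. -/
structure IsUniTri (G : OGraph) : Prop where
  cube : ∀ e, G.σ (G.σ (G.σ e)) = e
  no_strut : ∀ e, ¬ G.free e → ¬ (G.σ e = e ∧ G.σ (G.rev e) = G.rev e)

/-- All vertices are 3-valent. -/
structure IsTri (G : OGraph) : Prop where
  cube : ∀ e, G.σ (G.σ (G.σ e)) = e
  no_leg : ∀ e, ¬ G.free e → G.σ e ≠ e

theorem IsTri.isUniTri {G : OGraph} (h : G.IsTri) : G.IsUniTri :=
  ⟨h.1, fun e he h' => h.2 e he h'.1⟩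

/-- The dart `x` starts at a 4-valent vertex, and every other vertex is 1-valent or 3-valent. -/
def IsFourAt (G : OGraph) (x : G.E) : Prop :=
  G.σ (G.σ (G.σ (G.σ x))) = x ∧ G.σ (G.σ x) ≠ x ∧
    ∀ e, e ≠ x → e ≠ G.σ x → e ≠ G.σ (G.σ x) → e ≠ G.σ (G.σ (G.σ x)) →
      G.σ (G.σ (G.σ e)) = e

/-- One 4-valent vertex (where `x` starts), all other vertices 1- or 3-valent, no component a
single edge with two 1-valent ends. -/
structure IsUniTriFour (G : OGraph) (x : G.E) : Prop where
  four : G.IsFourAt x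
  no_strut : ∀ e, ¬ G.free e → ¬ (G.σ e = e ∧ G.σ (G.rev e) = G.rev e)

/-- One 4-valent vertex (where `x` starts), all other vertices 3-valent. -/
structure IsTriFour (G : OGraph) (x : G.E) : Prop where
  four : G.IsFourAt x
  no_leg : ∀ e, ¬ G.free e → G.σ e ≠ e

section Flip

open scoped Classical

/-- The swap of the two darts that follow and precede `e` at its vertex. -/
def flipSwap (G : OGraph) (e : G.E) : Equiv.Perm G.E := Equiv.swap (G.σ e) (G.σ.symm e)

theorem flipSwap_free (G : OGraph) (e h : G.E) (hh : G.free h) : G.flipSwap e h = h := by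
  by_cases he : G.free e
  · have : G.σ.symm e = e := by rw [Equiv.symm_apply_eq, G.σ_free e he]
    simp [flipSwap, this, G.σ_free e he]
  · apply Equiv.swap_apply_of_ne_of_ne
    · rintro rfl
      exact he (G.σ.injective (G.σ_free _ hh) ▸ hh)
    · rintro rfl
      have := G.σ_free _ hh
      rw [Equiv.apply_symm_apply] at this
      exact he (this ▸ hh)

theorem flipSwap_flipSwap (G : OGraph) (e h : G.E) : G.flipSwap e (G.flipSwap e h) = h :=
  Equiv.swap_apply_self _ _ _

/-- Reversal of the cyclic order at the 3-valent vertex where `e` starts: the 3-cycle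
`(e, σ e, σ⁻¹ e)` of `σ` is replaced by `(e, σ⁻¹ e, σ e)`. -/
abbrev flip (G : OGraph) (e : G.E) : OGraph where
  E := G.E
  finite := G.finite
  σ := G.flipSwap e * G.σ * G.flipSwap e
  rev := G.rev
  rev_rev := G.rev_rev
  rev_ne := G.rev_ne
  free := G.free
  free_rev := G.free_rev
  σ_free h hh := by
    simp [G.flipSwap_free e h hh, G.σ_free h hh]

theorem flip_σ (G : OGraph) (e h : G.E) :
    (G.flip e).σ h = G.flipSwap e (G.σ (G.flipSwap e h)) := rfl

theorem flip_σ_cube (G : OGraph) (hG : ∀ e, G.σ (G.σ (G.σ e)) = e) (e h : G.E) :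
    (G.flip e).σ ((G.flip e).σ ((G.flip e).σ h)) = h := by
  rw [flip_σ, flip_σ, flip_σ]
  simp only [flipSwap_flipSwap, hG]

theorem flip_σ_eq_iff (G : OGraph) (e h : G.E) (he : G.σ e ≠ e) :
    (G.flip e).σ h = h ↔ G.σ h = h := by
  have key : ∀ k, G.σ k = k → G.flipSwap e k = k := by
    intro k hk
    apply Equiv.swap_apply_of_ne_of_ne
    · rintro rfl
      exact he (G.σ.injective hk)
    · rintro rfl
      rw [Equiv.apply_symm_apply] at hk
      apply he
      nth_rewrite 1 [hk]
      simp
  have h1 : (G.flip e).σ h = h ↔ G.σ (G.flipSwap e h) = G.flipSwap e h := by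
    rw [flip_σ]
    constructor
    · intro hh
      rw [← G.flipSwap_flipSwap e (G.σ _), hh]
    · intro hh
      rw [hh, flipSwap_flipSwap]
  rw [h1]
  constructor
  · intro hh
    have := key _ hh
    rw [flipSwap_flipSwap] at this
    rwa [← this] at hh
  · intro hh
    rw [key _ hh, hh]

theorem IsUniTri.flip {G : OGraph} (hG : G.IsUniTri) (e : G.E) (he : G.σ e ≠ e) :
    (G.flip e).IsUniTri := by
  refine ⟨G.flip_σ_cube hG.1 e, fun h hh hs => hG.2 h hh ?_⟩
  exact ⟨(G.flip_σ_eq_iff e h he).1 hs.1, (G.flip_σ_eq_iff e (G.rev h) he).1 hs.2⟩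

theorem IsTri.flip {G : OGraph} (hG : G.IsTri) (e : G.E) (he : G.σ e ≠ e) :
    (G.flip e).IsTri :=
  ⟨G.flip_σ_cube hG.1 e, fun h hh hs => hG.2 h hh ((G.flip_σ_eq_iff e h he).1 hs)⟩

end Flip

section Resolve

open scoped Classical

/-- The four darts at the 4-valent vertex, in the cyclic order, starting from `x`. -/
def arm (G : OGraph) (x : G.E) : Fin 4 → G.E :=
  ![x, G.σ x, G.σ (G.σ x), G.σ (G.σ (G.σ x))]

/-- The three ways to split the four arms: for the `i`-th resolution, the arms number
`split i 0, split i 1` are attached to the first new vertex and `split i 2, split i 3` to the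
second one. -/
def split : Fin 3 → Fin 4 → Fin 4 :=
  ![![0, 1, 2, 3], ![1, 2, 3, 0], ![2, 0, 1, 3]]

/-- The cyclic orders of the `i`-th resolution of the 4-valent vertex at `x`.  The vertex with
arms `a₀, a₁, a₂, a₃` (counterclockwise) is removed and two vertices joined by a new edge with
darts `p` and `q` are added, with counterclockwise orders
`(a₀, a₁, p), (q, a₂, a₃)` for `i = 0`, `(a₁, a₂, p), (q, a₃, a₀)` for `i = 1` and
`(a₂, a₀, p), (q, a₁, a₃)` for `i = 2`.  The other vertices do not change. -/
def resolveσ (G : OGraph) (x : G.E) (i : Fin 3) : Equiv.Perm (G.E ⊕ Bool) :=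
  Equiv.sumCongr (G.σ * (List.formPerm [G.arm x 0, G.arm x 1, G.arm x 2, G.arm x 3])⁻¹) 1 *
    List.formPerm
      [Sum.inl (G.arm x (split i 0)), Sum.inl (G.arm x (split i 1)), Sum.inr false] *
    List.formPerm
      [Sum.inr true, Sum.inl (G.arm x (split i 2)), Sum.inl (G.arm x (split i 3))]

theorem IsFourAt.arm_injective {G : OGraph} {x : G.E} (h : G.IsFourAt x) :
    Function.Injective (G.arm x) := by
  obtain ⟨h4, h2, -⟩ := h
  have i := G.σ.injective
  have h1 : G.σ x ≠ x := fun h => h2 (by rw [h, h])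
  have h3 : G.σ (G.σ (G.σ x)) ≠ x := fun h => h1 (by rw [h] at h4; exact h4)
  intro a b hab
  fin_cases a <;> fin_cases b <;> simp [arm] at hab ⊢
  · exact h1 hab.symm
  · exact h2 hab.symm
  · exact h3 hab.symm
  · exact h1 hab
  · exact h1 hab.symm
  · exact h2 hab.symm
  · exact h2 hab
  · exact h1 hab
  · exact h1 hab.symm
  · exact h3 hab
  · exact h2 hab
  · exact h1 hab

theorem IsFourAt.σ_arm {G : OGraph} {x : G.E} (h : G.IsFourAt x) (j : Fin 4) :
    G.σ (G.arm x j) = G.arm x (j + 1) := by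
  fin_cases j
  · rfl
  · rfl
  · rfl
  · exact h.1

theorem IsFourAt.σ_mem_arm {G : OGraph} {x : G.E} (h : G.IsFourAt x) (e : G.E) :
    (∃ j, G.arm x j = G.σ e) ↔ ∃ j, G.arm x j = e := by
  constructor
  · rintro ⟨j, hj⟩
    refine ⟨j - 1, G.σ.injective ?_⟩
    rw [h.σ_arm, ← hj, sub_add_cancel]
  · rintro ⟨j, rfl⟩
    exact ⟨j + 1, (h.σ_arm j).symm⟩

theorem IsFourAt.σ_cube {G : OGraph} {x : G.E} (h : G.IsFourAt x) {e : G.E}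
    (he : ¬ ∃ j, G.arm x j = e) : G.σ (G.σ (G.σ e)) = e := by
  push Not at he
  exact h.2.2 e (he 0).symm (he 1).symm (he 2).symm (he 3).symm

theorem IsFourAt.not_free {G : OGraph} {x : G.E} (h : G.IsFourAt x) (j : Fin 4) :
    ¬ G.free (G.arm x j) := fun hf => by
  have := G.σ_free _ hf
  rw [h.σ_arm] at this
  have := h.arm_injective this
  revert this
  fin_cases j <;> simp

theorem IsFourAt.base_arm {G : OGraph} {x : G.E} (h : G.IsFourAt x) (j : Fin 4) :
    (G.σ * (List.formPerm [G.arm x 0, G.arm x 1, G.arm x 2, G.arm x 3])⁻¹) (G.arm x j)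
      = G.arm x j := by
  have key : (List.formPerm [G.arm x 0, G.arm x 1, G.arm x 2, G.arm x 3]) (G.arm x (j - 1))
      = G.arm x j := by
    have i := h.arm_injective
    have n : ∀ a b, a ≠ b → G.arm x a ≠ G.arm x b := fun a b hab hh => hab (i hh)
    fin_cases j <;>
      simp [List.formPerm_cons_cons, Equiv.swap_apply_def, i.eq_iff, show (-1 : Fin 4) = 3 from rfl]
  rw [Equiv.Perm.mul_apply]
  have : (List.formPerm [G.arm x 0, G.arm x 1, G.arm x 2, G.arm x 3])⁻¹ (G.arm x j)
      = G.arm x (j - 1) := by rw [Equiv.Perm.inv_eq_iff_eq, key]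
  rw [this, h.σ_arm, sub_add_cancel]

theorem base_of_not {G : OGraph} {x e : G.E} (he : ¬ ∃ j, G.arm x j = e) :
    (G.σ * (List.formPerm [G.arm x 0, G.arm x 1, G.arm x 2, G.arm x 3])⁻¹) e = G.σ e := by
  push Not at he
  rw [Equiv.Perm.mul_apply]
  congr 1
  rw [Equiv.Perm.inv_eq_iff_eq]
  symm
  apply List.formPerm_apply_of_notMem
  simp [(he 0).symm, (he 1).symm, (he 2).symm, (he 3).symm]

theorem split_injective (i : Fin 3) : Function.Injective (split i) := by
  revert i; decide

theorem resolveσ_of_not {G : OGraph} {x e : G.E} (i : Fin 3) (he : ¬ ∃ j, G.arm x j = e) :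
    G.resolveσ x i (Sum.inl e) = Sum.inl (G.σ e) := by
  have hb := base_of_not he
  push Not at he
  simp only [resolveσ, Equiv.Perm.mul_apply] at hb ⊢
  rw [List.formPerm_apply_of_notMem (l := [Sum.inr true, _, _]),
    List.formPerm_apply_of_notMem]
  · simpa using hb
  · simp [(he _).symm]
  · simp [(he _).symm]

theorem IsFourAt.resolveσ_split {G : OGraph} {x : G.E} (h : G.IsFourAt x) (i : Fin 3) :
    G.resolveσ x i (Sum.inl (G.arm x (split i 0))) = Sum.inl (G.arm x (split i 1)) ∧
    G.resolveσ x i (Sum.inl (G.arm x (split i 1))) = Sum.inr false ∧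
    G.resolveσ x i (Sum.inr false) = Sum.inl (G.arm x (split i 0)) ∧
    G.resolveσ x i (Sum.inr true) = Sum.inl (G.arm x (split i 2)) ∧
    G.resolveσ x i (Sum.inl (G.arm x (split i 2))) = Sum.inl (G.arm x (split i 3)) ∧
    G.resolveσ x i (Sum.inl (G.arm x (split i 3))) = Sum.inr true := by
  have hj := h.arm_injective
  have hs := split_injective i
  have hb := h.base_arm
  have hB : ∀ j, Equiv.sumCongr
      (G.σ * (List.formPerm [G.arm x 0, G.arm x 1, G.arm x 2, G.arm x 3])⁻¹)
      (1 : Equiv.Perm Bool) (Sum.inl (G.arm x j)) = Sum.inl (G.arm x j) := fun j => by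
    rw [Equiv.sumCongr_apply, Sum.map_inl, hb]
  have hC : ∀ b, Equiv.sumCongr
      (G.σ * (List.formPerm [G.arm x 0, G.arm x 1, G.arm x 2, G.arm x 3])⁻¹)
      (1 : Equiv.Perm Bool) (Sum.inr b) = Sum.inr b := fun b => rfl
  simp only [resolveσ]
  generalize Equiv.sumCongr
      (G.σ * (List.formPerm [G.arm x 0, G.arm x 1, G.arm x 2, G.arm x 3])⁻¹)
      (1 : Equiv.Perm Bool) = B at hB hC ⊢
  simp [List.formPerm_cons_cons, Equiv.swap_apply_def, hj.eq_iff, hs.eq_iff, hB, hC]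

theorem IsFourAt.exists_split {G : OGraph} {x : G.E} (i : Fin 3) {e : G.E}
    (he : ∃ j, G.arm x j = e) : e = G.arm x (split i 0) ∨ e = G.arm x (split i 1) ∨
      e = G.arm x (split i 2) ∨ e = G.arm x (split i 3) := by
  obtain ⟨j, rfl⟩ := he
  have : ∀ (i : Fin 3) (j : Fin 4), j = split i 0 ∨ j = split i 1 ∨ j = split i 2 ∨
    j = split i 3 := by decide
  rcases this i j with h | h | h | h <;> simp [← h]

/-- The `i`-th resolution of the 4-valent vertex at `x`. -/
abbrev resolve (G : OGraph) (x : G.E) (h : G.IsFourAt x) (i : Fin 3) : OGraph where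
  E := G.E ⊕ Bool
  finite := inferInstance
  σ := G.resolveσ x i
  rev := Sum.map G.rev not
  rev_rev := by rintro (e | e) <;> simp [G.rev_rev]
  rev_ne := by rintro (e | e) <;> simp [G.rev_ne]
  free := Sum.elim G.free (fun _ => False)
  free_rev := by
    rintro (e | e)
    · exact G.free_rev e
    · exact id
  σ_free := by
    rintro (e | e)
    · intro hf
      rw [resolveσ_of_not, G.σ_free e hf]
      rintro ⟨j, rfl⟩
      exact h.not_free j hf
    · exact False.elim

theorem resolve_σ_cube {G : OGraph} {x : G.E} (h : G.IsFourAt x) (i : Fin 3) (z : G.E ⊕ Bool) :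
    G.resolveσ x i (G.resolveσ x i (G.resolveσ x i z)) = z := by
  obtain ⟨h1, h2, h3, h4, h5, h6⟩ := h.resolveσ_split i
  rcases z with e | b
  · by_cases he : ∃ j, G.arm x j = e
    · rcases IsFourAt.exists_split i he with rfl | rfl | rfl | rfl <;> simp only [*]
    · rw [resolveσ_of_not i he, resolveσ_of_not i (by rwa [h.σ_mem_arm]),
        resolveσ_of_not i (by rwa [h.σ_mem_arm, h.σ_mem_arm]), h.σ_cube he]
  · cases b <;> simp only [*]

theorem resolve_σ_fixed {G : OGraph} {x : G.E} (h : G.IsFourAt x) (i : Fin 3) (z : G.E ⊕ Bool)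
    (hz : G.resolveσ x i z = z) : ∃ e, z = Sum.inl e ∧ G.σ e = e := by
  obtain ⟨h1, h2, h3, h4, h5, h6⟩ := h.resolveσ_split i
  have hj := h.arm_injective
  have hs := split_injective i
  rcases z with e | b
  · by_cases he : ∃ j, G.arm x j = e
    · exfalso
      rcases IsFourAt.exists_split i he with rfl | rfl | rfl | rfl <;>
        simp_all [hj.eq_iff, hs.eq_iff]
    · rw [resolveσ_of_not i he] at hz
      exact ⟨e, rfl, Sum.inl_injective hz⟩
  · cases b <;> simp_all

theorem IsUniTriFour.resolve {G : OGraph} {x : G.E} (h : G.IsUniTriFour x) (i : Fin 3) :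
    (G.resolve x h.1 i).IsUniTri := by
  refine ⟨resolve_σ_cube h.1 i, ?_⟩
  rintro z hz ⟨h1, h2⟩
  obtain ⟨e, rfl, he⟩ := resolve_σ_fixed h.1 i z h1
  obtain ⟨e', he', he''⟩ := resolve_σ_fixed h.1 i _ h2
  have : G.rev e = e' := Sum.inl_injective he'
  subst this
  exact h.2 e hz ⟨he, he''⟩

theorem IsTriFour.resolve {G : OGraph} {x : G.E} (h : G.IsTriFour x) (i : Fin 3) :
    (G.resolve x h.1 i).IsTri := by
  refine ⟨resolve_σ_cube h.1 i, ?_⟩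
  intro z hz h1
  obtain ⟨e, rfl, he⟩ := resolve_σ_fixed h.1 i z h1
  exact h.2 e hz he

end Resolve

section Attach

open scoped Classical

/-- The darts that appear when a leg is attached to an edge: at the new 3-valent vertex, `back`
and `fwd` (backward and forward along the edge) and `stem` (along the leg); and `tip`, which starts
at the new 1-valent vertex. -/
inductive LegDart : Type
  | back
  | fwd
  | stem
  | tip

theorem LegDart.eq_of (d : LegDart) : d = .back ∨ d = .fwd ∨ d = .stem ∨ d = .tip := by
  cases d <;> simp

instance : Finite LegDart :=
  Finite.of_surjective (fun i : Fin 4 => ![LegDart.back, .fwd, .stem, .tip] i) fun d => by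
    rcases d.eq_of with h | h | h | h
    · exact ⟨0, h.symm⟩
    · exact ⟨1, h.symm⟩
    · exact ⟨2, h.symm⟩
    · exact ⟨3, h.symm⟩

/-- Orientation reversal after a leg is attached to the edge of `e`: the edge is cut into the two
edges `{e, back}` and `{fwd, rev e}`, and the edge `{stem, tip}` is added. -/
def edgeRev (G : OGraph) (e : G.E) : G.E ⊕ LegDart → G.E ⊕ LegDart
  | .inl h => if h = e then .inr .back else if h = G.rev e then .inr .fwd else .inl (G.rev h)
  | .inr .back => .inl e
  | .inr .fwd => .inl (G.rev e)
  | .inr .stem => .inr .tip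
  | .inr .tip => .inr .stem

/-- The cyclic orders after a leg is attached to an edge: the order at the new vertex is
(forward, leg, backward). -/
def edgeσ (G : OGraph) : Equiv.Perm (G.E ⊕ LegDart) :=
  Equiv.sumCongr G.σ (List.formPerm [.fwd, .stem, .back])

/-- A leg is attached to the edge of `e`, on the left-hand side with respect to the orientation
`e`: the counterclockwise order at the new vertex is (forward, leg, backward). -/
abbrev attachEdge (G : OGraph) (e : G.E) (he : ¬ G.free e) : OGraph where
  E := G.E ⊕ LegDart
  finite := inferInstance
  σ := G.edgeσ
  rev := G.edgeRev e
  rev_rev := by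
    have h1 := G.rev_ne e
    have h2 := G.rev_rev
    rintro (h | h | h | h | h)
    · simp only [edgeRev]
      split_ifs with ha hb
      · simp [ha]
      · simp [hb]
      · have hc : G.rev h ≠ e := fun hc => hb (by rw [← hc, h2])
        have hd : G.rev h ≠ G.rev e := fun hd => ha (by rw [← h2 h, hd, h2])
        simp [hc, hd, h2]
    · simp [edgeRev]
    · simp [edgeRev, h1]
    · simp [edgeRev]
    · simp [edgeRev]
  rev_ne := by
    rintro (h | h | h | h | h)
    · simp only [edgeRev]
      split_ifs <;> simp [G.rev_ne]
    all_goals simp [edgeRev]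
  free := Sum.elim G.free (fun _ => False)
  free_rev := by
    rintro (h | h)
    · intro hf
      have ha : h ≠ e := by rintro rfl; exact he hf
      have hb : h ≠ G.rev e := by
        rintro rfl
        exact he (by rw [← G.rev_rev e]; exact G.free_rev _ hf)
      simpa [edgeRev, ha, hb] using G.free_rev _ hf
    · exact False.elim
  σ_free := by
    rintro (h | h)
    · intro hf
      exact congrArg Sum.inl (G.σ_free _ hf)
    · exact False.elim

/-- The cyclic orders after a leg is attached to the vertexless circle with the orientation `e`:
the order at the new vertex is `e` (forward), `false` (the leg), `rev e` (backward). -/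
def circleσ (G : OGraph) (e : G.E) : Equiv.Perm (G.E ⊕ Bool) :=
  Equiv.sumCongr G.σ 1 * List.formPerm [.inl e, .inr false, .inl (G.rev e)]

/-- A leg is attached to the vertexless circle with the orientation `e`, on its left-hand side.
The new vertex has the darts `e` (forward), `false` (the leg) and `rev e` (backward), in
counterclockwise order; `true` starts at the new 1-valent vertex. -/
abbrev attachCircle (G : OGraph) (e : G.E) (_he : G.free e) : OGraph where
  E := G.E ⊕ Bool
  finite := inferInstance
  σ := G.circleσ e
  rev := Sum.map G.rev not
  rev_rev := by rintro (e | e) <;> simp [G.rev_rev]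
  rev_ne := by rintro (e | e) <;> simp [G.rev_ne]
  free := Sum.elim (fun h => G.free h ∧ h ≠ e ∧ h ≠ G.rev e) (fun _ => False)
  free_rev := by
    have h2 := G.rev_rev
    rintro (h | h)
    · rintro ⟨hf, ha, hb⟩
      exact ⟨G.free_rev _ hf, fun hc => hb (by rw [← hc, h2]),
        fun hd => ha (by rw [← h2 h, hd, h2])⟩
    · exact False.elim
  σ_free := by
    rintro (h | h)
    · rintro ⟨hf, ha, hb⟩
      rw [circleσ, Equiv.Perm.mul_apply, List.formPerm_apply_of_notMem (by simp [ha, hb])]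
      simp [G.σ_free _ hf]
    · exact False.elim

theorem edgeσ_inr (G : OGraph) :
    G.edgeσ (.inr .fwd) = .inr .stem ∧
    G.edgeσ (.inr .stem) = .inr .back ∧
    G.edgeσ (.inr .back) = .inr .fwd ∧
    G.edgeσ (.inr .tip) = .inr .tip := by
  simp [edgeσ, List.formPerm_cons_cons, Equiv.swap_apply_def]

theorem IsUniTri.attachEdge {G : OGraph} (hG : G.IsUniTri) (e : G.E) (he : ¬ G.free e) :
    (G.attachEdge e he).IsUniTri := by
  obtain ⟨s1, s2, s3, s4⟩ := G.edgeσ_inr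
  constructor
  · change ∀ z, G.edgeσ (G.edgeσ (G.edgeσ z)) = z
    rintro (h | h | h | h | h)
    · exact congrArg Sum.inl (hG.1 h)
    all_goals simp only [*]
  · change ∀ z, ¬ Sum.elim G.free (fun _ => False) z →
      ¬ (G.edgeσ z = z ∧ G.edgeσ (G.edgeRev e z) = G.edgeRev e z)
    rintro (h | h | h | h | h)
    · rintro hf ⟨ha, hb⟩
      have ha' : G.σ h = h := Sum.inl_injective ha
      change G.edgeσ (G.edgeRev e (.inl h)) = G.edgeRev e (.inl h) at hb
      simp only [edgeRev] at hb
      split_ifs at hb with hc hd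
      · rw [s3] at hb
        simp at hb
      · rw [s1] at hb
        simp at hb
      · exact hG.2 h hf ⟨ha', Sum.inl_injective hb⟩
    · rintro - ⟨ha, -⟩
      rw [s3] at ha
      simp at ha
    · rintro - ⟨ha, -⟩
      rw [s1] at ha
      simp at ha
    · rintro - ⟨ha, -⟩
      rw [s2] at ha
      simp at ha
    · rintro - ⟨-, ha⟩
      change G.edgeσ (.inr .stem) = .inr .stem at ha
      rw [s2] at ha
      simp at ha

theorem circleσ_apply (G : OGraph) (e : G.E) (he : G.free e) :
    G.circleσ e (.inl e) = .inr false ∧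
    G.circleσ e (.inr false) = .inl (G.rev e) ∧
    G.circleσ e (.inl (G.rev e)) = .inl e ∧
    G.circleσ e (.inr true) = .inr true ∧
    ∀ h, h ≠ e → h ≠ G.rev e → G.circleσ e (.inl h) = .inl (G.σ h) := by
  have h1 := G.rev_ne e
  refine ⟨?_, ?_, ?_, ?_, fun h ha hb => ?_⟩ <;>
    simp [circleσ, List.formPerm_cons_cons, Equiv.swap_apply_def, G.σ_free e he,
      G.σ_free _ (G.free_rev e he), h1.symm, *]

theorem IsUniTri.attachCircle {G : OGraph} (hG : G.IsUniTri) (e : G.E) (he : G.free e) :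
    (G.attachCircle e he).IsUniTri := by
  obtain ⟨s1, s2, s3, s4, s5⟩ := G.circleσ_apply e he
  have hr := G.rev_ne e
  have key : ∀ h, h ≠ e → h ≠ G.rev e → G.σ h ≠ e ∧ G.σ h ≠ G.rev e := by
    intro h ha hb
    refine ⟨fun hc => ha (G.σ.injective ?_), fun hc => hb (G.σ.injective ?_)⟩
    · rw [hc, G.σ_free e he]
    · rw [hc, G.σ_free _ (G.free_rev e he)]
  constructor
  · change ∀ z, G.circleσ e (G.circleσ e (G.circleσ e z)) = z
    rintro (h | b)
    · by_cases ha : h = e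
      · subst ha
        rw [s1, s2, s3]
      by_cases hb : h = G.rev e
      · subst hb
        rw [s3, s1, s2]
      have k1 := key h ha hb
      have k2 := key _ k1.1 k1.2
      rw [s5 h ha hb, s5 _ k1.1 k1.2, s5 _ k2.1 k2.2, hG.1]
    · cases b
      · rw [s2, s3, s1]
      · rw [s4, s4, s4]
  · change ∀ z, ¬ Sum.elim (fun h => G.free h ∧ h ≠ e ∧ h ≠ G.rev e) (fun _ => False) z →
      ¬ (G.circleσ e z = z ∧ G.circleσ e (Sum.map G.rev not z) = Sum.map G.rev not z)
    rintro (h | b)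
    · rintro hf ⟨h1, h2⟩
      by_cases ha : h = e
      · subst ha
        rw [s1] at h1
        simp at h1
      by_cases hb : h = G.rev e
      · subst hb
        rw [s3] at h1
        exact hr (Sum.inl_injective h1).symm
      have ha' : G.rev h ≠ e := fun hc => hb (by rw [← hc, G.rev_rev])
      have hb' : G.rev h ≠ G.rev e := fun hd => ha (by rw [← G.rev_rev h, hd, G.rev_rev])
      rw [s5 h ha hb] at h1
      change G.circleσ e (.inl (G.rev h)) = .inl (G.rev h) at h2
      rw [s5 _ ha' hb'] at h2
      exact hG.2 h (fun hh => hf ⟨hh, ha, hb⟩) ⟨Sum.inl_injective h1, Sum.inl_injective h2⟩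
    · cases b
      · rintro - ⟨h1, -⟩
        rw [s2] at h1
        simp at h1
      · rintro - ⟨-, h1⟩
        change G.circleσ e (.inr false) = .inr false at h1
        rw [s2] at h1
        simp at h1

end Attach

theorem IsUniTri.union {G H : OGraph} (hG : G.IsUniTri) (hH : H.IsUniTri) :
    (G.union H).IsUniTri := by
  constructor
  · rintro (e | e)
    · exact congrArg Sum.inl (hG.1 e)
    · exact congrArg Sum.inr (hH.1 e)
  · rintro (e | e) he ⟨h1, h2⟩
    · exact hG.2 e he ⟨Sum.inl_injective h1, Sum.inl_injective h2⟩
    · exact hH.2 e he ⟨Sum.inr_injective h1, Sum.inr_injective h2⟩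

theorem IsTri.union {G H : OGraph} (hG : G.IsTri) (hH : H.IsTri) :
    (G.union H).IsTri := by
  constructor
  · rintro (e | e)
    · exact congrArg Sum.inl (hG.1 e)
    · exact congrArg Sum.inr (hH.1 e)
  · rintro (e | e) he h1
    · exact hG.2 e he (Sum.inl_injective h1)
    · exact hH.2 e he (Sum.inr_injective h1)

theorem isTri_empty : empty.IsTri := ⟨fun e => e.elim, fun e => e.elim⟩

end OGraph

namespace Iso

variable {G G' H H' J : OGraph}

def union (f : Iso G G') (g : Iso H H') : Iso (G.union H) (G'.union H') where
  toEquiv := Equiv.sumCongr f.toEquiv g.toEquiv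
  map_σ := by
    rintro (e | e)
    · exact congrArg Sum.inl (f.map_σ e)
    · exact congrArg Sum.inr (g.map_σ e)
  map_rev := by
    rintro (e | e)
    · exact congrArg Sum.inl (f.map_rev e)
    · exact congrArg Sum.inr (g.map_rev e)
  map_free := by
    rintro (e | e)
    · exact f.map_free e
    · exact g.map_free e

def unionComm (G H : OGraph) : Iso (G.union H) (H.union G) where
  toEquiv := Equiv.sumComm _ _
  map_σ := by rintro (e | e) <;> rfl
  map_rev := by rintro (e | e) <;> rfl
  map_free := by rintro (e | e) <;> rfl

def unionAssoc (G H J : OGraph) : Iso ((G.union H).union J) (G.union (H.union J)) where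
  toEquiv := Equiv.sumAssoc _ _ _
  map_σ := by rintro ((e | e) | e) <;> rfl
  map_rev := by rintro ((e | e) | e) <;> rfl
  map_free := by rintro ((e | e) | e) <;> rfl

def emptyUnion (G : OGraph) : Iso (OGraph.empty.union G) G where
  toEquiv := Equiv.emptySum Empty G.E
  map_σ := by rintro (e | e); exacts [e.elim, rfl]
  map_rev := by rintro (e | e); exacts [e.elim, rfl]
  map_free := by rintro (e | e); exacts [e.elim, Iff.rfl]

end Iso

section UnionCompat

open scoped Classical
open OGraph

variable {G : OGraph}

theorem flipSwap_union_inl (H : OGraph) (e h : G.E) :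
    (G.union H).flipSwap (.inl e) (.inl h) = .inl (G.flipSwap e h) := by
  simp only [flipSwap, Equiv.swap_apply_def, Equiv.sumCongr_apply, Equiv.sumCongr_symm,
    Sum.map_inl, Sum.inl.injEq]
  split_ifs <;> rfl

theorem flipSwap_union_inr (H : OGraph) (e : G.E) (h : H.E) :
    (G.union H).flipSwap (.inl e) (.inr h) = .inr h := by
  simp only [flipSwap, Equiv.swap_apply_def, Equiv.sumCongr_apply, Equiv.sumCongr_symm,
    Sum.map_inl, reduceCtorEq, if_false]

/-- Reversal of a cyclic order commutes with disjoint union. -/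
def Iso.flipUnion (H : OGraph) (e : G.E) :
    Iso ((G.flip e).union H) ((G.union H).flip (.inl e)) where
  toEquiv := Equiv.refl (G.E ⊕ H.E)
  map_σ := by
    rintro (h | h)
    · change Sum.inl (G.flipSwap e (G.σ (G.flipSwap e h))) =
        (G.union H).flipSwap (.inl e) ((G.union H).σ ((G.union H).flipSwap (.inl e) (.inl h)))
      rw [flipSwap_union_inl]
      exact (flipSwap_union_inl H e _).symm
    · change Sum.inr (H.σ h) =
        (G.union H).flipSwap (.inl e) ((G.union H).σ ((G.union H).flipSwap (.inl e) (.inr h)))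
      rw [flipSwap_union_inr]
      exact (flipSwap_union_inr H e _).symm
  map_rev := fun _ => rfl
  map_free := fun _ => Iff.rfl

theorem arm_union (H : OGraph) (x : G.E) (j : Fin 4) :
    (G.union H).arm (.inl x) j = .inl (G.arm x j) := by
  fin_cases j <;> rfl

theorem OGraph.IsFourAt.union {x : G.E} (h : G.IsFourAt x) {H : OGraph}
    (hH : ∀ e, H.σ (H.σ (H.σ e)) = e) : (G.union H).IsFourAt (.inl x) := by
  refine ⟨congrArg Sum.inl h.1, fun hh => h.2.1 (Sum.inl_injective hh), ?_⟩
  rintro (e | e) h0 h1 h2 h3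
  · exact congrArg Sum.inl (h.2.2 e (fun h => h0 (congrArg Sum.inl h))
      (fun h => h1 (congrArg Sum.inl h)) (fun h => h2 (congrArg Sum.inl h))
      (fun h => h3 (congrArg Sum.inl h)))
  · exact congrArg Sum.inr (hH e)

theorem OGraph.IsUniTriFour.union {x : G.E} (h : G.IsUniTriFour x) {H : OGraph}
    (hH : H.IsUniTri) : (G.union H).IsUniTriFour (.inl x) := by
  refine ⟨h.1.union hH.1, ?_⟩
  rintro (e | e) he ⟨h1, h2⟩
  · exact h.2 e he ⟨Sum.inl_injective h1, Sum.inl_injective h2⟩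
  · exact hH.2 e he ⟨Sum.inr_injective h1, Sum.inr_injective h2⟩

theorem OGraph.IsTriFour.union {x : G.E} (h : G.IsTriFour x) {H : OGraph}
    (hH : H.IsTri) : (G.union H).IsTriFour (.inl x) := by
  refine ⟨h.1.union hH.1, ?_⟩
  rintro (e | e) he h1
  · exact h.2 e he (Sum.inl_injective h1)
  · exact hH.2 e he (Sum.inr_injective h1)

/-- The bijection `(A ⊕ B) ⊕ C ≃ (A ⊕ C) ⊕ B`. -/
def sumSwapRight (A B C : Type) : (A ⊕ B) ⊕ C ≃ (A ⊕ C) ⊕ B where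
  toFun := Sum.elim (Sum.elim (fun a => .inl (.inl a)) .inr) (fun c => .inl (.inr c))
  invFun := Sum.elim (Sum.elim (fun a => .inl (.inl a)) .inr) (fun c => .inl (.inr c))
  left_inv := by rintro ((a | b) | c) <;> rfl
  right_inv := by rintro ((a | b) | c) <;> rfl

/-- Resolution of a 4-valent vertex commutes with disjoint union. -/
def Iso.resolveUnion (H : OGraph) {x : G.E} (h : G.IsFourAt x)
    (h' : (G.union H).IsFourAt (.inl x)) (i : Fin 3) :
    Iso ((G.resolve x h i).union H) ((G.union H).resolve (.inl x) h' i) where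
  toEquiv := sumSwapRight G.E Bool H.E
  map_σ := by
    obtain ⟨a1, a2, a3, a4, a5, a6⟩ := h.resolveσ_split i
    obtain ⟨b1, b2, b3, b4, b5, b6⟩ := h'.resolveσ_split i
    simp only [arm_union] at b1 b2 b3 b4 b5 b6
    rintro ((e | b) | e)
    · change sumSwapRight G.E Bool H.E (.inl (G.resolveσ x i (.inl e))) =
        (G.union H).resolveσ (.inl x) i (.inl (.inl e))
      by_cases he : ∃ j, G.arm x j = e
      · rcases IsFourAt.exists_split i he with rfl | rfl | rfl | rfl
        · rw [a1, b1]; rfl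
        · rw [a2, b2]; rfl
        · rw [a5, b5]; rfl
        · rw [a6, b6]; rfl
      · rw [resolveσ_of_not i he, resolveσ_of_not]
        · rfl
        · rintro ⟨j, hj⟩
          rw [arm_union] at hj
          exact he ⟨j, Sum.inl_injective hj⟩
    · change sumSwapRight G.E Bool H.E (.inl (G.resolveσ x i (.inr b))) =
        (G.union H).resolveσ (.inl x) i (.inr b)
      cases b
      · rw [a3, b3]; rfl
      · rw [a4, b4]; rfl
    · change (Sum.inl (.inr (H.σ e)) : (G.E ⊕ H.E) ⊕ Bool) =
        (G.union H).resolveσ (.inl x) i (.inl (.inr e))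
      rw [resolveσ_of_not]
      · rfl
      · rintro ⟨j, hj⟩
        rw [arm_union] at hj
        cases hj
  map_rev := by rintro ((e | b) | e) <;> rfl
  map_free := by rintro ((e | b) | e) <;> rfl

end UnionCompat

/-! ### The algebra of (1,3)-valent graphs -/

/-- (1,3)-valent graphs with cyclic orders at the 3-valent vertices. -/
abbrev UTGraph : Type 1 := {G : OGraph // G.IsUniTri}

namespace UTGraph

abbrev union (G H : UTGraph) : UTGraph := ⟨G.1.union H.1, G.2.union H.2⟩

abbrev flip (G : UTGraph) (e : G.1.E) (he : G.1.σ e ≠ e) : UTGraph := ⟨G.1.flip e, G.2.flip e he⟩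

abbrev attachEdge (G : UTGraph) (e : G.1.E) (he : ¬ G.1.free e) : UTGraph :=
  ⟨G.1.attachEdge e he, G.2.attachEdge e he⟩

abbrev attachCircle (G : UTGraph) (e : G.1.E) (he : G.1.free e) : UTGraph :=
  ⟨G.1.attachCircle e he, G.2.attachCircle e he⟩

instance setoid : Setoid UTGraph where
  r G H := Nonempty (Iso G.1 H.1)
  iseqv := ⟨fun G => ⟨Iso.refl G.1⟩, fun ⟨f⟩ => ⟨f.symm⟩, fun ⟨f⟩ ⟨g⟩ => ⟨f.trans g⟩⟩

end UTGraph

/-- Isomorphism classes of (1,3)-valent graphs. -/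
def UTClass : Type 1 := Quotient UTGraph.setoid

namespace UTClass

def mk (G : UTGraph) : UTClass := Quotient.mk _ G

theorem mk_eq {G H : UTGraph} (f : Iso G.1 H.1) : mk G = mk H := Quotient.sound ⟨f⟩

/-- The commutative monoid of isomorphism classes under disjoint union. -/
instance : CommMonoid UTClass where
  mul := Quotient.map₂ UTGraph.union (fun _ _ ⟨f⟩ _ _ ⟨g⟩ => ⟨f.union g⟩)
  one := mk ⟨OGraph.empty, OGraph.isTri_empty.isUniTri⟩
  mul_assoc := by
    rintro ⟨a⟩ ⟨b⟩ ⟨c⟩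
    exact mk_eq (Iso.unionAssoc a.1 b.1 c.1)
  mul_comm := by
    rintro ⟨a⟩ ⟨b⟩
    exact mk_eq (Iso.unionComm a.1 b.1)
  one_mul := by
    rintro ⟨a⟩
    exact mk_eq (Iso.emptyUnion a.1)
  mul_one := by
    rintro ⟨a⟩
    exact mk_eq ((Iso.unionComm _ _).trans (Iso.emptyUnion a.1))

theorem mk_mul (G H : UTGraph) : mk G * mk H = mk (G.union H) := rfl

end UTClass

section B

variable (K : Type*) [Field K]

/-- The free vector space on (1,3)-valent graphs (up to isomorphism), an algebra under disjoint
union. -/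
abbrev BTilde := MonoidAlgebra K UTClass

/-- The basis vector of a graph. -/
def BTilde.graph (G : UTGraph) : BTilde K := MonoidAlgebra.of K UTClass (UTClass.mk G)

variable {K} in
theorem BTilde.graph_congr {G H : UTGraph} (f : Iso G.1 H.1) :
    BTilde.graph K G = BTilde.graph K H := by
  rw [BTilde.graph, UTClass.mk_eq f, BTilde.graph]

theorem BTilde.graph_mul (G H : UTGraph) :
    BTilde.graph K G * BTilde.graph K H = BTilde.graph K (G.union H) := by
  rw [BTilde.graph, BTilde.graph, ← map_mul, UTClass.mk_mul, BTilde.graph]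

/-- The span of the sums of two graphs that differ by the cyclic order at one 3-valent vertex. -/
def BTilde.AS : Submodule K (BTilde K) :=
  Submodule.span K {z | ∃ (G : UTGraph) (e : G.1.E) (he : G.1.σ e ≠ e),
    z = BTilde.graph K G + BTilde.graph K (G.flip e he)}

/-- The span of the alternating sums of the three resolutions of graphs with one 4-valent
vertex. -/
def BTilde.IHX : Submodule K (BTilde K) :=
  Submodule.span K {z | ∃ (G : OGraph) (x : G.E) (h : G.IsUniTriFour x),
    z = BTilde.graph K ⟨G.resolve x h.1 0, h.resolve 0⟩
      - BTilde.graph K ⟨G.resolve x h.1 1, h.resolve 1⟩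
      + BTilde.graph K ⟨G.resolve x h.1 2, h.resolve 2⟩}

theorem BTilde.graph_mul_mem (H : UTGraph) {z : BTilde K}
    (hz : z ∈ BTilde.AS K ⊔ BTilde.IHX K) :
    z * BTilde.graph K H ∈ BTilde.AS K ⊔ BTilde.IHX K := by
  have hle : BTilde.AS K ⊔ BTilde.IHX K ≤
      (BTilde.AS K ⊔ BTilde.IHX K).comap (LinearMap.mulRight K (BTilde.graph K H)) := by
    refine sup_le (Submodule.span_le.2 ?_) (Submodule.span_le.2 ?_)
    · rintro _ ⟨G, e, he, rfl⟩
      refine Submodule.mem_sup_left (Submodule.subset_span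
        ⟨G.union H, .inl e, fun hh => he (Sum.inl_injective hh), ?_⟩)
      rw [LinearMap.mulRight_apply, add_mul, BTilde.graph_mul, BTilde.graph_mul]
      congr 1
      exact BTilde.graph_congr (Iso.flipUnion H.1 e)
    · rintro _ ⟨G, x, h, rfl⟩
      refine Submodule.mem_sup_right (Submodule.subset_span
        ⟨G.union H.1, .inl x, h.union H.2, ?_⟩)
      rw [LinearMap.mulRight_apply, add_mul, sub_mul, BTilde.graph_mul, BTilde.graph_mul,
        BTilde.graph_mul]
      congr 1
      · congr 1
        · exact BTilde.graph_congr (Iso.resolveUnion H.1 h.1 (h.1.union H.2.1) 0)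
        · exact BTilde.graph_congr (Iso.resolveUnion H.1 h.1 (h.1.union H.2.1) 1)
      · exact BTilde.graph_congr (Iso.resolveUnion H.1 h.1 (h.1.union H.2.1) 2)
  exact hle hz

/-- The subspace `AS + IHX` is an ideal. -/
def BTilde.relIdeal : Ideal (BTilde K) :=
  { BTilde.AS K ⊔ BTilde.IHX K with
    smul_mem' := fun a z hz => by
      have : ∀ a : BTilde K, z * a ∈ BTilde.AS K ⊔ BTilde.IHX K := by
        intro a
        induction a using MonoidAlgebra.induction_on with
        | of g =>
          induction g using Quotient.inductionOn with
          | h G => exact BTilde.graph_mul_mem K G hz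
        | add a b ha hb =>
          rw [mul_add]
          exact Submodule.add_mem _ ha hb
        | smul r a ha =>
          rw [mul_smul_comm]
          exact Submodule.smul_mem _ r ha
      rw [smul_eq_mul, mul_comm]
      exact this a }

/-- The algebra `B` of (1,3)-valent graphs modulo AS and IHX. -/
abbrev B := BTilde K ⧸ BTilde.relIdeal K

/-- The class of a graph in `B`. -/
def B.graph (G : UTGraph) : B K := Ideal.Quotient.mk _ (BTilde.graph K G)

/-- The subspace `B_{m,n}`, spanned by the graphs with `m` 1-valent vertices and second
degree `n`. -/
def B.deg (m n : ℕ) : Submodule K (B K) :=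
  Submodule.span K {z | ∃ G : UTGraph, G.1.numLegs = m ∧ G.1.deg₂ = n ∧ z = B.graph K G}

end B

/-! ### Cohomology of graphs -/

section Cohomology

variable (K : Type*) [Field K]

/-- Cellular 1-cochains: functions on oriented edges that change sign under reversal. -/
def cochains (G : OGraph) : Submodule K (G.E → K) where
  carrier := {c | ∀ e, c (G.rev e) = - c e}
  add_mem' {a b} ha hb e := by simp only [Pi.add_apply, ha e, hb e]; ring
  zero_mem' e := by simp
  smul_mem' r c hc e := by simp only [Pi.smul_apply, hc e, smul_neg]

/-- Coboundaries of 0-cochains.  A 0-cochain is a function on the vertices, given as the function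
`φ` whose value at a dart is the value at the vertex where the dart starts. (A circle without
vertices contributes no coboundary.) -/
def coboundaries (G : OGraph) : Submodule K (G.E → K) where
  carrier := {c | ∃ φ : G.E → K, (∀ e, φ (G.σ e) = φ e) ∧ (∀ e, G.free e → φ e = 0) ∧
    ∀ e, c e = φ (G.rev e) - φ e}
  add_mem' := by
    rintro a b ⟨φ, h1, h2, h3⟩ ⟨ψ, k1, k2, k3⟩
    refine ⟨φ + ψ, fun e => by simp [h1, k1], fun e he => by simp [h2 e he, k2 e he], fun e => ?_⟩
    simp only [Pi.add_apply, h3, k3]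
    ring
  zero_mem' := ⟨0, fun _ => rfl, fun _ _ => rfl, fun e => by simp⟩
  smul_mem' := by
    rintro r a ⟨φ, h1, h2, h3⟩
    refine ⟨r • φ, fun e => by simp [h1], fun e he => by simp [h2 e he], fun e => ?_⟩
    simp only [Pi.smul_apply, h3, smul_sub]

/-- The first cohomology `H¹(G; K)`. -/
def H1 (G : OGraph) := cochains K G ⧸ (coboundaries K G).submoduleOf (cochains K G)

instance (G : OGraph) : AddCommGroup (H1 K G) :=
  inferInstanceAs (AddCommGroup (cochains K G ⧸ (coboundaries K G).submoduleOf (cochains K G)))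

instance (G : OGraph) : Module K (H1 K G) :=
  inferInstanceAs (Module K (cochains K G ⧸ (coboundaries K G).submoduleOf (cochains K G)))

/-- The class of a 1-cochain. -/
def H1.mk (G : OGraph) : cochains K G →ₗ[K] H1 K G :=
  ((coboundaries K G).submoduleOf (cochains K G)).mkQ

/-- The symmetric algebra of `H¹(G; K)`. -/
def SH1 (G : OGraph) := SymmetricAlgebra K (H1 K G)

instance (G : OGraph) : CommRing (SH1 K G) :=
  inferInstanceAs (CommRing (SymmetricAlgebra K (H1 K G)))

instance (G : OGraph) : Algebra K (SH1 K G) :=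
  inferInstanceAs (Algebra K (SymmetricAlgebra K (H1 K G)))

/-- The inclusion of `H¹` into its symmetric algebra. -/
def SH1.ι (G : OGraph) : H1 K G →ₗ[K] SH1 K G := SymmetricAlgebra.ι K (H1 K G)

open scoped Classical in
/-- The 1-cochain dual to the oriented edge `e`: `1` on `e`, `-1` on its reversal, `0` elsewhere. -/
def dualCochain (G : OGraph) (e : G.E) : cochains K G :=
  ⟨Pi.single e 1 - Pi.single (G.rev e) 1, fun h => by
    have h1 : G.rev h = e ↔ h = G.rev e :=
      ⟨fun hh => by rw [← hh, G.rev_rev], fun hh => by rw [hh, G.rev_rev]⟩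
    have h2 : G.rev h = G.rev e ↔ h = e :=
      ⟨fun hh => by rw [← G.rev_rev h, hh, G.rev_rev], fun hh => by rw [hh]⟩
    simp only [Pi.sub_apply, Pi.single_apply, h1, h2]
    ring⟩

/-- The class in `H¹` dual to the oriented edge `e`. -/
def edgeClass (G : OGraph) (e : G.E) : H1 K G := H1.mk K G (dualCochain K G e)

variable {K} {G H J : OGraph}

/-- Pullback of functions on darts along a partially defined map of darts (the value is `0` on the
darts that are sent nowhere, that is, removed or collapsed). -/
def pull (r : H.E → Option G.E) : (G.E → K) →ₗ[K] (H.E → K) where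
  toFun c h := (r h).elim 0 c
  map_add' a b := by
    ext h
    cases hr : r h <;> simp [hr]
  map_smul' a b := by
    ext h
    cases hr : r h <;> simp [hr]

theorem pull_apply (r : H.E → Option G.E) (c : G.E → K) (h : H.E) :
    pull r c h = (r h).elim 0 c := rfl

/-- A partial map of darts that is compatible with reversal and sends coboundaries to coboundaries
(the chain map in degree 1 of a cellular map of graphs, or of the projection of a disjoint union
to one of its parts). -/
structure Collapse (K : Type*) [Field K] (G H : OGraph) where
  r : H.E → Option G.E
  r_rev : ∀ h, r (H.rev h) = (r h).map G.rev
  cob : ∀ c ∈ coboundaries K G, pull r c ∈ coboundaries K H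

namespace Collapse

theorem pull_mem (f : Collapse K G H) (c : G.E → K) (hc : c ∈ cochains K G) :
    pull f.r c ∈ cochains K H := by
  intro h
  rw [pull_apply, pull_apply, f.r_rev]
  cases f.r h
  · simp
  · exact hc _

/-- The map induced on `H¹`. -/
def H1map (f : Collapse K G H) : H1 K G →ₗ[K] H1 K H :=
  Submodule.mapQ _ _ ((pull f.r).restrict f.pull_mem) fun c hc => f.cob c hc

/-- The algebra homomorphism induced on the symmetric algebras of `H¹`. -/
def S (f : Collapse K G H) : SH1 K G →ₐ[K] SH1 K H :=
  SymmetricAlgebra.lift (A := SH1 K H) (SH1.ι K H ∘ₗ f.H1map)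

theorem H1map_mk (f : Collapse K G H) (c : cochains K G) :
    f.H1map (H1.mk K G c) = H1.mk K H ((pull f.r).restrict f.pull_mem c) := rfl

theorem S_ι (f : Collapse K G H) (x : H1 K G) :
    f.S (SH1.ι K G x) = SH1.ι K H (f.H1map x) :=
  SymmetricAlgebra.lift_ι_apply (A := SH1 K H) (SH1.ι K H ∘ₗ f.H1map) x

theorem algHom_ext {A : Type*} [CommRing A] [Algebra K A] {f g : SH1 K G →ₐ[K] A}
    (h : ∀ c, f (SH1.ι K G (H1.mk K G c)) = g (SH1.ι K G (H1.mk K G c))) : f = g := by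
  refine SymmetricAlgebra.algHom_ext (F := f) (G := g) (LinearMap.ext fun x => ?_)
  obtain ⟨c, rfl⟩ := Submodule.mkQ_surjective _ x
  exact h c

def comp (g : Collapse K H J) (f : Collapse K G H) : Collapse K G J where
  r j := (g.r j).bind f.r
  r_rev j := by
    rw [g.r_rev]
    cases hj : g.r j <;> simp [f.r_rev]
  cob c hc := by
    have := g.cob _ (f.cob c hc)
    convert this using 1
    ext j
    simp only [pull_apply]
    cases g.r j <;> rfl

theorem comp_S (g : Collapse K H J) (f : Collapse K G H) (x : SH1 K G) :
    (g.comp f).S x = g.S (f.S x) := by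
  have : (g.comp f).S = g.S.comp f.S := by
    refine algHom_ext fun c => ?_
    rw [AlgHom.comp_apply, S_ι, S_ι, S_ι, H1map_mk, H1map_mk, H1map_mk]
    congr 2
    ext j
    change pull (g.comp f).r c.1 j = pull g.r (pull f.r c.1) j
    simp only [pull_apply, comp]
    cases g.r j <;> rfl
  rw [this, AlgHom.comp_apply]

theorem S_congr {f g : Collapse K G H} (h : ∀ e, f.r e = g.r e) : f = g := by
  cases f
  cases g
  congr
  exact funext h

theorem S_id {f : Collapse K G G} (h : ∀ e, f.r e = some e) (x : SH1 K G) :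
    f.S x = x := by
  have : f.S = AlgHom.id K _ := by
    refine algHom_ext fun c => ?_
    rw [AlgHom.id_apply, S_ι, H1map_mk]
    congr 2
    ext j
    change pull f.r c.1 j = c.1 j
    rw [pull_apply, h]
    rfl
  rw [this, AlgHom.id_apply]

variable (K)

/-- The map `H¹(G) → H¹(H)` of an isomorphism `G → H` (pullback along the inverse). -/
def ofIso (f : Iso G H) : Collapse K G H where
  r h := some (f.symm.toEquiv h)
  r_rev h := by simp [f.symm.map_rev]
  cob := by
    rintro c ⟨φ, h1, h2, h3⟩
    refine ⟨fun h => φ (f.symm.toEquiv h), fun h => ?_, fun h hh => ?_, fun h => ?_⟩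
    · beta_reduce
      rw [f.symm.map_σ, h1]
    · exact h2 _ ((f.symm.map_free h).2 hh)
    · beta_reduce
      rw [f.symm.map_rev, pull_apply]
      exact h3 _

/-- The inclusion `H¹(G) → H¹(G ∪ H) = H¹(G) ⊕ H¹(H)`. -/
def inl (G H : OGraph) : Collapse K G (G.union H) where
  r := Sum.elim some (fun _ => none)
  r_rev := by rintro (e | e) <;> rfl
  cob := by
    rintro c ⟨φ, h1, h2, h3⟩
    refine ⟨Sum.elim φ 0, ?_, ?_, ?_⟩
    · rintro (e | e)
      exacts [h1 e, rfl]
    · rintro (e | e) he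
      exacts [h2 e he, rfl]
    · rintro (e | e)
      · exact h3 e
      · exact (sub_zero (0 : K)).symm

/-- The inclusion `H¹(H) → H¹(G ∪ H) = H¹(G) ⊕ H¹(H)`. -/
def inr (G H : OGraph) : Collapse K H (G.union H) where
  r := Sum.elim (fun _ => none) some
  r_rev := by rintro (e | e) <;> rfl
  cob := by
    rintro c ⟨φ, h1, h2, h3⟩
    refine ⟨Sum.elim 0 φ, ?_, ?_, ?_⟩
    · rintro (e | e)
      exacts [rfl, h1 e]
    · rintro (e | e) he
      exacts [rfl, h2 e he]
    · rintro (e | e)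
      · exact (sub_zero (0 : K)).symm
      · exact h3 e

/-- The natural isomorphism `H¹(G) → H¹(G')`, where `G'` differs from `G` by the cyclic order at
one vertex. -/
def flip (G : OGraph) (e : G.E) : Collapse K G (G.flip e) where
  r := some
  r_rev _ := rfl
  cob := by
    rintro c ⟨φ, h1, h2, h3⟩
    refine ⟨φ, fun h => ?_, h2, h3⟩
    have h4 : φ (G.σ.symm e) = φ e := by rw [← h1, Equiv.apply_symm_apply]
    have h5 : ∀ k, φ (G.flipSwap e k) = φ k := by
      intro k
      simp only [OGraph.flipSwap, Equiv.swap_apply_def]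
      split_ifs with ha hb
      · rw [ha, h4, h1]
      · rw [hb, h4, h1]
      · rfl
    change φ (G.flipSwap e (G.σ (G.flipSwap e h))) = φ h
    rw [h5, h1, h5]

/-- The map `H¹(G) → H¹(Gᵢ)` dual to the removal (contraction) of the extra edge of the `i`-th
resolution `Gᵢ` of `G`. -/
def resolve (G : OGraph) (x : G.E) (h : G.IsFourAt x) (i : Fin 3) :
    Collapse K G (G.resolve x h i) where
  r := Sum.elim some (fun _ => none)
  r_rev := by rintro (e | e) <;> rfl
  cob := by
    rintro c ⟨φ, h1, h2, h3⟩
    refine ⟨Sum.elim φ (fun _ => φ x), ?_, ?_, ?_⟩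
    · have h4 : ∀ j, φ (G.arm x j) = φ x := by
        intro j
        fin_cases j <;> simp [OGraph.arm, h1]
      obtain ⟨a1, a2, a3, a4, a5, a6⟩ := h.resolveσ_split i
      change ∀ z, Sum.elim φ (fun _ => φ x) (G.resolveσ x i z) = Sum.elim φ (fun _ => φ x) z
      rintro (e | b)
      · by_cases he : ∃ j, G.arm x j = e
        · rcases OGraph.IsFourAt.exists_split i he with rfl | rfl | rfl | rfl <;>
            simp only [a1, a2, a5, a6, Sum.elim_inl, Sum.elim_inr, h4]
        · rw [OGraph.resolveσ_of_not i he]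
          exact h1 e
      · cases b <;> simp only [a3, a4, Sum.elim_inl, Sum.elim_inr, h4]
    · rintro (e | e) he
      exacts [h2 e he, he.elim]
    · rintro (e | e)
      · exact h3 e
      · exact (sub_self (φ x)).symm

end Collapse

end Cohomology

/-! ### The algebra of closed graphs with cohomology classes -/

/-- Closed 3-valent graphs with cyclic orders at the vertices. -/
abbrev TriGraph : Type 1 := {G : OGraph // G.IsTri}

namespace TriGraph

abbrev union (G H : TriGraph) : TriGraph := ⟨G.1.union H.1, G.2.union H.2⟩

abbrev empty : TriGraph := ⟨OGraph.empty, OGraph.isTri_empty⟩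

abbrev flip (G : TriGraph) (e : G.1.E) (he : G.1.σ e ≠ e) : TriGraph := ⟨G.1.flip e, G.2.flip e he⟩

/-- A closed graph as a (1,3)-valent graph without 1-valent vertices. -/
abbrev toUT (G : TriGraph) : UTGraph := ⟨G.1, G.2.isUniTri⟩

instance setoid : Setoid TriGraph where
  r G H := Nonempty (Iso G.1 H.1)
  iseqv := ⟨fun G => ⟨Iso.refl G.1⟩, fun ⟨f⟩ => ⟨f.symm⟩, fun ⟨f⟩ ⟨g⟩ => ⟨f.trans g⟩⟩

end TriGraph

/-- Isomorphism classes of closed 3-valent graphs with cyclic orders. -/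
def TriClass : Type 1 := Quotient TriGraph.setoid

namespace TriClass

def mk (G : TriGraph) : TriClass := Quotient.mk _ G

/-- A chosen representative. -/
def rep (c : TriClass) : TriGraph := Quotient.out c

theorem mk_rep (c : TriClass) : mk c.rep = c := Quotient.out_eq c

theorem mk_eq {G H : TriGraph} (f : Iso G.1 H.1) : mk G = mk H := Quotient.sound ⟨f⟩

/-- A chosen isomorphism from a graph to the representative of its class. -/
def repIso (G : TriGraph) : Iso G.1 (mk G).rep.1 :=
  Classical.choice (Quotient.exact (mk_rep (mk G)).symm)

end TriClass

section D

variable (K : Type*) [Field K]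

/-- The homogeneous component of degree `m` of the symmetric algebra. -/
def SH1.deg (G : OGraph) (m : ℕ) : Submodule K (SH1 K G) :=
  (LinearMap.range (SH1.ι K G)) ^ m

/-- The action of isomorphisms on the symmetric algebra of `H¹`. -/
def isoS {G H : OGraph} (f : Iso G H) : SH1 K G →ₐ[K] SH1 K H := (Collapse.ofIso K f).S

theorem isoS_trans {G H J : OGraph} (f : Iso G H) (g : Iso H J) (x : SH1 K G) :
    isoS K (f.trans g) x = isoS K g (isoS K f x) := by
  rw [isoS, isoS, isoS, ← Collapse.comp_S]
  rfl

theorem isoS_id {G : OGraph} {f : Iso G G} (hf : ∀ e, f.symm.toEquiv e = e) (x : SH1 K G) :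
    isoS K f x = x :=
  Collapse.S_id (fun e => congrArg some (hf e)) x

/-- The part of the symmetric algebra that is invariant under the group of symmetries that preserve
the cyclic orders. -/
def invS (G : OGraph) : Submodule K (SH1 K G) where
  carrier := {x | ∀ g : Iso G G, isoS K g x = x}
  add_mem' ha hb g := by rw [map_add, ha g, hb g]
  zero_mem' g := map_zero _
  smul_mem' r x hx g := by rw [map_smul, hx g]

/-- The averaging projector onto the invariant part. -/
def avg (G : OGraph) : SH1 K G →ₗ[K] SH1 K G :=
  (Fintype.card (Iso G G) : K)⁻¹ • ∑ g : Iso G G, (isoS K g).toLinearMap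

theorem avg_apply (G : OGraph) (x : SH1 K G) :
    avg K G x = (Fintype.card (Iso G G) : K)⁻¹ • ∑ g : Iso G G, isoS K g x := by
  simp [avg]

theorem avg_mem (G : OGraph) (x : SH1 K G) : avg K G x ∈ invS K G := by
  intro g
  rw [avg_apply, map_smul, map_sum]
  congr 1
  let e : Iso G G ≃ Iso G G :=
    { toFun := fun f => f.trans g
      invFun := fun f => f.trans g.symm
      left_inv := fun f => Iso.toEquiv_injective (by ext; simp [Iso.trans, Iso.symm])
      right_inv := fun f => Iso.toEquiv_injective (by ext; simp [Iso.trans, Iso.symm]) }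
  rw [← Equiv.sum_comp e (fun f => isoS K f x)]
  exact Finset.sum_congr rfl fun f _ => (isoS_trans K f g x).symm

theorem avg_iso (G : OGraph) (g : Iso G G) (x : SH1 K G) :
    avg K G (isoS K g x) = avg K G x := by
  rw [avg_apply, avg_apply]
  congr 1
  let e : Iso G G ≃ Iso G G :=
    { toFun := fun f => g.trans f
      invFun := fun f => g.symm.trans f
      left_inv := fun f => Iso.toEquiv_injective (by ext; simp [Iso.trans, Iso.symm])
      right_inv := fun f => Iso.toEquiv_injective (by ext; simp [Iso.trans, Iso.symm]) }
  rw [← Equiv.sum_comp e (fun f => isoS K f x)]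
  exact Finset.sum_congr rfl fun f _ => (isoS_trans K g f x).symm

theorem card_iso_ne_zero [CharZero K] (G : OGraph) : (Fintype.card (Iso G G) : K) ≠ 0 := by
  have : Nonempty (Iso G G) := ⟨Iso.refl G⟩
  exact_mod_cast Fintype.card_ne_zero

theorem avg_of_mem [CharZero K] (G : OGraph) {x : SH1 K G} (hx : x ∈ invS K G) :
    avg K G x = x := by
  rw [avg_apply, Finset.sum_congr rfl (fun g _ => hx g), Finset.sum_const, Finset.card_univ,
    ← Nat.cast_smul_eq_nsmul K, smul_smul, inv_mul_cancel₀ (card_iso_ne_zero K G), one_smul]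

/-- The averaging projector, with values in the invariant part. -/
def projS (G : OGraph) : SH1 K G →ₗ[K] invS K G := (avg K G).codRestrict _ (avg_mem K G)

theorem coe_projS (G : OGraph) (x : SH1 K G) : (projS K G x).1 = avg K G x := rfl

/-- The direct sum, over all isomorphism classes of closed 3-valent graphs with cyclic orders, of
the invariant parts of the symmetric algebras of `H¹`. -/
def DTilde := DirectSum TriClass fun c => invS K c.rep.1

namespace DTilde

open scoped Classical

instance : AddCommGroup (DTilde K) :=
  inferInstanceAs (AddCommGroup (DirectSum TriClass fun c => invS K c.rep.1))

instance : Module K (DTilde K) :=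
  inferInstanceAs (Module K (DirectSum TriClass fun c => invS K c.rep.1))

/-- The inclusion of the summand of an isomorphism class. -/
def incl (c : TriClass) : invS K c.rep.1 →ₗ[K] DTilde K :=
  DirectSum.lof K TriClass (fun c => invS K c.rep.1) c

/-- The linear map on the direct sum given by linear maps on the summands. -/
def lift {M : Type*} [AddCommGroup M] [Module K M] (f : ∀ c : TriClass, invS K c.rep.1 →ₗ[K] M) :
    DTilde K →ₗ[K] M := DirectSum.toModule K TriClass M f

theorem lift_incl {M : Type*} [AddCommGroup M] [Module K M]
    (f : ∀ c : TriClass, invS K c.rep.1 →ₗ[K] M) (c : TriClass) (x : invS K c.rep.1) :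
    lift K f (incl K c x) = f c x :=
  DirectSum.toModule_lof (M := fun c : TriClass => invS K c.rep.1) (φ := f) K c x

/-- For a closed graph `G` and an element `x` of the symmetric algebra of `H¹(G)`, the projection
of `x` to the invariant part, as an element of the summand of the class of `G`. -/
def proj (G : TriGraph) : SH1 K G.1 →ₗ[K] DTilde K :=
  incl K (TriClass.mk G) ∘ₗ projS K _ ∘ₗ (isoS K (TriClass.repIso G)).toLinearMap

/-- `proj` does not depend on the choices. -/
theorem proj_eq {G : TriGraph} {c : TriClass} (f : Iso G.1 c.rep.1) (x : SH1 K G.1) :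
    proj K G x = incl K c (projS K _ (isoS K f x)) := by
  have hc : c = TriClass.mk G := by rw [← TriClass.mk_rep c, TriClass.mk_eq f]
  subst hc
  change incl K _ (projS K _ (isoS K (TriClass.repIso G) x)) = _
  congr 1
  apply Subtype.ext
  change avg K _ _ = avg K _ _
  have : isoS K f x
      = isoS K ((TriClass.repIso G).symm.trans f) (isoS K (TriClass.repIso G) x) := by
    rw [← isoS_trans]
    congr 2
    exact Iso.toEquiv_injective (by ext; simp [Iso.trans, Iso.symm])
  rw [this, avg_iso]

theorem proj_iso {G H : TriGraph} (f : Iso G.1 H.1) (x : SH1 K G.1) :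
    proj K H (isoS K f x) = proj K G x := by
  rw [proj_eq K (f.trans (TriClass.repIso H)), isoS_trans]
  rfl

theorem incl_eq_proj [CharZero K] (c : TriClass) (x : invS K c.rep.1) :
    incl K c x = proj K c.rep x.1 := by
  rw [proj_eq K (Iso.refl c.rep.1), isoS_id K (fun _ => rfl)]
  congr 1
  exact Subtype.ext (avg_of_mem K _ x.2).symm

/-- The product `x ⊗ y` in `S(H¹(G ∪ H)) = S(H¹(G)) ⊗ S(H¹(H))`. -/
def tens (G H : OGraph) : SH1 K G →ₗ[K] SH1 K H →ₗ[K] SH1 K (G.union H) :=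
  (LinearMap.mul K (SH1 K (G.union H))).compl₁₂ (Collapse.inl K G H).S.toLinearMap
    (Collapse.inr K G H).S.toLinearMap

theorem tens_apply (G H : OGraph) (x : SH1 K G) (y : SH1 K H) :
    tens K G H x y = (Collapse.inl K G H).S x * (Collapse.inr K G H).S y := rfl

theorem tens_iso {G G' H H' : OGraph} (f : Iso G G') (g : Iso H H') (x : SH1 K G) (y : SH1 K H) :
    tens K G' H' (isoS K f x) (isoS K g y) = isoS K (f.union g) (tens K G H x y) := by
  rw [tens_apply, tens_apply, map_mul, isoS, isoS, isoS, ← Collapse.comp_S, ← Collapse.comp_S,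
    ← Collapse.comp_S, ← Collapse.comp_S]
  congr 3
  · apply Collapse.S_congr
    rintro (e | e) <;> rfl
  · apply Collapse.S_congr
    rintro (e | e) <;> rfl

/-- The product: the product of `x` and `y` in the summands of `G` and `H` is the projection of
`x ⊗ y` to the invariant part. -/
def mulMap : DTilde K →ₗ[K] DTilde K →ₗ[K] DTilde K :=
  lift K fun c => LinearMap.flip (lift K fun d => LinearMap.flip
    (((tens K c.rep.1 d.rep.1).compr₂ (proj K (c.rep.union d.rep))).compl₁₂
      (invS K c.rep.1).subtype (invS K d.rep.1).subtype))

theorem mulMap_incl (c d : TriClass) (x : invS K c.rep.1) (y : invS K d.rep.1) :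
    mulMap K (incl K c x) (incl K d y)
      = proj K (c.rep.union d.rep) (tens K c.rep.1 d.rep.1 x.1 y.1) := by
  rw [mulMap, lift_incl, LinearMap.flip_apply, lift_incl]
  rfl

theorem mulMap_proj [CharZero K] (G H : TriGraph) (x : SH1 K G.1) (y : SH1 K H.1) :
    mulMap K (proj K G x) (proj K H y) = proj K (G.union H) (tens K G.1 H.1 x y) := by
  generalize hf : TriClass.repIso G = f
  generalize hg : TriClass.repIso H = g
  rw [proj_eq K f, proj_eq K g, mulMap_incl, coe_projS, coe_projS, avg_apply, avg_apply]
  simp only [map_smul, LinearMap.smul_apply, map_sum, LinearMap.sum_apply]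
  have key : ∀ a b, proj K ((TriClass.mk G).rep.union (TriClass.mk H).rep)
      (tens K _ _ (isoS K a (isoS K f x)) (isoS K b (isoS K g y)))
      = proj K (G.union H) (tens K G.1 H.1 x y) := by
    intro a b
    rw [← isoS_trans, ← isoS_trans, tens_iso]
    exact proj_iso K (G := G.union H) (H := (TriClass.mk G).rep.union (TriClass.mk H).rep) _ _
  simp only [key, Finset.sum_const, Finset.card_univ, ← Nat.cast_smul_eq_nsmul K, smul_smul]
  rw [inv_mul_cancel₀ (card_iso_ne_zero K _), mul_one, inv_mul_cancel₀ (card_iso_ne_zero K _),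
    one_smul]

@[elab_as_elim]
theorem induction_on [CharZero K] {p : DTilde K → Prop} (z : DTilde K)
    (h0 : p 0) (hadd : ∀ a b, p a → p b → p (a + b)) (hp : ∀ G x, p (proj K G x)) : p z := by
  refine DirectSum.induction_on z h0 (fun c x => ?_) hadd
  have := hp c.rep x.1
  rw [← incl_eq_proj] at this
  exact this

instance : Mul (DTilde K) := ⟨fun a b => mulMap K a b⟩

instance : One (DTilde K) := ⟨proj K TriGraph.empty 1⟩

theorem proj_mul_proj [CharZero K] (G H : TriGraph) (x : SH1 K G.1) (y : SH1 K H.1) :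
    proj K G x * proj K H y = proj K (G.union H) (tens K G.1 H.1 x y) := mulMap_proj K G H x y

variable {K}

protected theorem add_mul' (a b c : DTilde K) : (a + b) * c = a * c + b * c := by
  change mulMap K (a + b) c = mulMap K a c + mulMap K b c
  rw [map_add, LinearMap.add_apply]

protected theorem mul_add' (a b c : DTilde K) : a * (b + c) = a * b + a * c :=
  map_add (mulMap K a) b c

protected theorem zero_mul' (a : DTilde K) : 0 * a = 0 := by
  change mulMap K 0 a = 0
  rw [map_zero, LinearMap.zero_apply]

protected theorem mul_zero' (a : DTilde K) : a * 0 = 0 := map_zero (mulMap K a)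

variable [CharZero K]

protected theorem mul_comm' (a b : DTilde K) : a * b = b * a := by
  induction a using induction_on K with
  | h0 => rw [DTilde.zero_mul', DTilde.mul_zero']
  | hadd a a' ha ha' => rw [DTilde.add_mul', DTilde.mul_add', ha, ha']
  | hp G x =>
    induction b using induction_on K with
    | h0 => rw [DTilde.zero_mul', DTilde.mul_zero']
    | hadd a a' ha ha' => rw [DTilde.add_mul', DTilde.mul_add', ha, ha']
    | hp H y =>
      rw [proj_mul_proj, proj_mul_proj,
        ← proj_iso K (G := G.union H) (H := H.union G) (Iso.unionComm G.1 H.1)]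
      congr 1
      change isoS K _ (tens K G.1 H.1 x y) = _
      rw [tens_apply, tens_apply, map_mul, isoS, ← Collapse.comp_S, ← Collapse.comp_S, mul_comm]
      congr 3
      · apply Collapse.S_congr
        rintro (e | e) <;> rfl
      · apply Collapse.S_congr
        rintro (e | e) <;> rfl

protected theorem one_mul' (a : DTilde K) : 1 * a = a := by
  induction a using induction_on K with
  | h0 => rw [DTilde.mul_zero']
  | hadd a a' ha ha' => rw [DTilde.mul_add', ha, ha']
  | hp G x =>
    change proj K TriGraph.empty 1 * proj K G x = _
    rw [proj_mul_proj, ← proj_iso K (G := TriGraph.empty.union G) (H := G) (Iso.emptyUnion G.1)]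
    congr 1
    change isoS K _ (tens K OGraph.empty G.1 1 x) = _
    rw [tens_apply, map_one, one_mul, isoS, ← Collapse.comp_S]
    exact Collapse.S_id (fun e => rfl) x

protected theorem mul_assoc' (a b c : DTilde K) : a * b * c = a * (b * c) := by
  induction a using induction_on K with
  | h0 => simp only [DTilde.zero_mul']
  | hadd a a' ha ha' => simp only [DTilde.add_mul', ha, ha']
  | hp G x =>
    induction b using induction_on K with
    | h0 => simp only [DTilde.zero_mul', DTilde.mul_zero']
    | hadd a a' ha ha' => simp only [DTilde.add_mul', DTilde.mul_add', ha, ha']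
    | hp H y =>
      induction c using induction_on K with
      | h0 => simp only [DTilde.mul_zero']
      | hadd a a' ha ha' => simp only [DTilde.mul_add', ha, ha']
      | hp J z =>
        rw [proj_mul_proj, proj_mul_proj, proj_mul_proj, proj_mul_proj,
          ← proj_iso K (G := (G.union H).union J) (H := G.union (H.union J))
            (Iso.unionAssoc G.1 H.1 J.1)]
        congr 1
        change isoS K _ (tens K (G.1.union H.1) J.1 (tens K G.1 H.1 x y) z)
          = tens K G.1 (H.1.union J.1) x (tens K H.1 J.1 y z)
        simp only [tens_apply, map_mul, isoS, ← Collapse.comp_S, mul_assoc]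
        have key : ∀ {A B : OGraph} {f g : Collapse K A B} (w : SH1 K A),
            (∀ e, f.r e = g.r e) → f.S w = g.S w := fun w h => by rw [Collapse.S_congr h]
        refine congrArg₂ _ (key x ?_) (congrArg₂ _ (key y ?_) (key z ?_)) <;>
          rintro (e | e | e) <;> rfl

instance : CommRing (DTilde K) :=
  { (inferInstance : AddCommGroup (DTilde K)) with
    left_distrib := DTilde.mul_add'
    right_distrib := DTilde.add_mul'
    zero_mul := DTilde.zero_mul'
    mul_zero := DTilde.mul_zero'
    mul_assoc := DTilde.mul_assoc'
    one_mul := DTilde.one_mul'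
    mul_one := fun a => by rw [DTilde.mul_comm', DTilde.one_mul']
    mul_comm := DTilde.mul_comm' }

instance : Algebra K (DTilde K) :=
  Algebra.ofModule
    (fun r a b => by
      change mulMap K (r • a) b = r • mulMap K a b
      rw [map_smul, LinearMap.smul_apply])
    (fun r a b => map_smul (mulMap K a) r b)

variable (K)

/-- The sum of the spaces `{P x + P x'}`, where `x' ∈ S(H¹(G'))` corresponds to `x ∈ S(H¹(G))` and
`G'` differs from `G` by the cyclic order at one vertex. -/
def AS : Submodule K (DTilde K) :=
  Submodule.span K {z | ∃ (G : TriGraph) (e : G.1.E) (he : G.1.σ e ≠ e) (x : SH1 K G.1),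
    z = proj K G x + proj K (G.flip e he) ((Collapse.flip K G.1 e).S x)}

/-- The sum of the images of the alternating sums of the three maps `S(H¹(G)) → S(H¹(Gᵢ))`, for the
graphs `G` with one 4-valent vertex and their three resolutions `Gᵢ`. -/
def IHX : Submodule K (DTilde K) :=
  Submodule.span K {z | ∃ (G : OGraph) (v : G.E) (h : G.IsTriFour v) (x : SH1 K G),
    z = proj K ⟨G.resolve v h.1 0, h.resolve 0⟩ ((Collapse.resolve K G v h.1 0).S x)
      - proj K ⟨G.resolve v h.1 1, h.resolve 1⟩ ((Collapse.resolve K G v h.1 1).S x)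
      + proj K ⟨G.resolve v h.1 2, h.resolve 2⟩ ((Collapse.resolve K G v h.1 2).S x)}

theorem flip_mul_proj (G H : TriGraph) (e : G.1.E) (he : G.1.σ e ≠ e)
    (he' : (G.union H).1.σ (.inl e) ≠ .inl e) (x : SH1 K G.1) (y : SH1 K H.1) :
    proj K (G.flip e he) ((Collapse.flip K G.1 e).S x) * proj K H y =
      proj K ((G.union H).flip (.inl e) he')
        ((Collapse.flip K (G.1.union H.1) (.inl e)).S (tens K G.1 H.1 x y)) := by
  rw [proj_mul_proj, ← proj_iso K (G := (G.flip e he).union H)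
    (H := (G.union H).flip (.inl e) he') (Iso.flipUnion H.1 e)]
  congr 1
  change isoS K _ (tens K (G.1.flip e) H.1 _ y) = _
  simp only [tens_apply, map_mul, isoS, ← Collapse.comp_S]
  congr 3
  apply Collapse.S_congr
  rintro (e | e) <;> rfl

theorem resolve_mul_proj (G : OGraph) (H : TriGraph) (v : G.E) (h : G.IsTriFour v)
    (i : Fin 3) (x : SH1 K G) (y : SH1 K H.1) :
    proj K ⟨G.resolve v h.1 i, h.resolve i⟩ ((Collapse.resolve K G v h.1 i).S x) * proj K H y =
      proj K ⟨(G.union H.1).resolve (.inl v) (h.union H.2).1 i, (h.union H.2).resolve i⟩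
        ((Collapse.resolve K (G.union H.1) (.inl v) (h.union H.2).1 i).S
          (tens K G H.1 x y)) := by
  rw [proj_mul_proj, ← proj_iso K (G := TriGraph.union ⟨G.resolve v h.1 i, h.resolve i⟩ H)
    (H := ⟨(G.union H.1).resolve (.inl v) (h.union H.2).1 i, (h.union H.2).resolve i⟩)
    (Iso.resolveUnion H.1 h.1 (h.union H.2).1 i)]
  congr 1
  change isoS K _ (tens K (G.resolve v h.1 i) H.1 _ y) = _
  simp only [tens_apply, map_mul, isoS, ← Collapse.comp_S]
  congr 3
  · apply Collapse.S_congr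
    rintro ((e | e) | e) <;> rfl
  · apply Collapse.S_congr
    rintro ((e | e) | e) <;> rfl

theorem mul_proj_mem (H : TriGraph) (y : SH1 K H.1) {z : DTilde K} (hz : z ∈ AS K ⊔ IHX K) :
    z * proj K H y ∈ AS K ⊔ IHX K := by
  have hle : AS K ⊔ IHX K ≤ (AS K ⊔ IHX K).comap (LinearMap.mulRight K (proj K H y)) := by
    refine sup_le (Submodule.span_le.2 ?_) (Submodule.span_le.2 ?_)
    · rintro _ ⟨G, e, he, x, rfl⟩
      refine Submodule.mem_sup_left (Submodule.subset_span
        ⟨G.union H, .inl e, fun hh => he (Sum.inl_injective hh), tens K G.1 H.1 x y, ?_⟩)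
      rw [LinearMap.mulRight_apply, add_mul, proj_mul_proj, flip_mul_proj]
    · rintro _ ⟨G, v, h, x, rfl⟩
      refine Submodule.mem_sup_right (Submodule.subset_span
        ⟨G.union H.1, .inl v, h.union H.2, tens K G H.1 x y, ?_⟩)
      rw [LinearMap.mulRight_apply, add_mul, sub_mul, resolve_mul_proj K G H v h,
        resolve_mul_proj K G H v h, resolve_mul_proj K G H v h]
  exact hle hz

/-- The subspace `AS + IHX` is an ideal. -/
def relIdeal : Ideal (DTilde K) :=
  { AS K ⊔ IHX K with
    smul_mem' := fun a z hz => by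
      have : ∀ a : DTilde K, z * a ∈ AS K ⊔ IHX K := by
        intro a
        induction a using induction_on K with
        | h0 =>
          rw [mul_zero]
          exact Submodule.zero_mem _
        | hadd a b ha hb =>
          rw [mul_add]
          exact Submodule.add_mem _ ha hb
        | hp G x => exact mul_proj_mem K G x hz
      rw [smul_eq_mul, mul_comm]
      exact this a }

end DTilde

variable [CharZero K]

/-- The algebra `D`. -/
abbrev D := DTilde K ⧸ DTilde.relIdeal K

/-- The class in `D` of the invariant projection of `x ∈ S(H¹(G))`. -/
def D.cls (G : TriGraph) (x : SH1 K G.1) : D K := Ideal.Quotient.mk _ (DTilde.proj K G x)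

/-- The subspace `D_{m,n}`: the image of the direct sum of the invariant parts of `Sᵐ(H¹(G))` over
the graphs `G` with (opposite) Euler characteristic `n`. -/
def D.deg (m : ℕ) (n : ℤ) : Submodule K (D K) :=
  Submodule.span K {z | ∃ (c : TriClass) (x : invS K c.rep.1), c.rep.1.chi = n ∧
    x.1 ∈ SH1.deg K c.rep.1 m ∧ z = Ideal.Quotient.mk _ (DTilde.incl K c x)}

end D

/-! ### Legs attached to a closed graph -/

/-- The labels of the new darts when a leg is attached to an edge whose two orientations have the
labels `a` (forward) and `b` (backward). -/
def legLabel {α : Type} (a b : Option α) : OGraph.LegDart → Option α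
  | .back => b
  | .fwd => a
  | .stem => none
  | .tip => none

/-- `LegsOn G Γ κ s`: the graph `Γ` is obtained from the closed graph `G` by attaching legs, one
after the other, to the edges of `G`.  The map `κ` sends a dart of `Γ` that is a piece of an
oriented edge of `G` to that oriented edge (and the darts of the legs to `none`), and `s` is the
multiset of the oriented edges of `G` on whose left-hand side the legs are attached. -/
inductive LegsOn (G : TriGraph) :
    (Γ : UTGraph) → (Γ.1.E → Option G.1.E) → Multiset G.1.E → Prop
  | core : LegsOn G G.toUT some 0
  | edge (Γ : UTGraph) (κ : Γ.1.E → Option G.1.E) (s : Multiset G.1.E) (e : Γ.1.E)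
      (he : ¬ Γ.1.free e) (d : G.1.E) (hd : κ e = some d) (h : LegsOn G Γ κ s) :
      LegsOn G (Γ.attachEdge e he)
        (Sum.elim κ (legLabel (κ e) (κ (Γ.1.rev e)))) (d ::ₘ s)
  | circle (Γ : UTGraph) (κ : Γ.1.E → Option G.1.E) (s : Multiset G.1.E) (e : Γ.1.E)
      (he : Γ.1.free e) (d : G.1.E) (hd : κ e = some d) (h : LegsOn G Γ κ s) :
      LegsOn G (Γ.attachCircle e he) (Sum.elim κ fun _ => none) (d ::ₘ s)

/-- The monomial in `S(H¹(G))` of a multiset of oriented edges of `G`. -/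
def edgeMonomial (K : Type*) [Field K] (G : OGraph) (s : Multiset G.E) : SH1 K G :=
  (s.map fun e => SH1.ι K G (edgeClass K G e)).prod

end Jacobi

end

noncomputable section

namespace Jacobi

open scoped Classical

/-! ### Maps of graphs -/

namespace OGraph

variable {G : OGraph}

/-! The isomorphism is easiest to build backwards. A monomial $f_{e_1}\cdots f_{e_m}$ on a closed
graph $D$ is sent to $D$ with $m$ legs attached on the left of $e_1,\dots,e_m$ (`legs`). This is
well defined because of three facts in $\mathcal B$. Moving a leg to the other side of its edge
changes the sign, by AS at its vertex (`legs_rev`). The order of the legs is irrelevant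
(`legs_perm`). The sum of the three ways to attach a leg next to a 3-valent vertex is zero, by IHX
at the 4-valent vertex that arises when the leg is pushed into that vertex (`legs_vertex`). These
mirror the relations $f_{\bar e}=-f_e$ and $\sum_{e\text{ from }v}f_e=0$ in $H^1(D)$. So $S^*H^1(D)$
maps to the algebra with these generators and relations (`EdgeAlg`), and from there linearly to
$\mathcal B$ (`legsHom`). Attaching legs commutes with isomorphisms, with reversing a vertex, with
resolving a 4-valent vertex and with disjoint union. Hence averaging does no harm, AS and IHX of
$\mathcal D$ go to zero, and an algebra homomorphism `toB` from $\mathcal D$ to $\mathcal B$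
results.

It is onto. If two legs end at the same vertex, exchanging them is a symmetry that reverses exactly
one vertex, so the graph is its own negative and vanishes (`legs_of_hasFork`). From any other graph
the legs can be taken off one at a time until a closed graph remains. This induction,
`legs_mem_map_deg`, also keeps track of the bidegree.

It is injective because it has a linear left inverse `value`. A graph without forks has a closed
core, together with a labelling of its darts by the darts of the core (`CoreOf`). The core is unique
up to isomorphism (`CoreOf.exists_iso`), so the product of the labels at the legs gives a
well-defined class in $\mathcal D$ (`graphValue`); graphs with forks get the value $0$. Reversing a
vertex without legs is AS in $\mathcal D$, and reversing the vertex of a leg changes the sign of one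
factor (`graphValue_flip`). IHX at a 4-valent vertex without legs is IHX in $\mathcal D$; if a leg
ends there, IHX becomes the vertex relation in $H^1$ (`ihxValue_eq_zero`).

Uniqueness holds because the prescribed values determine the isomorphism on the image of `toB`,
which is everything. Characteristic $0$ is needed to divide by the orders of the symmetry groups, by
$2$ (forks, the two orientations of an edge) and by $3$ (the darts at a vertex). -/

theorem rev_injective (G : OGraph) : Function.Injective G.rev := fun a b h => by
  rw [← G.rev_rev a, h, G.rev_rev]

theorem rev_eq_iff {e h : G.E} : G.rev e = h ↔ e = G.rev h :=
  ⟨fun hh => by rw [← hh, G.rev_rev], fun hh => by rw [hh, G.rev_rev]⟩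

theorem free_rev_iff {e : G.E} : G.free (G.rev e) ↔ G.free e :=
  ⟨fun h => by simpa [G.rev_rev] using G.free_rev _ h, G.free_rev e⟩

theorem not_free_of_σ_ne {e : G.E} (h : G.σ e ≠ e) : ¬ G.free e := fun hf => h (G.σ_free e hf)

theorem not_free_σ {e : G.E} (h : ¬ G.free e) : ¬ G.free (G.σ e) := fun hf =>
  h (G.σ.injective (G.σ_free _ hf) ▸ hf)

theorem edgeRev_self (e : G.E) : G.edgeRev e (.inl e) = .inr .back := by simp [edgeRev]

theorem edgeRev_rev (e : G.E) : G.edgeRev e (.inl (G.rev e)) = .inr .fwd := by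
  simp [edgeRev, G.rev_ne]

theorem edgeRev_of_ne {e h : G.E} (h1 : h ≠ e) (h2 : h ≠ G.rev e) :
    G.edgeRev e (.inl h) = .inl (G.rev h) := by simp [edgeRev, h1, h2]

theorem edgeσ_inl (e : G.E) : G.edgeσ (.inl e) = .inl (G.σ e) := rfl

end OGraph

/-- A bijection of darts that preserves the cyclic orders except at the 3-valent vertex where `v`
starts; there the order is reversed. -/
structure AntiIso (G H : OGraph) (v : G.E) where
  toEquiv : G.E ≃ H.E
  map_rev : ∀ e, toEquiv (G.rev e) = H.rev (toEquiv e)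
  map_free : ∀ e, H.free (toEquiv e) ↔ G.free e
  map_σ : ∀ e, e ≠ v → e ≠ G.σ v → e ≠ G.σ (G.σ v) → toEquiv (G.σ e) = H.σ (toEquiv e)
  ne : G.σ v ≠ v
  cube : G.σ (G.σ (G.σ v)) = v
  orbit₀ : H.σ (toEquiv v) = toEquiv (G.σ (G.σ v))
  orbit₁ : H.σ (toEquiv (G.σ v)) = toEquiv v
  orbit₂ : H.σ (toEquiv (G.σ (G.σ v))) = toEquiv (G.σ v)

namespace OGraph

variable {G : OGraph}

theorem symm_apply_of_cube {v : G.E} (h3 : G.σ (G.σ (G.σ v)) = v) :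
    G.σ.symm v = G.σ (G.σ v) := by rw [Equiv.symm_apply_eq, h3]

theorem flip_orbit {v : G.E} (h1 : G.σ v ≠ v) (h3 : G.σ (G.σ (G.σ v)) = v) :
    (G.flip v).σ v = G.σ (G.σ v) ∧ (G.flip v).σ (G.σ v) = v ∧
      (G.flip v).σ (G.σ (G.σ v)) = G.σ v := by
  have h2 : v ≠ G.σ (G.σ v) := fun h => h1 (by rw [← h] at h3; exact h3)
  refine ⟨?_, ?_, ?_⟩ <;>
    simp [flipSwap, symm_apply_of_cube h3, Equiv.swap_apply_def, h1.symm, h2, h3]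

theorem flip_of_ne {v e : G.E} (h3 : G.σ (G.σ (G.σ v)) = v)
    (e0 : e ≠ v) (e1 : e ≠ G.σ v) (e2 : e ≠ G.σ (G.σ v)) : (G.flip v).σ e = G.σ e := by
  have f1 : G.σ e ≠ G.σ v := fun h => e0 (G.σ.injective h)
  have f2 : G.σ e ≠ G.σ (G.σ v) := fun h => e1 (G.σ.injective h)
  simp [flipSwap, symm_apply_of_cube h3, Equiv.swap_apply_def, e1, e2, f1, f2]

end OGraph

namespace AntiIso

variable {G H : OGraph} {v : G.E}

/-- The graph with one reversed cyclic order, compared with the original one. -/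
def flip (G : OGraph) (v : G.E) (h1 : G.σ v ≠ v) (h3 : G.σ (G.σ (G.σ v)) = v) :
    AntiIso G (G.flip v) v where
  toEquiv := Equiv.refl _
  map_rev _ := rfl
  map_free _ := Iff.rfl
  map_σ _ e0 e1 e2 := (OGraph.flip_of_ne h3 e0 e1 e2).symm
  ne := h1
  cube := h3
  orbit₀ := (OGraph.flip_orbit h1 h3).1
  orbit₁ := (OGraph.flip_orbit h1 h3).2.1
  orbit₂ := (OGraph.flip_orbit h1 h3).2.2

/-- The relation AS mentions only `flip`. Composed with this isomorphism, it applies to every map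
that reverses one vertex, however the target graph was constructed. -/
def iso (f : AntiIso G H v) : Iso (G.flip v) H where
  toEquiv := f.toEquiv
  map_rev := f.map_rev
  map_free := f.map_free
  map_σ e := by
    obtain ⟨h1, h2, h3⟩ := OGraph.flip_orbit f.ne f.cube
    by_cases e0 : e = v
    · rw [e0, h1, f.orbit₀]
    by_cases e1 : e = G.σ v
    · rw [e1, h2, f.orbit₁]
    by_cases e2 : e = G.σ (G.σ v)
    · rw [e2, h3, f.orbit₂]
    rw [OGraph.flip_of_ne f.cube e0 e1 e2, f.map_σ e e0 e1 e2]

end AntiIso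

/-! ### Attaching legs is compatible with maps of graphs -/

section AttachMap

variable {G H : OGraph}

theorem sumMap_edgeRev (f : G.E ≃ H.E) (hf : ∀ e, f (G.rev e) = H.rev (f e)) (e : G.E)
    (z : G.E ⊕ OGraph.LegDart) : Sum.map f id (G.edgeRev e z) = H.edgeRev (f e) (Sum.map f id z) := by
  rcases z with h | h | h | h | h
  · simp only [OGraph.edgeRev, Sum.map_inl, ← hf, f.injective.eq_iff]
    split_ifs <;> simp [hf]
  all_goals simp [OGraph.edgeRev, hf]

/-- Compatibility with `σ` is required only at the dart in question, so that one computation serves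
both isomorphisms and maps that reverse a vertex. -/
theorem circleσ_map (f : G.E ≃ H.E) (hf : ∀ e, f (G.rev e) = H.rev (f e)) (e : G.E)
    (he : G.free e) (he' : H.free (f e)) :
    (∀ h, h ≠ e → h ≠ G.rev e → f (G.σ h) = H.σ (f h) →
      Sum.map f id (G.circleσ e (.inl h)) = H.circleσ (f e) (.inl (f h))) ∧
    (Sum.map f id (G.circleσ e (.inl e)) = H.circleσ (f e) (.inl (f e))) ∧
    (Sum.map f id (G.circleσ e (.inl (G.rev e))) = H.circleσ (f e) (.inl (f (G.rev e)))) ∧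
    (∀ b : Bool, Sum.map f id (G.circleσ e (.inr b)) = H.circleσ (f e) (.inr b)) := by
  obtain ⟨s1, s2, s3, s4, s5⟩ := G.circleσ_apply e he
  obtain ⟨t1, t2, t3, t4, t5⟩ := H.circleσ_apply (f e) he'
  refine ⟨fun h h1 h2 h3 => ?_, ?_, ?_, ?_⟩
  · rw [s5 h h1 h2, t5 _ (fun hh => h1 (f.injective hh))
      (fun hh => h2 (f.injective (by rw [hh, hf]))), ← h3]
    rfl
  · rw [s1, t1]; rfl
  · rw [s3, hf, t3]; rfl
  · rintro (b | b)
    · rw [s2, t2, ← hf]; rfl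
    · rw [s4, t4]; rfl

def Iso.attachEdge (f : Iso G H) (e : G.E) (he : ¬ G.free e) (he' : ¬ H.free (f.toEquiv e)) :
    Iso (G.attachEdge e he) (H.attachEdge (f.toEquiv e) he') where
  toEquiv := Equiv.sumCongr f.toEquiv (Equiv.refl _)
  map_σ := by
    rintro (h | h)
    · exact congrArg Sum.inl (f.map_σ h)
    · rfl
  map_rev z := sumMap_edgeRev f.toEquiv f.map_rev e z
  map_free := by
    rintro (h | h)
    · exact f.map_free h
    · exact Iff.rfl

def Iso.attachCircle (f : Iso G H) (e : G.E) (he : G.free e) (he' : H.free (f.toEquiv e)) :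
    Iso (G.attachCircle e he) (H.attachCircle (f.toEquiv e) he') where
  toEquiv := Equiv.sumCongr f.toEquiv (Equiv.refl _)
  map_σ := by
    obtain ⟨s1, s2, s3, s4⟩ := circleσ_map f.toEquiv f.map_rev e he he'
    rintro (h | h)
    · by_cases h1 : h = e
      · subst h1; exact s2
      by_cases h2 : h = G.rev e
      · subst h2; exact s3
      exact s1 h h1 h2 (f.map_σ h)
    · exact s4 h
  map_rev := by
    rintro (h | h)
    · exact congrArg Sum.inl (f.map_rev h)
    · rfl
  map_free := by
    rintro (h | h)
    · simp only [Equiv.sumCongr_apply, Sum.map_inl, Sum.elim_inl, f.map_free, ← f.map_rev, ne_eq,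
        f.toEquiv.injective.eq_iff]
    · exact Iff.rfl

def AntiIso.attachEdge {v : G.E} (f : AntiIso G H v) (e : G.E) (he : ¬ G.free e)
    (he' : ¬ H.free (f.toEquiv e)) :
    AntiIso (G.attachEdge e he) (H.attachEdge (f.toEquiv e) he') (.inl v) where
  toEquiv := Equiv.sumCongr f.toEquiv (Equiv.refl _)
  map_σ := by
    rintro (h | h) h1 h2 h3
    · exact congrArg Sum.inl (f.map_σ h (fun hh => h1 (congrArg Sum.inl hh))
        (fun hh => h2 (congrArg Sum.inl hh)) (fun hh => h3 (congrArg Sum.inl hh)))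
    · rfl
  map_rev z := sumMap_edgeRev f.toEquiv f.map_rev e z
  map_free := by
    rintro (h | h)
    · exact f.map_free h
    · exact Iff.rfl
  ne h := f.ne (Sum.inl_injective h)
  cube := congrArg Sum.inl f.cube
  orbit₀ := congrArg Sum.inl f.orbit₀
  orbit₁ := congrArg Sum.inl f.orbit₁
  orbit₂ := congrArg Sum.inl f.orbit₂

theorem OGraph.circleσ_of_not_free {e : G.E} (he : G.free e) {h : G.E} (hh : ¬ G.free h) :
    G.circleσ e (.inl h) = .inl (G.σ h) :=
  (G.circleσ_apply e he).2.2.2.2 h (fun h1 => hh (h1 ▸ he))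
    (fun h1 => hh (h1 ▸ G.free_rev _ he))

def AntiIso.attachCircle {v : G.E} (f : AntiIso G H v) (e : G.E) (he : G.free e)
    (he' : H.free (f.toEquiv e)) :
    AntiIso (G.attachCircle e he) (H.attachCircle (f.toEquiv e) he') (.inl v) := by
  -- Free darts are fixed by `σ`. So the reversed vertex is not on the circle that receives the leg,
  -- and `circleσ` agrees with `σ` there.
  have n0 : ¬ G.free v := OGraph.not_free_of_σ_ne f.ne
  have n1 := OGraph.not_free_σ n0
  have n2 := OGraph.not_free_σ n1
  have m : ∀ h, ¬ G.free h → ¬ H.free (f.toEquiv h) := fun h hh => by rwa [f.map_free]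
  have c : ∀ h, ¬ G.free h → (G.attachCircle e he).σ (.inl h) = .inl (G.σ h) :=
    fun h hh => OGraph.circleσ_of_not_free he hh
  have d : ∀ h, ¬ G.free h →
      (H.attachCircle (f.toEquiv e) he').σ (.inl (f.toEquiv h)) = .inl (H.σ (f.toEquiv h)) :=
    fun h hh => OGraph.circleσ_of_not_free he' (m h hh)
  exact
  { toEquiv := Equiv.sumCongr f.toEquiv (Equiv.refl _)
    map_σ := by
      obtain ⟨s1, s2, s3, s4⟩ := circleσ_map f.toEquiv f.map_rev e he he'
      rw [c _ n0, c _ n1]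
      rintro (h | h) e0 e1 e2
      · by_cases h1 : h = e
        · subst h1; exact s2
        by_cases h2 : h = G.rev e
        · subst h2; exact s3
        exact s1 h h1 h2 (f.map_σ h (fun hh => e0 (congrArg Sum.inl hh))
          (fun hh => e1 (congrArg Sum.inl hh)) (fun hh => e2 (congrArg Sum.inl hh)))
      · exact s4 h
    map_rev := by
      rintro (h | h)
      · exact congrArg Sum.inl (f.map_rev h)
      · rfl
    map_free := by
      rintro (h | h)
      · simp only [Equiv.sumCongr_apply, Sum.map_inl, Sum.elim_inl, f.map_free, ← f.map_rev, ne_eq,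
          f.toEquiv.injective.eq_iff]
      · exact Iff.rfl
    ne := by
      rw [c _ n0]
      exact fun h => f.ne (Sum.inl_injective h)
    cube := by rw [c _ n0, c _ n1, c _ n2, f.cube]
    orbit₀ := by
      rw [c _ n0, c _ n1]
      exact (d _ n0).trans (congrArg Sum.inl f.orbit₀)
    orbit₁ := by
      rw [c _ n0]
      exact (d _ n1).trans (congrArg Sum.inl f.orbit₁)
    orbit₂ := by
      rw [c _ n0, c _ n1]
      exact (d _ n2).trans (congrArg Sum.inl f.orbit₂) }

end AttachMap

/-! ### Changing the side and the order of the legs -/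

section AttachOrder

variable {G : OGraph}

/-- The exchange of the forward and the backward dart at the new vertex. -/
def legDartSwap : OGraph.LegDart ≃ OGraph.LegDart where
  toFun | .back => .fwd | .fwd => .back | .stem => .stem | .tip => .tip
  invFun | .back => .fwd | .fwd => .back | .stem => .stem | .tip => .tip
  left_inv d := by cases d <;> rfl
  right_inv d := by cases d <;> rfl

/-- Legs on the two sides of an edge differ by the cyclic order at one vertex. -/
def AntiIso.attachEdgeRev (G : OGraph) (e : G.E) (he : ¬ G.free e) (he' : ¬ G.free (G.rev e)) :
    AntiIso (G.attachEdge e he) (G.attachEdge (G.rev e) he') (.inr .stem) := by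
  have s1 := G.edgeσ_inr.1
  have s2 := G.edgeσ_inr.2.1
  have s3 := G.edgeσ_inr.2.2.1
  have s4 := G.edgeσ_inr.2.2.2
  have r1 := G.rev_rev e
  have r2 := G.rev_ne e
  exact
  { toEquiv := Equiv.sumCongr (Equiv.refl _) legDartSwap
    map_rev := by
      rintro (h | h | h | h | h)
      · by_cases h1 : h = e
        · subst h1
          simp [OGraph.edgeRev, legDartSwap, r1, r2.symm]
        by_cases h2 : h = G.rev e
        · subst h2
          simp [OGraph.edgeRev, legDartSwap, r2]
        simp [OGraph.edgeRev, h1, h2, r1]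
      all_goals simp [OGraph.edgeRev, legDartSwap, r1]
    map_free := by
      rintro (h | h)
      · exact Iff.rfl
      · exact Iff.rfl
    map_σ := by
      change ∀ z, z ≠ _ → z ≠ G.edgeσ _ → z ≠ G.edgeσ (G.edgeσ _) → _ = G.edgeσ _
      rw [s2, s3]
      rintro (h | h | h | h | h) h1 h2 h3
      · rfl
      · simp at h2
      · simp at h3
      · simp at h1
      · exact (congrArg (Equiv.sumCongr (Equiv.refl _) legDartSwap) s4).trans s4.symm
    ne := by
      change G.edgeσ _ ≠ _
      rw [s2]; simp
    cube := by
      change G.edgeσ (G.edgeσ (G.edgeσ _)) = _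
      rw [s2, s3, s1]
    orbit₀ := by
      change G.edgeσ _ = Equiv.sumCongr _ _ (G.edgeσ (G.edgeσ _))
      rw [s2, s3]; exact s2
    orbit₁ := by
      change G.edgeσ (Equiv.sumCongr _ _ (G.edgeσ _)) = _
      rw [s2]; exact s1
    orbit₂ := by
      change G.edgeσ (Equiv.sumCongr _ _ (G.edgeσ (G.edgeσ _))) = Equiv.sumCongr _ _ (G.edgeσ _)
      rw [s2, s3]; exact s3 }

/-- The two graphs have the same darts. The new vertex has the cyclic order (`e`, leg, `rev e`) in
one and (`rev e`, leg, `e`) in the other, so the identity is the required bijection. -/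
def AntiIso.attachCircleRev (G : OGraph) (e : G.E) (he : G.free e) (he' : G.free (G.rev e)) :
    AntiIso (G.attachCircle e he) (G.attachCircle (G.rev e) he') (.inr false) := by
  have s1 := (G.circleσ_apply e he).1
  have s2 := (G.circleσ_apply e he).2.1
  have s3 := (G.circleσ_apply e he).2.2.1
  have s4 := (G.circleσ_apply e he).2.2.2.1
  have s5 := (G.circleσ_apply e he).2.2.2.2
  have t1 := (G.circleσ_apply (G.rev e) he').1
  have t2 := (G.circleσ_apply (G.rev e) he').2.1
  have t3 := (G.circleσ_apply (G.rev e) he').2.2.1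
  have t4 := (G.circleσ_apply (G.rev e) he').2.2.2.1
  have t5 := (G.circleσ_apply (G.rev e) he').2.2.2.2
  have r1 := G.rev_rev e
  rw [r1] at t2 t3 t5
  exact
  { toEquiv := Equiv.refl _
    map_rev := fun _ => rfl
    map_free := by
      rintro (h | h)
      · simp only [Equiv.refl_apply, Sum.elim_inl, r1]
        tauto
      · exact Iff.rfl
    map_σ := by
      change ∀ z, z ≠ _ → z ≠ G.circleσ e _ → z ≠ G.circleσ e (G.circleσ e _) →
        G.circleσ e z = G.circleσ (G.rev e) z
      rw [s2, s3]
      rintro (h | h | h) h1 h2 h3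
      · have h2' : h ≠ G.rev e := fun hh => h2 (congrArg Sum.inl hh)
        have h3' : h ≠ e := fun hh => h3 (congrArg Sum.inl hh)
        rw [s5 _ h3' h2', t5 _ h2' h3']
      · simp at h1
      · rw [s4, t4]
    ne := by
      change G.circleσ e _ ≠ _
      rw [s2]; simp
    cube := by
      change G.circleσ e (G.circleσ e (G.circleσ e _)) = _
      rw [s2, s3, s1]
    orbit₀ := by
      change G.circleσ _ _ = G.circleσ e (G.circleσ e _)
      rw [s2, s3, Equiv.refl_apply, t2]
    orbit₁ := by
      change G.circleσ _ (Equiv.refl _ (G.circleσ e _)) = _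
      rw [s2, Equiv.refl_apply, t1]; rfl
    orbit₂ := by
      change G.circleσ _ (Equiv.refl _ (G.circleσ e (G.circleσ e _))) = Equiv.refl _ (G.circleσ e _)
      rw [s2, s3, Equiv.refl_apply, t3]; rfl }

/-- Two legs on different darts can be attached in any order. -/
def Iso.attachEdgeEdge {e f : G.E} (he : ¬ G.free e) (hf : ¬ G.free f) (h : f ≠ e) :
    Iso ((G.attachEdge e he).attachEdge (.inl f) hf) ((G.attachEdge f hf).attachEdge (.inl e) he) where
  toEquiv := sumSwapRight _ _ _
  map_σ := by rintro ((h | h) | h) <;> rfl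
  map_free := by rintro ((h | h) | h) <;> exact Iff.rfl
  map_rev := by
    have r1 := G.rev_ne e
    have r4 : G.rev e ≠ G.rev f := fun hh => h (G.rev_injective hh).symm
    have E1 : ∀ z, (G.attachEdge e he).edgeRev (.inl f) (.inl z) = if z = .inl f then .inr .back
        else if z = G.edgeRev e (.inl f) then .inr .fwd else .inl (G.edgeRev e z) := fun _ => by
      simp only [OGraph.edgeRev]; congr
    have E2 : ∀ z, (G.attachEdge f hf).edgeRev (.inl e) (.inl z) = if z = .inl e then .inr .back
        else if z = G.edgeRev f (.inl e) then .inr .fwd else .inl (G.edgeRev f z) := fun _ => by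
      simp only [OGraph.edgeRev]; congr
    have E3 : (G.attachEdge e he).edgeRev (.inl f) (.inr .fwd) = .inl (G.edgeRev e (.inl f)) := rfl
    have E4 : (G.attachEdge f hf).edgeRev (.inl e) (.inr .fwd) = .inl (G.edgeRev f (.inl e)) := rfl
    by_cases hfe : f = G.rev e
    -- Here both legs sit on one edge, each next to the end where its dart starts, so neither
    -- attachment disturbs the other.
    · subst hfe
      have q2 : G.edgeRev (G.rev e) (.inl e) = .inr .fwd := by
        simpa [G.rev_rev] using OGraph.edgeRev_rev (G.rev e)
      rw [OGraph.edgeRev_rev] at E1 E3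
      rw [q2] at E2 E4
      rintro ((k | k | k | k | k) | k | k | k | k)
      · change sumSwapRight _ _ _ ((G.attachEdge e he).edgeRev (.inl (G.rev e)) (.inl (.inl k))) =
          (G.attachEdge (G.rev e) hf).edgeRev (.inl e) (.inl (.inl k))
        rw [E1, E2]
        by_cases k1 : k = e
        · subst k1
          simp [OGraph.edgeRev, sumSwapRight, r1.symm]
        by_cases k2 : k = G.rev e
        · subst k2
          simp [OGraph.edgeRev, sumSwapRight, r1]
        simp [OGraph.edgeRev, sumSwapRight, G.rev_rev, k1, k2]
      all_goals simp [OGraph.edgeRev, sumSwapRight, G.rev_rev, r1, r1.symm]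
    · have hfe' : G.rev f ≠ e := fun hh => hfe (by rw [← hh, G.rev_rev])
      have hef : e ≠ G.rev f := hfe'.symm
      have hef' : G.rev e ≠ f := Ne.symm hfe
      rw [OGraph.edgeRev_of_ne h hfe] at E1 E3
      rw [OGraph.edgeRev_of_ne h.symm hef] at E2 E4
      rintro ((k | k | k | k | k) | k | k | k | k)
      · change sumSwapRight _ _ _ ((G.attachEdge e he).edgeRev (.inl f) (.inl (.inl k))) =
          (G.attachEdge f hf).edgeRev (.inl e) (.inl (.inl k))
        rw [E1, E2]
        by_cases k1 : k = e
        · subst k1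
          simp [OGraph.edgeRev, sumSwapRight, h.symm, hef]
        by_cases k2 : k = G.rev e
        · subst k2
          simp [OGraph.edgeRev, sumSwapRight, r1, hef', r4]
        by_cases k3 : k = f
        · subst k3
          simp [OGraph.edgeRev, sumSwapRight, h, hfe]
        by_cases k4 : k = G.rev f
        · subst k4
          simp [OGraph.edgeRev, sumSwapRight, hfe', r4.symm, G.rev_ne f]
        simp [OGraph.edgeRev, sumSwapRight, k1, k2, k3, k4]
      all_goals simp [OGraph.edgeRev, sumSwapRight, h, h.symm, hfe, hef]

def Iso.attachCircleEdge {e f : G.E} (he : G.free e) (hf : ¬ G.free f)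
    (hf' : ¬ (G.attachCircle e he).free (.inl f)) :
    Iso ((G.attachCircle e he).attachEdge (.inl f) hf')
      ((G.attachEdge f hf).attachCircle (.inl e) he) where
  toEquiv := sumSwapRight _ _ _
  map_rev := by
    have r1 : e ≠ f := fun h => hf (h ▸ he)
    have r2 : e ≠ G.rev f := fun h => hf (by rw [← G.free_rev_iff, ← h]; exact he)
    rintro ((k | k) | k | k | k | k)
    · by_cases k3 : k = f
      · subst k3
        simp [OGraph.edgeRev, sumSwapRight]
      by_cases k4 : k = G.rev f
      · subst k4
        simp [OGraph.edgeRev, sumSwapRight, G.rev_ne]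
      simp [OGraph.edgeRev, sumSwapRight, k3, k4]
    all_goals simp [OGraph.edgeRev, sumSwapRight]
  map_free := by
    have r1 : e ≠ f := fun h => hf (h ▸ he)
    have r2 : e ≠ G.rev f := fun h => hf (by rw [← G.free_rev_iff, ← h]; exact he)
    rintro ((k | k) | k)
    · simp [OGraph.edgeRev, sumSwapRight, r1, r2]
    all_goals simp [sumSwapRight]
  map_σ := by
    have r1 : e ≠ f := fun h => hf (h ▸ he)
    have r2 : e ≠ G.rev f := fun h => hf (by rw [← G.free_rev_iff, ← h]; exact he)
    obtain ⟨s1, s2, s3, s4, s5⟩ := G.circleσ_apply e he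
    have he' : (G.attachEdge f hf).free (.inl e) := he
    obtain ⟨t1, t2, t3, t4, t5⟩ := (G.attachEdge f hf).circleσ_apply (.inl e) he'
    have r3 : (G.attachEdge f hf).rev (.inl e) = .inl (G.rev e) := OGraph.edgeRev_of_ne r1 r2
    rw [r3] at t2 t3 t5
    rintro ((k | k | k) | k)
    · change sumSwapRight _ _ _ (.inl (G.circleσ e (.inl k))) =
        (G.attachEdge f hf).circleσ (.inl e) (.inl (.inl k))
      by_cases k1 : k = e
      · subst k1
        rw [s1, t1]; rfl
      by_cases k2 : k = G.rev e
      · subst k2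
        rw [s3, t3]; rfl
      rw [s5 k k1 k2, t5 _ (fun h => k1 (Sum.inl_injective h)) (fun h => k2 (Sum.inl_injective h))]
      rfl
    · change sumSwapRight _ _ _ (.inl (G.circleσ e (.inr false))) =
        (G.attachEdge f hf).circleσ (.inl e) (.inr false)
      rw [s2, t2]; rfl
    · change sumSwapRight _ _ _ (.inl (G.circleσ e (.inr true))) =
        (G.attachEdge f hf).circleσ (.inl e) (.inr true)
      rw [s4, t4]; rfl
    · exact (t5 (.inr k) (by simp) (by simp)).symm

/-- The two circles must be different: a circle that has received a leg is no longer free. -/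
def Iso.attachCircleCircle {e f : G.E} (he : G.free e) (hf : G.free f) (h1 : f ≠ e)
    (h2 : f ≠ G.rev e) (hf' : (G.attachCircle e he).free (.inl f))
    (he' : (G.attachCircle f hf).free (.inl e)) :
    Iso ((G.attachCircle e he).attachCircle (.inl f) hf')
      ((G.attachCircle f hf).attachCircle (.inl e) he') where
  toEquiv := sumSwapRight _ _ _
  map_rev := by rintro ((k | k) | k) <;> rfl
  map_free := by
    rintro ((k | k) | k)
    · simp [sumSwapRight]
      tauto
    all_goals simp [sumSwapRight]
  map_σ := by
    obtain ⟨s1, s2, s3, s4, s5⟩ := G.circleσ_apply e he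
    obtain ⟨t1, t2, t3, t4, t5⟩ := G.circleσ_apply f hf
    obtain ⟨u1, u2, u3, u4, u5⟩ := (G.attachCircle e he).circleσ_apply (.inl f) hf'
    obtain ⟨w1, w2, w3, w4, w5⟩ := (G.attachCircle f hf).circleσ_apply (.inl e) he'
    have r4 : G.rev e ≠ G.rev f := fun hh => h1 (G.rev_injective hh).symm
    have r5 : G.rev f ≠ e := fun hh => h2 (by rw [← hh, G.rev_rev])
    change ∀ h, h ≠ .inl f → h ≠ .inl (G.rev f) → _ = Sum.inl (G.circleσ e h) at u5
    change ∀ h, h ≠ .inl e → h ≠ .inl (G.rev e) → _ = Sum.inl (G.circleσ f h) at w5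
    change (G.attachCircle e he).circleσ (.inl f) (.inl (.inl (G.rev f))) = _ at u3
    change (G.attachCircle f hf).circleσ (.inl e) (.inl (.inl (G.rev e))) = _ at w3
    rintro ((k | k | k) | k | k)
    · change sumSwapRight _ _ _ ((G.attachCircle e he).circleσ (.inl f) (.inl (.inl k))) =
        (G.attachCircle f hf).circleσ (.inl e) (.inl (.inl k))
      by_cases k1 : k = e
      · subst k1
        rw [u5 _ (by simpa using h1.symm) (by simpa using r5.symm), s1, w1]; rfl
      by_cases k2 : k = G.rev e
      · subst k2
        rw [u5 _ (by simpa using h2.symm) (by simpa using r4), s3, w3]; rfl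
      by_cases k3 : k = f
      · subst k3
        rw [w5 _ (by simpa using h1) (by simpa using h2), u1, t1]; rfl
      by_cases k4 : k = G.rev f
      · subst k4
        rw [w5 _ (by simpa using r5) (by simpa using r4.symm), u3, t3]; rfl
      rw [w5 _ (by simpa using k1) (by simpa using k2), u5 _ (by simpa using k3) (by simpa using k4),
        s5 _ k1 k2, t5 _ k3 k4]
      rfl
    · change sumSwapRight _ _ _ ((G.attachCircle e he).circleσ (.inl f) (.inl (.inr false))) =
        (G.attachCircle f hf).circleσ (.inl e) (.inr false)
      rw [u5 _ (by simp) (by simp), s2, w2]; rfl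
    · change sumSwapRight _ _ _ ((G.attachCircle e he).circleσ (.inl f) (.inl (.inr true))) =
        (G.attachCircle f hf).circleσ (.inl e) (.inr true)
      rw [u5 _ (by simp) (by simp), s4, w4]; rfl
    · change sumSwapRight _ _ _ ((G.attachCircle e he).circleσ (.inl f) (.inr false)) =
        (G.attachCircle f hf).circleσ (.inl e) (.inl (.inr false))
      rw [w5 _ (by simp) (by simp), t2, u2]; rfl
    · change sumSwapRight _ _ _ ((G.attachCircle e he).circleσ (.inl f) (.inr true)) =
        (G.attachCircle f hf).circleσ (.inl e) (.inl (.inr true))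
      rw [w5 _ (by simp) (by simp), t4, u4]; rfl

end AttachOrder

end Jacobi
end

noncomputable section

namespace Jacobi

open scoped Classical

/-! ### Attaching legs commutes with disjoint unions and resolutions -/

section AttachUnion

variable {G : OGraph}

def Iso.attachEdgeUnion (H : OGraph) (e : G.E) (he : ¬ G.free e) :
    Iso ((G.attachEdge e he).union H) ((G.union H).attachEdge (.inl e) he) where
  toEquiv := sumSwapRight _ _ _
  map_σ := by rintro ((h | h) | h) <;> rfl
  map_free := by rintro ((h | h) | h) <;> exact Iff.rfl
  map_rev := by
    rintro ((k | k | k | k | k) | k)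
    · by_cases k1 : k = e
      · subst k1
        simp [OGraph.edgeRev, sumSwapRight]
      by_cases k2 : k = G.rev e
      · subst k2
        simp [OGraph.edgeRev, sumSwapRight, G.rev_ne]
      simp [OGraph.edgeRev, sumSwapRight, k1, k2]
    all_goals simp [OGraph.edgeRev, sumSwapRight]

def Iso.attachCircleUnion (H : OGraph) (e : G.E) (he : G.free e) :
    Iso ((G.attachCircle e he).union H) ((G.union H).attachCircle (.inl e) he) where
  toEquiv := sumSwapRight _ _ _
  map_rev := by rintro ((h | h) | h) <;> rfl
  map_free := by rintro ((h | h) | h) <;> simp [sumSwapRight]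
  map_σ := by
    obtain ⟨s1, s2, s3, s4, s5⟩ := G.circleσ_apply e he
    have he' : (G.union H).free (.inl e) := he
    obtain ⟨t1, t2, t3, t4, t5⟩ := (G.union H).circleσ_apply (.inl e) he'
    rintro ((k | k | k) | k)
    · change sumSwapRight _ _ _ (.inl (G.circleσ e (.inl k))) =
        (G.union H).circleσ (.inl e) (.inl (.inl k))
      by_cases k1 : k = e
      · subst k1
        rw [s1, t1]; rfl
      by_cases k2 : k = G.rev e
      · subst k2
        rw [s3]; exact t3.symm
      rw [s5 k k1 k2, t5 _ (fun h => k1 (Sum.inl_injective h)) (fun h => k2 (Sum.inl_injective h))]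
      rfl
    · change sumSwapRight _ _ _ (.inl (G.circleσ e (.inr false))) =
        (G.union H).circleσ (.inl e) (.inr false)
      rw [s2, t2]; rfl
    · change sumSwapRight _ _ _ (.inl (G.circleσ e (.inr true))) =
        (G.union H).circleσ (.inl e) (.inr true)
      rw [s4, t4]; rfl
    · exact (t5 (.inr k) (by simp) (by simp)).symm

end AttachUnion

/-! ### Attaching legs to a graph with a 4-valent vertex. -/

section AttachResolve

open OGraph

variable {G : OGraph}

theorem arm_attachEdge (e : G.E) (he : ¬ G.free e) (x : G.E) (j : Fin 4) :
    (G.attachEdge e he).arm (.inl x) j = .inl (G.arm x j) := by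
  fin_cases j <;> rfl

theorem OGraph.IsFourAt.attachEdge {x : G.E} (h : G.IsFourAt x) (e : G.E) (he : ¬ G.free e) :
    (G.attachEdge e he).IsFourAt (.inl x) := by
  refine ⟨congrArg Sum.inl h.1, fun hh => h.2.1 (Sum.inl_injective hh), ?_⟩
  obtain ⟨s1, s2, s3, s4⟩ := G.edgeσ_inr
  rintro (k | k | k | k | k) h0 h1 h2 h3
  · exact congrArg Sum.inl (h.2.2 k (fun h => h0 (congrArg Sum.inl h))
      (fun h => h1 (congrArg Sum.inl h)) (fun h => h2 (congrArg Sum.inl h))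
      (fun h => h3 (congrArg Sum.inl h)))
  all_goals
    change G.edgeσ (G.edgeσ (G.edgeσ _)) = _
    simp only [*]

theorem OGraph.attachEdge_no_strut {e : G.E} {he : ¬ G.free e}
    (hG : ∀ e, ¬ G.free e → ¬ (G.σ e = e ∧ G.σ (G.rev e) = G.rev e)) :
    ∀ z, ¬ (G.attachEdge e he).free z → ¬ ((G.attachEdge e he).σ z = z ∧
      (G.attachEdge e he).σ ((G.attachEdge e he).rev z) = (G.attachEdge e he).rev z) := by
  obtain ⟨s1, s2, s3, s4⟩ := G.edgeσ_inr
  change ∀ z, ¬ Sum.elim G.free (fun _ => False) z →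
      ¬ (G.edgeσ z = z ∧ G.edgeσ (G.edgeRev e z) = G.edgeRev e z)
  rintro (h | h | h | h | h)
  · rintro hf ⟨ha, hb⟩
    have ha' : G.σ h = h := Sum.inl_injective ha
    simp only [edgeRev] at hb
    split_ifs at hb with hc hd
    · rw [s3] at hb
      simp at hb
    · rw [s1] at hb
      simp at hb
    · exact hG h hf ⟨ha', Sum.inl_injective hb⟩
  · rintro - ⟨ha, -⟩
    rw [s3] at ha
    simp at ha
  · rintro - ⟨ha, -⟩
    rw [s1] at ha
    simp at ha
  · rintro - ⟨ha, -⟩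
    rw [s2] at ha
    simp at ha
  · rintro - ⟨-, ha⟩
    change G.edgeσ (.inr .stem) = .inr .stem at ha
    rw [s2] at ha
    simp at ha

theorem OGraph.IsUniTriFour.attachEdge {x : G.E} (h : G.IsUniTriFour x) (e : G.E)
    (he : ¬ G.free e) : (G.attachEdge e he).IsUniTriFour (.inl x) :=
  ⟨h.1.attachEdge e he, attachEdge_no_strut h.2⟩

def Iso.resolveAttachEdge {x : G.E} (h : G.IsFourAt x) (e : G.E) (he : ¬ G.free e) (i : Fin 3)
    (h' : (G.attachEdge e he).IsFourAt (.inl x)) :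
    Iso ((G.resolve x h i).attachEdge (.inl e) he) ((G.attachEdge e he).resolve (.inl x) h' i) where
  toEquiv := sumSwapRight _ _ _
  map_free := by rintro ((h | h) | h) <;> exact Iff.rfl
  map_rev := by
    rintro ((k | k) | k | k | k | k)
    · by_cases k1 : k = e
      · subst k1
        simp [OGraph.edgeRev, sumSwapRight]
      by_cases k2 : k = G.rev e
      · subst k2
        simp [OGraph.edgeRev, sumSwapRight, G.rev_ne]
      simp [OGraph.edgeRev, sumSwapRight, k1, k2]
    all_goals simp [OGraph.edgeRev, sumSwapRight]
  map_σ := by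
    obtain ⟨a1, a2, a3, a4, a5, a6⟩ := h.resolveσ_split i
    obtain ⟨b1, b2, b3, b4, b5, b6⟩ := h'.resolveσ_split i
    simp only [arm_attachEdge] at b1 b2 b3 b4 b5 b6
    rintro ((k | b) | k)
    · change sumSwapRight _ _ _ (.inl (G.resolveσ x i (.inl k))) =
        (G.attachEdge e he).resolveσ (.inl x) i (.inl (.inl k))
      by_cases hk : ∃ j, G.arm x j = k
      · rcases IsFourAt.exists_split i hk with rfl | rfl | rfl | rfl
        · rw [a1, b1]; rfl
        · rw [a2, b2]; rfl
        · rw [a5, b5]; rfl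
        · rw [a6, b6]; rfl
      · rw [resolveσ_of_not i hk, resolveσ_of_not]
        · rfl
        · rintro ⟨j, hj⟩
          rw [arm_attachEdge] at hj
          exact hk ⟨j, Sum.inl_injective hj⟩
    · change sumSwapRight _ _ _ (.inl (G.resolveσ x i (.inr b))) =
        (G.attachEdge e he).resolveσ (.inl x) i (.inr b)
      cases b
      · rw [a3, b3]; rfl
      · rw [a4, b4]; rfl
    · symm
      change (G.attachEdge e he).resolveσ (.inl x) i (.inl (.inr k)) = _
      rw [resolveσ_of_not]
      · rfl
      · rintro ⟨j, hj⟩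
        rw [arm_attachEdge] at hj
        cases hj

theorem arm_attachCircle {x : G.E} (h : G.IsFourAt x) (e : G.E) (he : G.free e) (j : Fin 4) :
    (G.attachCircle e he).arm (.inl x) j = .inl (G.arm x j) := by
  have c : ∀ j, (G.attachCircle e he).σ (.inl (G.arm x j)) = .inl (G.σ (G.arm x j)) :=
    fun j => circleσ_of_not_free he (h.not_free j)
  have c0 : (G.attachCircle e he).σ (.inl x) = .inl (G.σ x) := c 0
  have c1 : (G.attachCircle e he).σ (.inl (G.σ x)) = .inl (G.σ (G.σ x)) := c 1
  have c2 : (G.attachCircle e he).σ (.inl (G.σ (G.σ x))) = .inl (G.σ (G.σ (G.σ x))) := c 2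
  fin_cases j
  · rfl
  · exact c0
  · exact (congrArg _ c0).trans c1
  · exact (congrArg _ ((congrArg _ c0).trans c1)).trans c2

theorem OGraph.IsFourAt.attachCircle {x : G.E} (h : G.IsFourAt x) (e : G.E) (he : G.free e) :
    (G.attachCircle e he).IsFourAt (.inl x) := by
  have hj := h.arm_injective
  have c : ∀ j, (G.attachCircle e he).σ (.inl (G.arm x j)) = .inl (G.arm x (j + 1)) := fun j =>
    (circleσ_of_not_free he (h.not_free j)).trans (congrArg Sum.inl (h.σ_arm j))
  have c0 : (G.attachCircle e he).σ (.inl x) = .inl (G.arm x 1) := c 0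
  obtain ⟨s1, s2, s3, s4, s5⟩ := G.circleσ_apply e he
  change G.circleσ e _ = _ at c0
  change ∀ j, G.circleσ e _ = _ at c
  refine ⟨?_, ?_, ?_⟩
  · change G.circleσ e (G.circleσ e (G.circleσ e (G.circleσ e _))) = _
    rw [c0, c, c, c]; rfl
  · change G.circleσ e (G.circleσ e _) ≠ _
    rw [c0, c]
    exact fun hh => h.2.1 (Sum.inl_injective hh)
  · change ∀ z, z ≠ _ → z ≠ G.circleσ e _ → z ≠ G.circleσ e (G.circleσ e _) →
      z ≠ G.circleσ e (G.circleσ e (G.circleσ e _)) →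
      G.circleσ e (G.circleσ e (G.circleσ e z)) = z
    rw [c0, c, c]
    rintro (k | k | k) h0 h1 h2 h3
    · by_cases k1 : k = e
      · subst k1
        rw [s1, s2, s3]
      by_cases k2 : k = G.rev e
      · subst k2
        rw [s3, s1, s2]
      have key : ∀ h, h ≠ e → h ≠ G.rev e → G.σ h ≠ e ∧ G.σ h ≠ G.rev e := by
        intro h ha hb
        refine ⟨fun hc => ha (G.σ.injective ?_), fun hc => hb (G.σ.injective ?_)⟩
        · rw [hc, G.σ_free e he]
        · rw [hc, G.σ_free _ (G.free_rev e he)]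
      have l1 := key k k1 k2
      have l2 := key _ l1.1 l1.2
      rw [s5 k k1 k2, s5 _ l1.1 l1.2, s5 _ l2.1 l2.2, h.2.2 k (fun h => h0 (congrArg Sum.inl h))
        (fun h => h1 (congrArg Sum.inl h)) (fun h => h2 (congrArg Sum.inl h))
        (fun h => h3 (congrArg Sum.inl h))]
    · rw [s2, s3, s1]
    · rw [s4, s4, s4]

theorem OGraph.attachCircle_no_strut {e : G.E} {he : G.free e}
    (hG : ∀ e, ¬ G.free e → ¬ (G.σ e = e ∧ G.σ (G.rev e) = G.rev e)) :
    ∀ z, ¬ (G.attachCircle e he).free z → ¬ ((G.attachCircle e he).σ z = z ∧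
      (G.attachCircle e he).σ ((G.attachCircle e he).rev z) = (G.attachCircle e he).rev z) := by
  obtain ⟨s1, s2, s3, s4, s5⟩ := G.circleσ_apply e he
  have hr := G.rev_ne e
  change ∀ z, ¬ Sum.elim (fun h => G.free h ∧ h ≠ e ∧ h ≠ G.rev e) (fun _ => False) z →
      ¬ (G.circleσ e z = z ∧ G.circleσ e (Sum.map G.rev not z) = Sum.map G.rev not z)
  rintro (h | b | b)
  · rintro hf ⟨h1, h2⟩
    by_cases ha : h = e
    · subst ha
      rw [s1] at h1
      simp at h1
    by_cases hb : h = G.rev e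
    · subst hb
      rw [s3] at h1
      exact hr (Sum.inl_injective h1).symm
    have ha' : G.rev h ≠ e := fun hc => hb (by rw [← hc, G.rev_rev])
    have hb' : G.rev h ≠ G.rev e := fun hd => ha (by rw [← G.rev_rev h, hd, G.rev_rev])
    rw [s5 h ha hb] at h1
    change G.circleσ e (.inl (G.rev h)) = .inl (G.rev h) at h2
    rw [s5 _ ha' hb'] at h2
    exact hG h (fun hh => hf ⟨hh, ha, hb⟩) ⟨Sum.inl_injective h1, Sum.inl_injective h2⟩
  · rintro - ⟨h1, -⟩
    rw [s2] at h1
    simp at h1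
  · rintro - ⟨-, h1⟩
    change G.circleσ e (.inr false) = .inr false at h1
    rw [s2] at h1
    simp at h1

theorem OGraph.IsUniTriFour.attachCircle {x : G.E} (h : G.IsUniTriFour x) (e : G.E)
    (he : G.free e) : (G.attachCircle e he).IsUniTriFour (.inl x) :=
  ⟨h.1.attachCircle e he, attachCircle_no_strut h.2⟩

def Iso.resolveAttachCircle {x : G.E} (h : G.IsFourAt x) (e : G.E) (he : G.free e) (i : Fin 3)
    (h' : (G.attachCircle e he).IsFourAt (.inl x)) :
    Iso ((G.resolve x h i).attachCircle (.inl e) he)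
      ((G.attachCircle e he).resolve (.inl x) h' i) where
  toEquiv := sumSwapRight _ _ _
  map_free := by rintro ((h | h) | h) <;> simp [sumSwapRight]
  map_rev := by rintro ((k | k) | k) <;> rfl
  map_σ := by
    obtain ⟨a1, a2, a3, a4, a5, a6⟩ := h.resolveσ_split i
    obtain ⟨b1, b2, b3, b4, b5, b6⟩ := h'.resolveσ_split i
    simp only [arm_attachCircle h] at b1 b2 b3 b4 b5 b6
    obtain ⟨s1, s2, s3, s4, s5⟩ := G.circleσ_apply e he
    have he' : (G.resolve x h i).free (.inl e) := he
    obtain ⟨t1, t2, t3, t4, t5⟩ := (G.resolve x h i).circleσ_apply (.inl e) he'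
    change (G.resolve x h i).circleσ (.inl e) (.inl (.inl (G.rev e))) = _ at t3
    have t6 : ∀ z : G.E ⊕ Bool, ¬ (G.resolve x h i).free z →
        (G.resolve x h i).circleσ (.inl e) (.inl z) = .inl (G.resolveσ x i z) :=
      fun z hz => circleσ_of_not_free he' hz
    have na : ∀ z, (∀ j, z ≠ .inl (G.arm x j)) →
        (G.attachCircle e he).resolveσ (.inl x) i (.inl z) = .inl (G.circleσ e z) := by
      intro z hz
      rw [resolveσ_of_not]
      rintro ⟨j, hj⟩
      rw [arm_attachCircle h] at hj
      exact hz j hj.symm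
    have fa : ∀ k, G.free k → ∀ j, k ≠ G.arm x j := fun k hk j hj => h.not_free j (hj ▸ hk)
    rintro ((k | b) | k | k)
    · change sumSwapRight _ _ _ ((G.resolve x h i).circleσ (.inl e) (.inl (.inl k))) =
        (G.attachCircle e he).resolveσ (.inl x) i (.inl (.inl k))
      by_cases k1 : k = e
      · subst k1
        rw [t1, na _ fun j hh => fa _ he j (Sum.inl_injective hh), s1]; rfl
      by_cases k2 : k = G.rev e
      · subst k2
        rw [t3, na _ fun j hh => fa _ (G.free_rev _ he) j (Sum.inl_injective hh), s3]; rfl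
      rw [t5 _ (fun hh => k1 (Sum.inl_injective hh)) (fun hh => k2 (Sum.inl_injective hh))]
      change sumSwapRight _ _ _ (.inl (G.resolveσ x i (.inl k))) = _
      by_cases hk : ∃ j, G.arm x j = k
      · rcases IsFourAt.exists_split i hk with rfl | rfl | rfl | rfl
        · rw [a1, b1]; rfl
        · rw [a2, b2]; rfl
        · rw [a5, b5]; rfl
        · rw [a6, b6]; rfl
      · rw [resolveσ_of_not i hk, na _ fun j hh => hk ⟨j, (Sum.inl_injective hh).symm⟩, s5 _ k1 k2]
        rfl
    · change sumSwapRight _ _ _ ((G.resolve x h i).circleσ (.inl e) (.inl (.inr b))) =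
        (G.attachCircle e he).resolveσ (.inl x) i (.inr b)
      rw [t6 (.inr b) (fun hh => hh)]
      cases b
      · rw [a3, b3]; rfl
      · rw [a4, b4]; rfl
    · change sumSwapRight _ _ _ ((G.resolve x h i).circleσ (.inl e) (.inr false)) =
        (G.attachCircle e he).resolveσ (.inl x) i (.inl (.inr false))
      rw [t2, na _ (by simp), s2]; rfl
    · change sumSwapRight _ _ _ ((G.resolve x h i).circleσ (.inl e) (.inr true)) =
        (G.attachCircle e he).resolveσ (.inl x) i (.inl (.inr true))
      rw [t4, na _ (by simp), s4]; rfl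

end AttachResolve

/-! ### A leg attached to a vertex -/

section LegAtVertex

open OGraph

variable {G : OGraph}

/-- A leg (with the darts `false`, the stem, and `true`) is attached to the 3-valent vertex where
`v` starts, between the third dart and `v`. -/
abbrev OGraph.legAtVertex (G : OGraph) (v : G.E) (hv : G.σ v ≠ v) : OGraph where
  E := G.E ⊕ Bool
  finite := inferInstance
  σ := Equiv.sumCongr G.σ 1 * Equiv.swap (.inr false) (.inl (G.σ (G.σ v)))
  rev := Sum.map G.rev not
  rev_rev := by rintro (e | e) <;> simp [G.rev_rev]
  rev_ne := by rintro (e | e) <;> simp [G.rev_ne]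
  free := Sum.elim G.free (fun _ => False)
  free_rev := by
    rintro (e | e)
    · exact G.free_rev e
    · exact id
  σ_free := by
    rintro (e | e)
    · intro hf
      have : e ≠ G.σ (G.σ v) := by
        rintro rfl
        exact not_free_σ (not_free_σ (not_free_of_σ_ne hv)) hf
      rw [Equiv.Perm.mul_apply, Equiv.swap_apply_of_ne_of_ne (by simp) (by simpa using this)]
      exact congrArg Sum.inl (G.σ_free e hf)
    · exact False.elim

theorem legAtVertex_σ {v : G.E} (hv : G.σ v ≠ v) (h3 : G.σ (G.σ (G.σ v)) = v) :
    (G.legAtVertex v hv).σ (.inr false) = .inl v ∧ (G.legAtVertex v hv).σ (.inr true) = .inr true ∧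
    (G.legAtVertex v hv).σ (.inl (G.σ (G.σ v))) = .inr false ∧
    ∀ e, e ≠ G.σ (G.σ v) → (G.legAtVertex v hv).σ (.inl e) = .inl (G.σ e) := by
  refine ⟨?_, ?_, ?_, fun e he => ?_⟩
  · simp [h3]
  · simp [Equiv.swap_apply_def]
  · simp
  · rw [Equiv.Perm.mul_apply, Equiv.swap_apply_of_ne_of_ne (by simp) (by simpa using he)]
    rfl

theorem orbit_ne {v : G.E} (hv : G.σ v ≠ v) (h3 : G.σ (G.σ (G.σ v)) = v) :
    v ≠ G.σ (G.σ v) ∧ G.σ v ≠ G.σ (G.σ v) :=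
  ⟨fun h => hv (by rw [← h] at h3; exact h3), fun h => hv (G.σ.injective h).symm⟩

theorem legAtVertex_arm {v : G.E} (hv : G.σ v ≠ v) (h3 : G.σ (G.σ (G.σ v)) = v) :
    (G.legAtVertex v hv).arm (.inl v) 0 = .inl v ∧
    (G.legAtVertex v hv).arm (.inl v) 1 = .inl (G.σ v) ∧
    (G.legAtVertex v hv).arm (.inl v) 2 = .inl (G.σ (G.σ v)) ∧
    (G.legAtVertex v hv).arm (.inl v) 3 = .inr false := by
  obtain ⟨s1, s2, s3, s4⟩ := legAtVertex_σ hv h3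
  obtain ⟨n0, n1⟩ := orbit_ne hv h3
  have c0 := s4 _ n0
  have c1 := s4 _ n1
  refine ⟨rfl, c0, ?_, ?_⟩
  · exact (congrArg _ c0).trans c1
  · exact (congrArg _ ((congrArg _ c0).trans c1)).trans s3

theorem OGraph.IsUniTri.legAtVertex (hG : G.IsUniTri) {v : G.E} (hv : G.σ v ≠ v) :
    (G.legAtVertex v hv).IsUniTriFour (.inl v) := by
  have h3 := hG.1 v
  obtain ⟨s1, s2, s3, s4⟩ := legAtVertex_σ hv h3
  obtain ⟨n0, n1⟩ := orbit_ne hv h3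
  have c0 := s4 _ n0
  have c1 := s4 _ n1
  refine ⟨⟨?_, ?_, ?_⟩, ?_⟩
  · rw [c0, c1, s3, s1]
  · rw [c0, c1]
    exact fun h => n0 (Sum.inl_injective h).symm
  · rw [c0, c1, s3]
    rintro (e | e | e) e0 e1 e2 e3
    · have e0' : e ≠ v := fun h => e0 (congrArg Sum.inl h)
      have e1' : e ≠ G.σ v := fun h => e1 (congrArg Sum.inl h)
      have e2' : e ≠ G.σ (G.σ v) := fun h => e2 (congrArg Sum.inl h)
      rw [s4 _ e2', s4 _ fun h => e1' (G.σ.injective h),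
        s4 _ fun h => e0' (G.σ.injective (G.σ.injective h)), hG.1]
    · simp at e3
    · rw [s2, s2, s2]
  · rintro (e | e | e) hf ⟨h1, h2⟩
    · have key : ∀ e, (G.legAtVertex v hv).σ (.inl e) = .inl e → G.σ e = e := by
        intro e he
        by_cases h : e = G.σ (G.σ v)
        · subst h
          rw [s3] at he
          simp at he
        · rw [s4 _ h] at he
          exact Sum.inl_injective he
      exact hG.2 e hf ⟨key e h1, key _ h2⟩
    · rw [s1] at h1
      simp at h1
    · change (G.legAtVertex v hv).σ (.inr false) = .inr false at h2
      rw [s1] at h2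
      simp at h2

/-- The darts of a graph with a leg attached to the edge of `w`, next to the vertex where `w`
starts, compared with the darts of a resolution of the graph with a leg attached to that vertex. -/
def legAtVertexEquiv (G : OGraph) (w : G.E) : G.E ⊕ LegDart ≃ (G.E ⊕ Bool) ⊕ Bool :=
  Equiv.trans
    { toFun := Sum.elim (fun h => .inl (.inl h))
        (fun | .fwd => .inr false | .back => .inr true | .stem => .inl (.inr false)
             | .tip => .inl (.inr true))
      invFun := Sum.elim (Sum.elim .inl (fun b => .inr (bif b then .tip else .stem)))
        (fun b => .inr (bif b then .back else .fwd))
      left_inv := by rintro (h | h | h | h | h) <;> rfl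
      right_inv := by rintro ((h | h | h) | h | h) <;> rfl }
    (Equiv.swap (.inl (.inl w)) (.inr false))

/-- The short edge between the vertex and the attached leg, with the darts `w` and `back`, becomes
the new edge of the resolution. The dart `fwd`, which continues along the old edge, takes over the
name `w`. -/
theorem legAtVertexEquiv_apply (w : G.E) :
    legAtVertexEquiv G w (.inl w) = .inr false ∧
    legAtVertexEquiv G w (.inr .fwd) = .inl (.inl w) ∧
    legAtVertexEquiv G w (.inr .back) = .inr true ∧
    legAtVertexEquiv G w (.inr .stem) = .inl (.inr false) ∧
    legAtVertexEquiv G w (.inr .tip) = .inl (.inr true) ∧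
    ∀ h, h ≠ w → legAtVertexEquiv G w (.inl h) = .inl (.inl h) := by
  refine ⟨?_, ?_, ?_, ?_, ?_, fun h hh => ?_⟩ <;>
    simp [legAtVertexEquiv, Equiv.swap_apply_def, *]

theorem legAtVertexEquiv_rev (w : G.E) (z : G.E ⊕ LegDart) :
    legAtVertexEquiv G w (G.edgeRev w z) =
      Sum.map (Sum.map G.rev not) not (legAtVertexEquiv G w z) := by
  obtain ⟨w1, w2, w3, w4, w5, w6⟩ := legAtVertexEquiv_apply w
  rcases z with h | h | h | h | h
  · by_cases h1 : h = w
    · subst h1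
      rw [edgeRev_self, w1, w3]; rfl
    by_cases h2 : h = G.rev w
    · subst h2
      rw [edgeRev_rev, w2, w6 _ h1]
      simp [G.rev_rev]
    · rw [edgeRev_of_ne h1 h2, w6 _ h1, w6 _ fun hh => h2 (by rw [← hh, G.rev_rev])]
      rfl
  · change legAtVertexEquiv G w (.inl w) = _
    rw [w1, w3]; rfl
  · change legAtVertexEquiv G w (.inl (G.rev w)) = _
    rw [w2, w6 _ (G.rev_ne w)]; rfl
  · change legAtVertexEquiv G w (.inr .tip) = _
    rw [w4, w5]; rfl
  · change legAtVertexEquiv G w (.inr .stem) = _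
    rw [w4, w5]; rfl

theorem legAtVertexEquiv_free (w : G.E) (hw : ¬ G.free w) (z : G.E ⊕ LegDart) :
    Sum.elim (Sum.elim G.free fun _ => False) (fun _ => False) (legAtVertexEquiv G w z) ↔
      Sum.elim G.free (fun _ => False) z := by
  obtain ⟨w1, w2, w3, w4, w5, w6⟩ := legAtVertexEquiv_apply w
  rcases z with h | h | h | h | h
  · by_cases h1 : h = w
    · subst h1
      rw [w1]
      simpa using hw
    · rw [w6 _ h1]; rfl
  · rw [w3]; rfl
  · rw [w2]
    simpa using hw
  · rw [w4]; rfl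
  · rw [w5]; rfl

/-- The first and the third resolution of a leg attached to a vertex: the leg is attached to the
third or the second edge. -/
def Iso.legAtVertex {v : G.E} (hv : G.σ v ≠ v) (hG : G.IsUniTri) (i : Fin 3) (w : G.E)
    (hw : ¬ G.free w) (hi : (i = 0 ∧ w = G.σ (G.σ v)) ∨ (i = 2 ∧ w = G.σ v)) :
    Iso (G.attachEdge w hw)
      ((G.legAtVertex v hv).resolve (.inl v) (hG.legAtVertex hv).1 i) where
  toEquiv := legAtVertexEquiv G w
  map_rev z := legAtVertexEquiv_rev w z
  map_free z := legAtVertexEquiv_free w hw z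
  map_σ := by
    have h3 := hG.1 v
    obtain ⟨w1, w2, w3, w4, w5, w6⟩ := legAtVertexEquiv_apply w
    obtain ⟨s1, s2, s3, s4⟩ := G.edgeσ_inr
    obtain ⟨t1, t2, t3, t4⟩ := legAtVertex_σ hv h3
    obtain ⟨n0, n1⟩ := orbit_ne hv h3
    obtain ⟨m0, m1, m2, m3⟩ := legAtVertex_arm hv h3
    obtain ⟨a1, a2, a3, a4, a5, a6⟩ := (hG.legAtVertex hv).1.resolveσ_split i
    have na : ∀ z, z ≠ .inl v → z ≠ .inl (G.σ v) → z ≠ .inl (G.σ (G.σ v)) → z ≠ .inr false →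
        (G.legAtVertex v hv).resolveσ (.inl v) i (.inl z) = .inl ((G.legAtVertex v hv).σ z) := by
      intro z z0 z1 z2 z3
      rw [resolveσ_of_not]
      rintro ⟨j, hj⟩
      fin_cases j
      · exact z0 (m0 ▸ hj.symm)
      · exact z1 (m1 ▸ hj.symm)
      · exact z2 (m2 ▸ hj.symm)
      · exact z3 (m3 ▸ hj.symm)
    have ninl : ∀ k, k ≠ v → k ≠ G.σ v → k ≠ G.σ (G.σ v) →
        (G.legAtVertex v hv).resolveσ (.inl v) i (.inl (.inl k)) = .inl (.inl (G.σ k)) := by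
      intro k k0 k1 k2
      rw [na _ (by simpa using k0) (by simpa using k1) (by simpa using k2) (by simp), t4 _ k2]
    have ntip : (G.legAtVertex v hv).resolveσ (.inl v) i (.inl (.inr true)) = .inl (.inr true) := by
      rw [na _ (by simp) (by simp) (by simp) (by simp), t2]
    change ∀ z, legAtVertexEquiv G w (G.edgeσ z) =
      (G.legAtVertex v hv).resolveσ (.inl v) i (legAtVertexEquiv G w z)
    rcases hi with ⟨rfl, rfl⟩ | ⟨rfl, rfl⟩
    · simp only [split, Matrix.cons_val_zero, Matrix.cons_val_one, Matrix.cons_val, m0, m1, m2, m3]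
        at a1 a2 a3 a4 a5 a6
      rintro (k | k | k | k | k)
      · rw [edgeσ_inl]
        by_cases k0 : k = v
        · subst k0
          rw [w6 _ n1, w6 _ n0, a1]
        by_cases k1 : k = G.σ v
        · subst k1
          rw [w6 _ n1, w1, a2]
        by_cases k2 : k = G.σ (G.σ v)
        · subst k2
          rw [w1, h3, w6 _ n0, a3]
        rw [w6 _ k2, w6 _ fun h => k1 (G.σ.injective h), ninl _ k0 k1 k2]
      · rw [s3, w2, w3, a4]
      · rw [s1, w2, w4, a5]
      · rw [s2, w4, w3, a6]
      · rw [s4, w5, ntip]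
    · simp only [split, Matrix.cons_val_zero, Matrix.cons_val_one, Matrix.cons_val, m0, m1, m2, m3]
        at a1 a2 a3 a4 a5 a6
      rintro (k | k | k | k | k)
      · rw [edgeσ_inl]
        by_cases k0 : k = v
        · subst k0
          rw [w6 _ hv.symm, w1, a2]
        by_cases k1 : k = G.σ v
        · subst k1
          rw [w6 _ n1.symm, w1, a3]
        by_cases k2 : k = G.σ (G.σ v)
        · subst k2
          rw [w6 _ n1.symm, h3, w6 _ hv.symm, a1]
        rw [w6 _ k1, w6 _ fun h => k0 (G.σ.injective h), ninl _ k0 k1 k2]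
      · rw [s3, w2, w3, a4]
      · rw [s1, w2, w4, a5]
      · rw [s2, w4, w3, a6]
      · rw [s4, w5, ntip]

/-- The second resolution of a leg attached to a vertex: the leg is attached to the first edge,
on the opposite side. -/
def AntiIso.legAtVertex {v : G.E} (hv : G.σ v ≠ v) (hG : G.IsUniTri) (hw : ¬ G.free v) :
    AntiIso (G.attachEdge v hw)
      ((G.legAtVertex v hv).resolve (.inl v) (hG.legAtVertex hv).1 1) (.inr .stem) := by
  have h3 := hG.1 v
  obtain ⟨w1, w2, w3, w4, w5, w6⟩ := legAtVertexEquiv_apply v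
  obtain ⟨s1, s2, s3, s4⟩ := G.edgeσ_inr
  obtain ⟨t1, t2, t3, t4⟩ := legAtVertex_σ hv h3
  obtain ⟨n0, n1⟩ := orbit_ne hv h3
  obtain ⟨m0, m1, m2, m3⟩ := legAtVertex_arm hv h3
  obtain ⟨a1, a2, a3, a4, a5, a6⟩ := (hG.legAtVertex hv).1.resolveσ_split 1
  have na : ∀ z, z ≠ .inl v → z ≠ .inl (G.σ v) → z ≠ .inl (G.σ (G.σ v)) → z ≠ .inr false →
      (G.legAtVertex v hv).resolveσ (.inl v) 1 (.inl z) = .inl ((G.legAtVertex v hv).σ z) := by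
    intro z z0 z1 z2 z3
    rw [resolveσ_of_not]
    rintro ⟨j, hj⟩
    fin_cases j
    · exact z0 (m0 ▸ hj.symm)
    · exact z1 (m1 ▸ hj.symm)
    · exact z2 (m2 ▸ hj.symm)
    · exact z3 (m3 ▸ hj.symm)
  have ninl : ∀ k, k ≠ v → k ≠ G.σ v → k ≠ G.σ (G.σ v) →
      (G.legAtVertex v hv).resolveσ (.inl v) 1 (.inl (.inl k)) = .inl (.inl (G.σ k)) := by
    intro k k0 k1 k2
    rw [na _ (by simpa using k0) (by simpa using k1) (by simpa using k2) (by simp), t4 _ k2]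
  have ntip : (G.legAtVertex v hv).resolveσ (.inl v) 1 (.inl (.inr true)) = .inl (.inr true) := by
    rw [na _ (by simp) (by simp) (by simp) (by simp), t2]
  simp only [split, Matrix.cons_val_zero, Matrix.cons_val_one, Matrix.cons_val, m0, m1, m2, m3]
        at a1 a2 a3 a4 a5 a6
  exact
  { toEquiv := legAtVertexEquiv G v
    map_rev := fun z => legAtVertexEquiv_rev v z
    map_free := fun z => legAtVertexEquiv_free v hw z
    map_σ := by
      change ∀ z, z ≠ _ → z ≠ G.edgeσ _ → z ≠ G.edgeσ (G.edgeσ _) →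
        legAtVertexEquiv G v (G.edgeσ z) =
          (G.legAtVertex v hv).resolveσ (.inl v) 1 (legAtVertexEquiv G v z)
      rw [s2, s3]
      rintro (k | k | k | k | k) q0 q1 q2
      · rw [edgeσ_inl]
        by_cases k0 : k = v
        · subst k0
          rw [w6 _ hv, w1, a3]
        by_cases k1 : k = G.σ v
        · subst k1
          rw [w6 _ n0.symm, w6 _ hv, a1]
        by_cases k2 : k = G.σ (G.σ v)
        · subst k2
          rw [w6 _ n0.symm, h3, w1, a2]
        rw [w6 _ k0, w6 _ (fun h => k2 (G.σ.injective (h.trans h3.symm))), ninl _ k0 k1 k2]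
      · simp at q1
      · simp at q2
      · simp at q0
      · rw [s4, w5, ntip]
    ne := by
      change G.edgeσ _ ≠ _
      rw [s2]; simp
    cube := by
      change G.edgeσ (G.edgeσ (G.edgeσ _)) = _
      rw [s2, s3, s1]
    orbit₀ := by
      change (G.legAtVertex v hv).resolveσ (.inl v) 1 _ = legAtVertexEquiv G v (G.edgeσ (G.edgeσ _))
      rw [s2, s3, w4, w2, a5]
    orbit₁ := by
      change (G.legAtVertex v hv).resolveσ (.inl v) 1 (legAtVertexEquiv G v (G.edgeσ _)) = _
      rw [s2, w3, w4, a4]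
    orbit₂ := by
      change (G.legAtVertex v hv).resolveσ (.inl v) 1
        (legAtVertexEquiv G v (G.edgeσ (G.edgeσ _))) = legAtVertexEquiv G v (G.edgeσ _)
      rw [s2, s3, w2, w3, a6] }

end LegAtVertex

end Jacobi
end

noncomputable section

namespace Jacobi

open scoped Classical

/-! ### Forks -/

namespace OGraph

/-- The dart `t` starts at a 1-valent vertex. -/
def IsTip (G : OGraph) (t : G.E) : Prop := ¬ G.free t ∧ G.σ t = t

/-- Two legs end at the same vertex. -/
def HasFork (G : OGraph) : Prop :=
  ∃ t t', t ≠ t' ∧ G.IsTip t ∧ G.IsTip t' ∧ G.σ (G.rev t) = G.rev t'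

variable {G : OGraph}

theorem isTip_attachEdge_inl {e : G.E} {he : ¬ G.free e} {t : G.E} :
    (G.attachEdge e he).IsTip (.inl t) ↔ G.IsTip t := by
  refine and_congr Iff.rfl ?_
  exact ⟨fun h => Sum.inl_injective h, fun h => congrArg Sum.inl h⟩

theorem isTip_attachEdge_inr {e : G.E} {he : ¬ G.free e} {t : LegDart} :
    (G.attachEdge e he).IsTip (.inr t) ↔ t = .tip := by
  obtain ⟨s1, s2, s3, s4⟩ := G.edgeσ_inr
  have : (G.attachEdge e he).IsTip (.inr t) ↔ G.edgeσ (.inr t) = .inr t :=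
    ⟨fun h => h.2, fun h => ⟨fun hf => hf, h⟩⟩
  rw [this]
  cases t <;> simp [*]

theorem isTip_attachCircle_inl {e : G.E} {he : G.free e} {t : G.E} :
    (G.attachCircle e he).IsTip (.inl t) ↔ G.IsTip t := by
  obtain ⟨s1, s2, s3, s4, s5⟩ := G.circleσ_apply e he
  have : (G.attachCircle e he).IsTip (.inl t) ↔
      ¬ (G.free t ∧ t ≠ e ∧ t ≠ G.rev e) ∧ G.circleσ e (.inl t) = .inl t := Iff.rfl
  rw [this, IsTip]
  by_cases h1 : t = e
  · subst h1
    simp [s1, he]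
  by_cases h2 : t = G.rev e
  · subst h2
    simp [s3, G.free_rev _ he, (G.rev_ne e).symm]
  simp [s5 t h1 h2, h1, h2]

theorem isTip_attachCircle_inr {e : G.E} {he : G.free e} {b : Bool} :
    (G.attachCircle e he).IsTip (.inr b) ↔ b = true := by
  obtain ⟨s1, s2, s3, s4, s5⟩ := G.circleσ_apply e he
  have : (G.attachCircle e he).IsTip (.inr b) ↔ G.circleσ e (.inr b) = .inr b :=
    ⟨fun h => h.2, fun h => ⟨fun hf => hf, h⟩⟩
  rw [this]
  cases b <;> simp [*]

theorem IsTip.map_iso {H : OGraph} (f : Iso G H) {t : G.E} :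
    H.IsTip (f.toEquiv t) ↔ G.IsTip t := by
  rw [IsTip, IsTip, f.map_free, ← f.map_σ, f.toEquiv.injective.eq_iff]

/-- A leg attached to a leg creates a vertex at which both tips hang. -/
theorem hasFork_attachEdge_of_leg {e : G.E} (he : ¬ G.free e) (h : G.IsTip e ∨ G.IsTip (G.rev e)) :
    (G.attachEdge e he).HasFork := by
  obtain ⟨s1, s2, s3, s4⟩ := G.edgeσ_inr
  rcases h with h | h
  · refine ⟨.inr .tip, .inl e, by simp, isTip_attachEdge_inr.2 rfl, isTip_attachEdge_inl.2 h, ?_⟩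
    change G.edgeσ (.inr .stem) = G.edgeRev e (.inl e)
    rw [s2, edgeRev_self]
  · refine ⟨.inl (G.rev e), .inr .tip, by simp, isTip_attachEdge_inl.2 h,
      isTip_attachEdge_inr.2 rfl, ?_⟩
    change G.edgeσ (G.edgeRev e (.inl (G.rev e))) = .inr .stem
    rw [edgeRev_rev, s1]

/-- If the new leg cuts a leg of the old fork, that fork may be destroyed, but the cut leg and the
new one form another. -/
theorem HasFork.attachEdge (hG : G.HasFork) (e : G.E) (he : ¬ G.free e) :
    (G.attachEdge e he).HasFork := by
  by_cases h : G.IsTip e ∨ G.IsTip (G.rev e)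
  · exact hasFork_attachEdge_of_leg he h
  · obtain ⟨t, t', h0, h1, h2, h3⟩ := hG
    have key : ∀ t, G.IsTip t → t ≠ e ∧ t ≠ G.rev e := fun t ht =>
      ⟨fun hh => h (.inl (hh ▸ ht)), fun hh => h (.inr (hh ▸ ht))⟩
    refine ⟨.inl t, .inl t', by simpa using h0, isTip_attachEdge_inl.2 h1,
      isTip_attachEdge_inl.2 h2, ?_⟩
    change G.edgeσ (G.edgeRev e (.inl t)) = G.edgeRev e (.inl t')
    rw [edgeRev_of_ne (key t h1).1 (key t h1).2, edgeRev_of_ne (key t' h2).1 (key t' h2).2,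
      edgeσ_inl, h3]

theorem HasFork.attachCircle (hG : G.HasFork) (e : G.E) (he : G.free e) :
    (G.attachCircle e he).HasFork := by
  obtain ⟨t, t', h0, h1, h2, h3⟩ := hG
  refine ⟨.inl t, .inl t', by simpa using h0, isTip_attachCircle_inl.2 h1,
    isTip_attachCircle_inl.2 h2, ?_⟩
  change G.circleσ e (.inl (G.rev t)) = .inl (G.rev t')
  rw [circleσ_of_not_free he (by rw [free_rev_iff]; exact h1.1), h3]

theorem HasFork.map_iso {H : OGraph} (hG : G.HasFork) (f : Iso G H) : H.HasFork := by
  obtain ⟨t, t', h0, h1, h2, h3⟩ := hG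
  refine ⟨f.toEquiv t, f.toEquiv t', fun h => h0 (f.toEquiv.injective h),
    (IsTip.map_iso f).2 h1, (IsTip.map_iso f).2 h2, ?_⟩
  rw [← f.map_rev, ← f.map_σ, h3, f.map_rev]

end OGraph

open OGraph in
/-- The exchange of the two legs of a fork. -/
def AntiIso.fork {G : OGraph} (hG : G.IsUniTri) {t t' : G.E} (h0 : t ≠ t') (h1 : G.IsTip t)
    (h2 : G.IsTip t') (h3 : G.σ (G.rev t) = G.rev t') : AntiIso G G (G.rev t) := by
  have r0 : G.rev t ≠ G.rev t' := fun h => h0 (G.rev_injective h)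
  have ns : ∀ t, G.IsTip t → G.σ (G.rev t) ≠ G.rev t := fun t ht h => hG.2 t ht.1 ⟨ht.2, h⟩
  have n1 : t ≠ G.rev t := (G.rev_ne t).symm
  have n2 : t' ≠ G.rev t' := (G.rev_ne t').symm
  have n3 : t ≠ G.rev t' := fun h => ns t' h2 (by rw [← h, h1.2])
  have n4 : t' ≠ G.rev t := fun h => ns t h1 (by rw [← h, h2.2])
  have c := hG.1 (G.rev t)
  rw [h3] at c
  have q0 : G.σ (G.rev t') ≠ G.rev t' := ns t' h2
  have q1 : G.σ (G.rev t') ≠ G.rev t := fun h => by rw [h, h3] at c; exact r0 c.symm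
  have q2 : G.σ (G.rev t') ≠ t := fun h => by
    rw [h, h1.2] at c; exact n1 c
  have q3 : G.σ (G.rev t') ≠ t' := fun h => by
    rw [h, h2.2] at c; exact n4 c
  let ψ : Equiv.Perm G.E := Equiv.swap t t' * Equiv.swap (G.rev t) (G.rev t')
  have p1 : ψ t = t' := by
    simp [ψ, Equiv.swap_apply_of_ne_of_ne n1 n3]
  have p2 : ψ t' = t := by
    simp [ψ, Equiv.swap_apply_of_ne_of_ne n4 n2]
  have p3 : ψ (G.rev t) = G.rev t' := by
    simp [ψ, Equiv.swap_apply_of_ne_of_ne n3.symm n2.symm]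
  have p4 : ψ (G.rev t') = G.rev t := by
    simp [ψ, Equiv.swap_apply_of_ne_of_ne n1.symm n4.symm]
  have p5 : ∀ e, e ≠ t → e ≠ t' → e ≠ G.rev t → e ≠ G.rev t' → ψ e = e := fun e a b c d => by
    simp [ψ, Equiv.swap_apply_of_ne_of_ne a b, Equiv.swap_apply_of_ne_of_ne c d]
  exact
  { toEquiv := ψ
    map_rev := fun e => by
      by_cases e1 : e = t
      · rw [e1, p1, p3]
      by_cases e2 : e = t'
      · rw [e2, p2, p4]
      by_cases e3 : e = G.rev t
      · rw [e3, p3, G.rev_rev, G.rev_rev, p1]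
      by_cases e4 : e = G.rev t'
      · rw [e4, p4, G.rev_rev, G.rev_rev, p2]
      rw [p5 e e1 e2 e3 e4, p5]
      · rwa [ne_eq, rev_eq_iff]
      · rwa [ne_eq, rev_eq_iff]
      · rwa [ne_eq, G.rev_injective.eq_iff]
      · rwa [ne_eq, G.rev_injective.eq_iff]
    map_free := fun e => by
      have f1 := h1.1
      have f2 := h2.1
      have f3 : ¬ G.free (G.rev t) := by rwa [free_rev_iff]
      have f4 : ¬ G.free (G.rev t') := by rwa [free_rev_iff]
      by_cases e1 : e = t
      · subst e1; simp [p1, f1, f2]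
      by_cases e2 : e = t'
      · subst e2; simp [p2, f1, f2]
      by_cases e3 : e = G.rev t
      · subst e3; simp [p3, f3, f4]
      by_cases e4 : e = G.rev t'
      · subst e4; simp [p4, f3, f4]
      rw [p5 e e1 e2 e3 e4]
    map_σ := fun e a b c' => by
      rw [h3] at b c'
      by_cases e1 : e = t
      · rw [e1, h1.2, p1, h2.2]
      by_cases e2 : e = t'
      · rw [e2, h2.2, p2, h1.2]
      rw [p5 e e1 e2 a b, p5]
      · exact fun h => e1 (G.σ.injective (h.trans h1.2.symm))
      · exact fun h => e2 (G.σ.injective (h.trans h2.2.symm))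
      · exact fun h => c' (G.σ.injective (h.trans c.symm))
      · exact fun h => a (G.σ.injective (h.trans h3.symm))
    ne := ns t h1
    cube := hG.1 _
    orbit₀ := by rw [p3, h3, p5 _ q2 q3 q1 q0]
    orbit₁ := by rw [h3, p4, h3, p3]
    orbit₂ := by rw [h3, p5 _ q2 q3 q1 q0, p4, c] }

/-! ### Graphs with legs attached, as elements of `B` -/

section Legs

variable (K : Type*) [Field K]

theorem B.graph_congr {G H : UTGraph} (f : Iso G.1 H.1) : B.graph K G = B.graph K H := by
  rw [B.graph, BTilde.graph_congr f, B.graph]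

theorem B.graph_mul (G H : UTGraph) : B.graph K G * B.graph K H = B.graph K (G.union H) := by
  rw [B.graph, B.graph, ← map_mul, BTilde.graph_mul, B.graph]

theorem B.graph_antiIso {G H : UTGraph} {v : G.1.E} (f : AntiIso G.1 H.1 v) :
    B.graph K G + B.graph K H = 0 := by
  rw [← B.graph_congr K (G := G.flip v f.ne) f.iso, B.graph, B.graph, ← map_add,
    Ideal.Quotient.eq_zero_iff_mem]
  exact Submodule.mem_sup_left (Submodule.subset_span ⟨G, v, f.ne, rfl⟩)

theorem B.graph_resolve {G : OGraph} {x : G.E} (h : G.IsUniTriFour x) :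
    B.graph K ⟨G.resolve x h.1 0, h.resolve 0⟩ - B.graph K ⟨G.resolve x h.1 1, h.resolve 1⟩
      + B.graph K ⟨G.resolve x h.1 2, h.resolve 2⟩ = 0 := by
  rw [B.graph, B.graph, B.graph, ← map_sub, ← map_add, Ideal.Quotient.eq_zero_iff_mem]
  exact Submodule.mem_sup_right (Submodule.subset_span ⟨G, x, h, rfl⟩)

/-- The class of the graph that is obtained from `Γ` by attaching legs successively at the darts
in the list (on the left-hand side, next to the vertices where the darts start). -/
def legs (K : Type*) [Field K] : (Γ : UTGraph) → List Γ.1.E → B K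
  | Γ, [] => B.graph K Γ
  | Γ, e :: L =>
    if h : Γ.1.free e then legs K (Γ.attachCircle e h) (L.map Sum.inl)
    else legs K (Γ.attachEdge e h) (L.map Sum.inl)
termination_by _ L => L.length

variable {K}

theorem legs_nil (Γ : UTGraph) : legs K Γ [] = B.graph K Γ := by rw [legs]

theorem legs_circle {Γ : UTGraph} {e : Γ.1.E} (h : Γ.1.free e) (L : List Γ.1.E) :
    legs K Γ (e :: L) = legs K (Γ.attachCircle e h) (L.map Sum.inl) := by rw [legs, dif_pos h]

theorem legs_edge {Γ : UTGraph} {e : Γ.1.E} (h : ¬ Γ.1.free e) (L : List Γ.1.E) :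
    legs K Γ (e :: L) = legs K (Γ.attachEdge e h) (L.map Sum.inl) := by rw [legs, dif_neg h]

/-- The recursion in `legs` replaces the graph by a larger one. So this and the following statements
are proved by induction on the number of legs, with the graph arbitrary. -/
theorem legs_iso {Γ Γ' : UTGraph} (f : Iso Γ.1 Γ'.1) (L : List Γ.1.E) :
    legs K Γ L = legs K Γ' (L.map f.toEquiv) := by
  induction hn : L.length generalizing Γ Γ' with
  | zero =>
    rw [List.length_eq_zero_iff] at hn
    subst hn
    rw [List.map_nil, legs_nil, legs_nil, B.graph_congr K f]
  | succ n ih =>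
    obtain ⟨e, L, rfl⟩ := List.exists_cons_of_length_eq_add_one hn
    rw [List.length_cons, Nat.add_right_cancel_iff] at hn
    rw [List.map_cons]
    by_cases h : Γ.1.free e
    · have h' := (f.map_free e).2 h
      rw [legs_circle h, legs_circle h', ih (Γ' := Γ'.attachCircle _ h') (f.attachCircle e h h') _
        (by simpa using hn), List.map_map, List.map_map]
      rfl
    · have h' := (f.map_free e).not.2 h
      rw [legs_edge h, legs_edge h', ih (Γ' := Γ'.attachEdge _ h') (f.attachEdge e h h') _
        (by simpa using hn), List.map_map, List.map_map]
      rfl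

/-- The reversed vertex survives every attachment, so AS needs to be applied only once, after the
last leg. -/
theorem legs_antiIso {Γ Γ' : UTGraph} {v : Γ.1.E} (f : AntiIso Γ.1 Γ'.1 v) (L : List Γ.1.E) :
    legs K Γ L + legs K Γ' (L.map f.toEquiv) = 0 := by
  induction hn : L.length generalizing Γ Γ' with
  | zero =>
    rw [List.length_eq_zero_iff] at hn
    subst hn
    rw [List.map_nil, legs_nil, legs_nil, B.graph_antiIso K f]
  | succ n ih =>
    obtain ⟨e, L, rfl⟩ := List.exists_cons_of_length_eq_add_one hn
    rw [List.length_cons, Nat.add_right_cancel_iff] at hn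
    rw [List.map_cons]
    by_cases h : Γ.1.free e
    · have h' := (f.map_free e).2 h
      rw [legs_circle h, legs_circle h', ← ih (Γ := Γ.attachCircle e h)
        (Γ' := Γ'.attachCircle _ h') (f.attachCircle e h h') (L.map .inl) (by simpa using hn), List.map_map, List.map_map]
      rfl
    · have h' := (f.map_free e).not.2 h
      rw [legs_edge h, legs_edge h', ← ih (Γ := Γ.attachEdge e h)
        (Γ' := Γ'.attachEdge _ h') (f.attachEdge e h h') (L.map .inl) (by simpa using hn), List.map_map, List.map_map]
      rfl

/-- A leg attached to a graph with a 4-valent vertex leaves that vertex intact, and attaching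
commutes with resolving. So IHX is applied once, after all legs have been attached. -/
theorem legs_resolve {G : OGraph} {x : G.E} (h : G.IsUniTriFour x) (L : List G.E) :
    legs K ⟨G.resolve x h.1 0, h.resolve 0⟩ (L.map .inl)
      - legs K ⟨G.resolve x h.1 1, h.resolve 1⟩ (L.map .inl)
      + legs K ⟨G.resolve x h.1 2, h.resolve 2⟩ (L.map .inl) = 0 := by
  induction hn : L.length generalizing G with
  | zero =>
    rw [List.length_eq_zero_iff] at hn
    subst hn
    rw [List.map_nil, legs_nil, legs_nil, legs_nil, B.graph_resolve K h]
  | succ n ih =>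
    obtain ⟨e, L, rfl⟩ := List.exists_cons_of_length_eq_add_one hn
    rw [List.length_cons, Nat.add_right_cancel_iff] at hn
    by_cases he : G.free e
    · have key : ∀ i, legs K ⟨G.resolve x h.1 i, h.resolve i⟩ ((e :: L).map .inl) =
          legs K ⟨(G.attachCircle e he).resolve (.inl x) (h.attachCircle e he).1 i,
            (h.attachCircle e he).resolve i⟩ ((L.map Sum.inl).map .inl) := by
        intro i
        have he' : (G.resolve x h.1 i).free (.inl e) := he
        rw [List.map_cons, legs_circle he',
          legs_iso (Γ' := ⟨(G.attachCircle e he).resolve (.inl x) (h.attachCircle e he).1 i,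
            (h.attachCircle e he).resolve i⟩) (Iso.resolveAttachCircle h.1 e he i (h.attachCircle e he).1), List.map_map,
          List.map_map, List.map_map]
        rfl
      rw [key, key, key, ih (h.attachCircle e he) _ (by simpa using hn)]
    · have key : ∀ i, legs K ⟨G.resolve x h.1 i, h.resolve i⟩ ((e :: L).map .inl) =
          legs K ⟨(G.attachEdge e he).resolve (.inl x) (h.attachEdge e he).1 i,
            (h.attachEdge e he).resolve i⟩ ((L.map Sum.inl).map .inl) := by
        intro i
        have he' : ¬ (G.resolve x h.1 i).free (.inl e) := he
        rw [List.map_cons, legs_edge he',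
          legs_iso (Γ' := ⟨(G.attachEdge e he).resolve (.inl x) (h.attachEdge e he).1 i,
            (h.attachEdge e he).resolve i⟩) (Iso.resolveAttachEdge h.1 e he i (h.attachEdge e he).1), List.map_map,
          List.map_map, List.map_map]
        rfl
      rw [key, key, key, ih (h.attachEdge e he) _ (by simpa using hn)]

/-! ### Relations between attached legs: side, order, forks and vertices. -/

theorem legs_rev {Γ : UTGraph} (e : Γ.1.E) (L : List Γ.1.E) :
    legs K Γ (e :: L) + legs K Γ (Γ.1.rev e :: L) = 0 := by
  by_cases h : Γ.1.free e
  · have h' := Γ.1.free_rev e h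
    rw [legs_circle h, legs_circle h', ← legs_antiIso (Γ := Γ.attachCircle e h)
      (Γ' := Γ.attachCircle (Γ.1.rev e) h') (AntiIso.attachCircleRev Γ.1 e h h') (L.map .inl), List.map_map]
    rfl
  · have h' := (OGraph.free_rev_iff (e := e)).not.2 h
    rw [legs_edge h, legs_edge h', ← legs_antiIso (Γ := Γ.attachEdge e h)
      (Γ' := Γ.attachEdge (Γ.1.rev e) h') (AntiIso.attachEdgeRev Γ.1 e h h') (L.map .inl), List.map_map]
    rfl

/-- Legs at different darts do not interfere. Only two legs on the same circle, at `e` and at `rev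
e`, need an argument, since the first attachment turns the circle into an edge. -/
theorem legs_swap {Γ : UTGraph} (e f : Γ.1.E) (L : List Γ.1.E) :
    legs K Γ (e :: f :: L) = legs K Γ (f :: e :: L) := by
  by_cases hfe : f = e
  · rw [hfe]
  have edge_circle : ∀ e f : Γ.1.E, Γ.1.free e → ¬ Γ.1.free f →
      legs K Γ (e :: f :: L) = legs K Γ (f :: e :: L) := by
    intro e f he hf
    have he' : (Γ.attachEdge f hf).1.free (.inl e) := he
    have hf' : ¬ (Γ.attachCircle e he).1.free (.inl f) := fun h => hf h.1
    rw [legs_circle he, legs_edge hf, List.map_cons, List.map_cons, legs_edge hf', legs_circle he',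
      legs_iso (Γ' := (Γ.attachEdge f hf).attachCircle (.inl e) he')
        (Iso.attachCircleEdge he hf hf'), List.map_map, List.map_map, List.map_map]
    rfl
  by_cases he : Γ.1.free e
  · by_cases hf : Γ.1.free f
    · by_cases hr : f = Γ.1.rev e
      · subst hr
        -- Both orders are the negative of two legs at `e`: one by moving the first leg to the other
        -- side, the other by moving the second.
        have h1 := legs_rev (K := K) (Γ := Γ) e (e :: L)
        have h2 := legs_rev (K := K) (Γ := Γ.attachCircle e he) (.inl e) (L.map .inl)
        have h3 : legs K Γ (e :: e :: L) + legs K Γ (e :: Γ.1.rev e :: L) = 0 := by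
          rw [legs_circle he, legs_circle he]
          exact h2
        rw [← h3] at h1
        exact (add_left_cancel h1).symm
      · have hf' : (Γ.attachCircle e he).1.free (.inl f) := ⟨hf, hfe, hr⟩
        have he' : (Γ.attachCircle f hf).1.free (.inl e) :=
          ⟨he, Ne.symm hfe, fun h => hr (by rw [h, Γ.1.rev_rev])⟩
        rw [legs_circle he, legs_circle hf, List.map_cons, List.map_cons, legs_circle hf',
          legs_circle he', legs_iso (Γ' := (Γ.attachCircle f hf).attachCircle (.inl e) he')
            (Iso.attachCircleCircle he hf hfe hr hf' he'), List.map_map, List.map_map, List.map_map]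
        rfl
    · exact edge_circle e f he hf
  · by_cases hf : Γ.1.free f
    · exact (edge_circle f e hf he).symm
    · have hf' : ¬ (Γ.attachEdge e he).1.free (.inl f) := hf
      have he' : ¬ (Γ.attachEdge f hf).1.free (.inl e) := he
      rw [legs_edge he, legs_edge hf, List.map_cons, List.map_cons, legs_edge hf',
        legs_edge he', legs_iso (Γ' := (Γ.attachEdge f hf).attachEdge (.inl e) he')
          (Iso.attachEdgeEdge he hf hfe), List.map_map, List.map_map, List.map_map]
      rfl

theorem legs_perm {Γ : UTGraph} {L L' : List Γ.1.E} (h : L.Perm L') :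
    legs K Γ L = legs K Γ L' := by
  induction hn : L.length generalizing Γ with
  | zero =>
    rw [List.length_eq_zero_iff] at hn
    subst hn
    rw [List.Perm.nil_eq h]
  | succ n ih =>
    induction h with
    | nil => rfl
    -- After the common first leg the remaining lists are shorter but live on a larger graph. This
    -- is why there is an outer induction on the length.
    | cons e p _ =>
      rw [List.length_cons, Nat.add_right_cancel_iff] at hn
      by_cases he : Γ.1.free e
      · rw [legs_circle he, legs_circle he]
        exact ih (p.map _) (by simpa using hn)
      · rw [legs_edge he, legs_edge he]
        exact ih (p.map _) (by simpa using hn)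
    | swap e f L => exact legs_swap _ _ _
    | trans p q ihp ihq => exact (ihp hn).trans (ihq (p.length_eq ▸ hn))

/-- Forks persist when legs are attached, so it suffices to treat a graph with a fork and no further
legs to attach. Exchanging the two legs of the fork maps the graph to itself and reverses one
vertex. -/
theorem legs_of_hasFork [CharZero K] {Γ : UTGraph} (h : Γ.1.HasFork) (L : List Γ.1.E) :
    legs K Γ L = 0 := by
  induction hn : L.length generalizing Γ with
  | zero =>
    rw [List.length_eq_zero_iff] at hn
    subst hn
    obtain ⟨t, t', h0, h1, h2, h3⟩ := h
    have := B.graph_antiIso K (AntiIso.fork Γ.2 h0 h1 h2 h3)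
    rw [legs_nil]
    -- AS says that twice the graph is zero, and $2$ is invertible.
    rwa [← two_smul K, smul_eq_zero_iff_right (two_ne_zero)] at this
  | succ n ih =>
    obtain ⟨e, L, rfl⟩ := List.exists_cons_of_length_eq_add_one hn
    rw [List.length_cons, Nat.add_right_cancel_iff] at hn
    by_cases he : Γ.1.free e
    · rw [legs_circle he]
      exact ih (Γ := Γ.attachCircle e he) (h.attachCircle e he) _ (by simpa using hn)
    · rw [legs_edge he]
      exact ih (Γ := Γ.attachEdge e he) (h.attachEdge e he) _ (by simpa using hn)

theorem legs_of_leg [CharZero K] {Γ : UTGraph} {e : Γ.1.E}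
    (h : Γ.1.IsTip e ∨ Γ.1.IsTip (Γ.1.rev e)) (L : List Γ.1.E) : legs K Γ (e :: L) = 0 := by
  have he : ¬ Γ.1.free e := by
    rcases h with h | h
    · exact h.1
    · exact fun hf => h.1 (Γ.1.free_rev e hf)
  rw [legs_edge he]
  exact legs_of_hasFork (Γ := Γ.attachEdge e he) (OGraph.hasFork_attachEdge_of_leg he h) _

/-- The sum over the three ways to attach a leg next to a 3-valent vertex vanishes. -/
theorem graph_vertex {Γ : UTGraph} {v : Γ.1.E} (hv : Γ.1.σ v ≠ v) :
    legs K Γ [v] + legs K Γ [Γ.1.σ v] + legs K Γ [Γ.1.σ (Γ.1.σ v)] = 0 := by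
  have n0 := OGraph.not_free_of_σ_ne hv
  have n1 := OGraph.not_free_σ n0
  have n2 := OGraph.not_free_σ n1
  rw [legs_edge n0, legs_edge n1, legs_edge n2, List.map_nil, legs_nil, legs_nil, legs_nil]
  -- IHX is used at the 4-valent vertex obtained by attaching the leg to `v` itself. Its resolutions
  -- are the leg on the three edges at `v`. In the middle one the leg is on the opposite side, and
  -- this sign absorbs the minus sign of IHX.
  have hr := B.graph_resolve K (Γ.2.legAtVertex hv)
  rw [← B.graph_congr K (G := Γ.attachEdge _ n2) (H := ⟨_, (Γ.2.legAtVertex hv).resolve 0⟩)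
      (Iso.legAtVertex hv Γ.2 0 _ n2 (.inl ⟨rfl, rfl⟩)),
    ← B.graph_congr K (G := Γ.attachEdge _ n1) (H := ⟨_, (Γ.2.legAtVertex hv).resolve 2⟩)
      (Iso.legAtVertex hv Γ.2 2 _ n1 (.inr ⟨rfl, rfl⟩))] at hr
  have ha := B.graph_antiIso K (G := Γ.attachEdge _ n0)
    (H := ⟨_, (Γ.2.legAtVertex hv).resolve 1⟩) (AntiIso.legAtVertex hv Γ.2 n0)
  rw [eq_neg_of_add_eq_zero_right ha] at hr
  rw [← hr]
  ring

/-- The movable leg is put last: the vertex of `v` is unchanged while the legs in `L` are attached,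
so the relation without other legs can be used at the end. -/
theorem legs_vertex_append {Γ : UTGraph} {v : Γ.1.E} (hv : Γ.1.σ v ≠ v) (L : List Γ.1.E) :
    legs K Γ (L ++ [v]) + legs K Γ (L ++ [Γ.1.σ v]) + legs K Γ (L ++ [Γ.1.σ (Γ.1.σ v)]) = 0 := by
  induction hn : L.length generalizing Γ with
  | zero =>
    rw [List.length_eq_zero_iff] at hn
    subst hn
    exact graph_vertex hv
  | succ n ih =>
    obtain ⟨e, L, rfl⟩ := List.exists_cons_of_length_eq_add_one hn
    rw [List.length_cons, Nat.add_right_cancel_iff] at hn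
    simp only [List.cons_append]
    by_cases he : Γ.1.free e
    · have n0 := OGraph.not_free_of_σ_ne hv
      have c0 : (Γ.attachCircle e he).1.σ (.inl v) = .inl (Γ.1.σ v) :=
        OGraph.circleσ_of_not_free he n0
      have c1 : (Γ.attachCircle e he).1.σ (.inl (Γ.1.σ v)) = .inl (Γ.1.σ (Γ.1.σ v)) :=
        OGraph.circleσ_of_not_free he (OGraph.not_free_σ n0)
      have := ih (Γ := Γ.attachCircle e he) (v := .inl v)
        (by rw [c0]; exact fun h => hv (Sum.inl_injective h)) (L.map .inl) (by simpa using hn)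
      rw [c0, c1] at this
      simpa only [legs_circle he, List.map_append, List.map_cons, List.map_nil] using this
    · have := ih (Γ := Γ.attachEdge e he) (v := .inl v)
        (fun h => hv (Sum.inl_injective h)) (L.map .inl) (by simpa using hn)
      simp only [OGraph.edgeσ_inl] at this
      simpa only [legs_edge he, List.map_append, List.map_cons, List.map_nil] using this

theorem legs_vertex [CharZero K] {Γ : UTGraph} {v : Γ.1.E} (hv : ¬ Γ.1.free v) (L : List Γ.1.E) :
    legs K Γ (v :: L) + legs K Γ (Γ.1.σ v :: L) + legs K Γ (Γ.1.σ (Γ.1.σ v) :: L) = 0 := by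
  by_cases h : Γ.1.σ v = v
  -- At a 1-valent vertex the three terms coincide, and each is a leg attached to a leg.
  · rw [h, h, legs_of_leg (.inl ⟨hv, h⟩), add_zero, add_zero]
  · have p : ∀ e, legs K Γ (e :: L) = legs K Γ (L ++ [e]) := fun e =>
      legs_perm (List.perm_append_singleton e L).symm
    rw [p, p, p, legs_vertex_append h]

/-! ### Legs and disjoint unions -/

theorem graph_mul_legs (Γ Γ' : UTGraph) (L : List Γ'.1.E) :
    B.graph K Γ * legs K Γ' L = legs K (Γ.union Γ') (L.map .inr) := by
  induction hn : L.length generalizing Γ' with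
  | zero =>
    rw [List.length_eq_zero_iff] at hn
    subst hn
    rw [List.map_nil, legs_nil, legs_nil, B.graph_mul]
  | succ n ih =>
    obtain ⟨e, L, rfl⟩ := List.exists_cons_of_length_eq_add_one hn
    rw [List.length_cons, Nat.add_right_cancel_iff] at hn
    -- The isomorphisms between attachments and unions have the leg in the left summand, so the
    -- factors are exchanged first.
    have c : ∀ M : List (Γ'.1.E), legs K (Γ.union Γ') (M.map .inr) =
        legs K (Γ'.union Γ) (M.map .inl) := by
      intro M
      rw [legs_iso (Γ' := Γ'.union Γ) (Iso.unionComm Γ.1 Γ'.1), List.map_map]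
      rfl
    rw [c, List.map_cons]
    by_cases he : Γ'.1.free e
    · have he' : (Γ'.union Γ).1.free (.inl e) := he
      rw [legs_circle he, legs_circle he', ih (Γ'.attachCircle e he) _ (by simpa using hn),
        legs_iso (Γ' := (Γ'.attachCircle e he).union Γ) (Iso.unionComm Γ.1 _),
        legs_iso (Γ' := (Γ'.union Γ).attachCircle (.inl e) he') (Iso.attachCircleUnion Γ.1 e he),
        List.map_map, List.map_map, List.map_map, List.map_map]
      rfl
    · have he' : ¬ (Γ'.union Γ).1.free (.inl e) := he
      rw [legs_edge he, legs_edge he', ih (Γ'.attachEdge e he) _ (by simpa using hn),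
        legs_iso (Γ' := (Γ'.attachEdge e he).union Γ) (Iso.unionComm Γ.1 _),
        legs_iso (Γ' := (Γ'.union Γ).attachEdge (.inl e) he') (Iso.attachEdgeUnion Γ.1 e he),
        List.map_map, List.map_map, List.map_map, List.map_map]
      rfl

theorem legs_mul_legs (Γ Γ' : UTGraph) (L : List Γ.1.E) (L' : List Γ'.1.E) :
    legs K Γ L * legs K Γ' L' = legs K (Γ.union Γ') (L.map .inl ++ L'.map .inr) := by
  induction hn : L.length generalizing Γ with
  | zero =>
    rw [List.length_eq_zero_iff] at hn
    subst hn
    rw [legs_nil, graph_mul_legs, List.map_nil, List.nil_append]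
  | succ n ih =>
    obtain ⟨e, L, rfl⟩ := List.exists_cons_of_length_eq_add_one hn
    rw [List.length_cons, Nat.add_right_cancel_iff] at hn
    rw [List.map_cons, List.cons_append]
    by_cases he : Γ.1.free e
    · have he' : (Γ.union Γ').1.free (.inl e) := he
      rw [legs_circle he, legs_circle he', ih (Γ.attachCircle e he) _ (by simpa using hn),
        legs_iso (Γ' := (Γ.union Γ').attachCircle (.inl e) he') (Iso.attachCircleUnion Γ'.1 e he),
        List.map_append, List.map_append, List.map_map, List.map_map, List.map_map, List.map_map,
        List.map_map]
      rfl
    · have he' : ¬ (Γ.union Γ').1.free (.inl e) := he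
      rw [legs_edge he, legs_edge he', ih (Γ.attachEdge e he) _ (by simpa using hn),
        legs_iso (Γ' := (Γ.union Γ').attachEdge (.inl e) he') (Iso.attachEdgeUnion Γ'.1 e he),
        List.map_append, List.map_append, List.map_map, List.map_map, List.map_map, List.map_map,
        List.map_map]
      rfl

end Legs

end Jacobi
end

noncomputable section

namespace Jacobi

open scoped Classical

/-! ### Generators and relations of the cohomology -/

section Generators

variable (K : Type*) [Field K] {G : OGraph}

theorem edgeClass_rev (e : G.E) : edgeClass K G (G.rev e) = - edgeClass K G e := by
  rw [edgeClass, edgeClass, ← map_neg]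
  congr 1
  ext h
  change (Pi.single (G.rev e) 1 - Pi.single (G.rev (G.rev e)) 1 : G.E → K) h =
    - (Pi.single e 1 - Pi.single (G.rev e) 1 : G.E → K) h
  rw [G.rev_rev]
  simp

theorem H1.mk_eq_zero {c : cochains K G} (h : c.1 ∈ coboundaries K G) : H1.mk K G c = 0 :=
  (Submodule.Quotient.mk_eq_zero _).2 h

/-- The sum is the coboundary of minus the indicator function of the vertex where `e` starts. At a
1-valent vertex the dart is counted three times on both sides. -/
theorem edgeClass_vertex {e : G.E} (he : ¬ G.free e) (h3 : G.σ (G.σ (G.σ e)) = e) :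
    edgeClass K G e + edgeClass K G (G.σ e) + edgeClass K G (G.σ (G.σ e)) = 0 := by
  rw [edgeClass, edgeClass, edgeClass, ← map_add, ← map_add]
  apply H1.mk_eq_zero
  let χ : G.E → G.E → K := fun a h => if h = a then 1 else 0
  have hχ : ∀ a h, χ (G.σ a) (G.σ h) = χ a h := fun a h => by
    simp only [χ, G.σ.injective.eq_iff]
  refine ⟨fun h => - (χ e h + χ (G.σ e) h + χ (G.σ (G.σ e)) h), fun h => ?_, fun h hf => ?_,
    fun h => ?_⟩
  · have h0 : χ e (G.σ h) = χ (G.σ (G.σ e)) h := by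
      rw [← hχ (G.σ (G.σ e)) h, h3]
    simp only [hχ, h0]
    ring
  · have n0 : h ≠ e := fun hh => he (hh ▸ hf)
    have n1 : h ≠ G.σ e := fun hh => OGraph.not_free_σ he (hh ▸ hf)
    have n2 : h ≠ G.σ (G.σ e) := fun hh => OGraph.not_free_σ (OGraph.not_free_σ he) (hh ▸ hf)
    simp [χ, n0, n1, n2]
  · have key : ∀ a, (dualCochain K G a).1 h = χ a h - χ a (G.rev h) := fun a => by
      change (Pi.single a 1 - Pi.single (G.rev a) 1 : G.E → K) h = _
      simp only [Pi.sub_apply, Pi.single_apply, χ, OGraph.rev_eq_iff]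
    change (dualCochain K G e).1 h + (dualCochain K G (G.σ e)).1 h
      + (dualCochain K G (G.σ (G.σ e))).1 h = _
    simp only [key]
    ring

/-- Isomorphisms, the change of a cyclic order, resolutions and the inclusions into a union all pull
back along a map that is inverse to an injection `j` of darts. On monomials they merely rename the
darts, which reduces statements about $S^*H^1$ to statements about lists of legs. -/
theorem Collapse.S_edgeMonomial {G H : OGraph} (f : Collapse K G H) (j : G.E → H.E)
    (hrev : ∀ e, H.rev (j e) = j (G.rev e))
    (hf : ∀ e h, f.r h = some e ↔ h = j e) (s : Multiset G.E) :
    f.S (edgeMonomial K G s) = edgeMonomial K H (s.map j) := by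
  rw [edgeMonomial, edgeMonomial, map_multiset_prod, Multiset.map_map, Multiset.map_map]
  congr 1
  refine Multiset.map_congr rfl fun e _ => ?_
  rw [Function.comp_apply, Function.comp_apply, Collapse.S_ι]
  congr 1
  rw [edgeClass, edgeClass, Collapse.H1map_mk]
  congr 1
  ext h
  change pull f.r (Pi.single e 1 - Pi.single (G.rev e) 1) h =
    (Pi.single (j e) 1 - Pi.single (H.rev (j e)) 1 : H.E → K) h
  rw [pull_apply, hrev]
  have h1 : ∀ e, (Pi.single (j e) (1 : K) : H.E → K) h = if f.r h = some e then 1 else 0 := by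
    intro e
    rw [Pi.single_apply]
    simp only [hf]
  rw [Pi.sub_apply, h1, h1]
  cases f.r h with
  | none => simp
  | some a => simp [Pi.single_apply]

theorem edgeMonomial_zero : edgeMonomial K G 0 = 1 := by simp [edgeMonomial]

variable [CharZero K]

instance (G : OGraph) : Fintype G.E := Fintype.ofFinite _

/-- The sum runs over both orientations of every edge, and they contribute equally; hence the factor
$1/2$. -/
theorem sum_dualCochain (c : cochains K G) :
    c = (2⁻¹ : K) • ∑ e, c.1 e • dualCochain K G e := by
  ext h
  have : ((2⁻¹ : K) • ∑ e, c.1 e • dualCochain K G e : cochains K G).1 h =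
      (2⁻¹ : K) * ∑ e, c.1 e * ((Pi.single e 1 - Pi.single (G.rev e) 1 : G.E → K) h) := by
    simp [dualCochain, Finset.sum_apply]
  rw [this]
  simp only [Pi.sub_apply, Pi.single_apply, mul_sub, mul_ite, mul_one, mul_zero,
    Finset.sum_sub_distrib]
  have h1 : ∀ e, h = G.rev e ↔ e = G.rev h := fun e => by
    rw [← OGraph.rev_eq_iff, eq_comm]
  simp only [h1, Finset.sum_ite_eq, Finset.sum_ite_eq', Finset.mem_univ, if_true, c.2 h]
  field_simp
  norm_num

theorem H1.mk_eq_sum (c : cochains K G) :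
    H1.mk K G c = (2⁻¹ : K) • ∑ e, c.1 e • edgeClass K G e := by
  conv_lhs => rw [sum_dualCochain K c]
  simp [edgeClass]

theorem span_edgeClass : Submodule.span K (Set.range (edgeClass K G)) = ⊤ := by
  rw [eq_top_iff]
  rintro x -
  obtain ⟨c, rfl⟩ := Submodule.mkQ_surjective _ x
  change H1.mk K G c ∈ _
  rw [H1.mk_eq_sum]
  exact Submodule.smul_mem _ _ (Submodule.sum_mem _ fun e _ =>
    Submodule.smul_mem _ _ (Submodule.subset_span ⟨e, rfl⟩))

theorem deg_eq_span (m : ℕ) :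
    SH1.deg K G m = Submodule.span K {x | ∃ s : Multiset G.E, s.card = m ∧ x = edgeMonomial K G s} := by
  have hr : LinearMap.range (SH1.ι K G) =
      Submodule.span K (Set.range fun e => SH1.ι K G (edgeClass K G e)) := by
    rw [LinearMap.range_eq_map, ← span_edgeClass, Submodule.map_span, ← Set.range_comp]
    rfl
  induction m with
  | zero =>
    rw [SH1.deg, pow_zero, Submodule.one_eq_span]
    congr 1
    ext x
    simp [edgeMonomial]
  | succ m ih =>
    have : SH1.deg K G (m + 1) = SH1.deg K G m * LinearMap.range (SH1.ι K G) := pow_succ _ _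
    rw [this, ih, hr, Submodule.span_mul_span]
    congr 1
    ext x
    constructor
    · rintro ⟨_, ⟨s, hs, rfl⟩, _, ⟨e, rfl⟩, rfl⟩
      exact ⟨e ::ₘ s, by simp [hs], by simp [edgeMonomial, mul_comm]⟩
    · rintro ⟨s, hs, rfl⟩
      obtain ⟨e, s, rfl, -⟩ := Multiset.card_eq_succ_iff.1 hs
      exact ⟨_, ⟨s, by simpa using hs, rfl⟩, _, ⟨e, rfl⟩, by simp [edgeMonomial, mul_comm]⟩

theorem span_edgeMonomial : Submodule.span K (Set.range (edgeMonomial K G)) = ⊤ := by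
  have hmul : ∀ x ∈ Submodule.span K (Set.range (edgeMonomial K G)),
      ∀ y ∈ Submodule.span K (Set.range (edgeMonomial K G)),
      x * y ∈ Submodule.span K (Set.range (edgeMonomial K G)) := by
    intro x hx y hy
    have := Submodule.mul_mem_mul hx hy
    rw [Submodule.span_mul_span] at this
    refine Submodule.span_mono ?_ this
    rintro _ ⟨_, ⟨s, rfl⟩, _, ⟨s', rfl⟩, rfl⟩
    exact ⟨s + s', by simp [edgeMonomial]⟩
  rw [eq_top_iff]
  rintro x -
  have h1 : (1 : SH1 K G) ∈ Submodule.span K (Set.range (edgeMonomial K G)) :=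
    Submodule.subset_span ⟨0, by simp [edgeMonomial]⟩
  refine SymmetricAlgebra.induction (R := K) (M := H1 K G)
    (motive := fun x => (x : SH1 K G) ∈ Submodule.span K (Set.range (edgeMonomial K G)))
    ?_ ?_ ?_ ?_ x
  · intro r
    change algebraMap K (SH1 K G) r ∈ _
    rw [Algebra.algebraMap_eq_smul_one]
    exact Submodule.smul_mem _ _ h1
  · intro x
    change SH1.ι K G x ∈ _
    have hx : x ∈ Submodule.span K (Set.range (edgeClass K G)) := by
      rw [span_edgeClass]; trivial
    induction hx using Submodule.span_induction with
    | mem x hx =>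
      obtain ⟨e, rfl⟩ := hx
      exact Submodule.subset_span ⟨{e}, by simp [edgeMonomial]⟩
    | zero => rw [map_zero]; exact Submodule.zero_mem _
    | add x y _ _ hx hy => rw [map_add]; exact Submodule.add_mem _ hx hy
    | smul r x _ hx => rw [map_smul]; exact Submodule.smul_mem _ _ hx
  · intro a b ha hb
    exact hmul a ha b hb
  · intro a b ha hb
    exact Submodule.add_mem _ ha hb

/-- This is used where multiplicativity is not available: `legsHom` is only linear, since the
product of $\mathcal B$ is disjoint union. -/
theorem SH1_linearMap_ext {M : Type*} [AddCommGroup M] [Module K M] {f g : SH1 K G →ₗ[K] M}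
    (h : ∀ s, f (edgeMonomial K G s) = g (edgeMonomial K G s)) : f = g :=
  LinearMap.ext_on (span_edgeMonomial K) (by rintro _ ⟨s, rfl⟩; exact h s)

end Generators

end Jacobi
end

noncomputable section

namespace Jacobi

open scoped Classical

/-! ### From cohomology classes to graphs with legs -/

section LegsHom

variable {K : Type*} [Field K]

variable (K) in
/-- The class of a graph with legs attached at a multiset of darts. -/
def legsM (Γ : UTGraph) (s : Multiset Γ.1.E) : B K :=
  Quotient.liftOn s (legs K Γ) fun _ _ h => legs_perm h

theorem legsM_rev (Γ : UTGraph) (e : Γ.1.E) (s : Multiset Γ.1.E) :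
    legsM K Γ (e ::ₘ s) + legsM K Γ (Γ.1.rev e ::ₘ s) = 0 := by
  induction s using Quotient.inductionOn with
  | h L => exact legs_rev e L

theorem legsM_vertex [CharZero K] (Γ : UTGraph) {e : Γ.1.E} (he : ¬ Γ.1.free e) (s : Multiset Γ.1.E) :
    legsM K Γ (e ::ₘ s) + legsM K Γ (Γ.1.σ e ::ₘ s) + legsM K Γ (Γ.1.σ (Γ.1.σ e) ::ₘ s) = 0 := by
  induction s using Quotient.inductionOn with
  | h L => exact legs_vertex he L

variable (K) in
/-- The relations between the classes dual to the edges. -/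
inductive EdgeRel (G : OGraph) : MvPolynomial G.E K → Prop
  | rev (e : G.E) : EdgeRel G (MvPolynomial.X e + MvPolynomial.X (G.rev e))
  | vertex (e : G.E) (he : ¬ G.free e) : EdgeRel G
      (MvPolynomial.X e + MvPolynomial.X (G.σ e) + MvPolynomial.X (G.σ (G.σ e)))

variable (K) in
/-- The symmetric algebra of `H¹`, by generators and relations. -/
abbrev EdgeAlg (G : OGraph) := MvPolynomial G.E K ⧸ Ideal.span {p | EdgeRel K G p}

variable (K) in
/-- The generator of an oriented edge. -/
def EdgeAlg.X (G : OGraph) (e : G.E) : EdgeAlg K G := Ideal.Quotient.mk _ (MvPolynomial.X e)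

theorem EdgeAlg.X_rev (G : OGraph) (e : G.E) : X K G (G.rev e) = - X K G e := by
  have h := Ideal.Quotient.eq_zero_iff_mem.2
    (Ideal.subset_span (s := {p | EdgeRel K G p}) (EdgeRel.rev e))
  rw [map_add] at h
  exact eq_neg_of_add_eq_zero_right h

theorem EdgeAlg.X_vertex (G : OGraph) {e : G.E} (he : ¬ G.free e) :
    X K G e + X K G (G.σ e) + X K G (G.σ (G.σ e)) = 0 := by
  have h := Ideal.Quotient.eq_zero_iff_mem.2
    (Ideal.subset_span (s := {p | EdgeRel K G p}) (EdgeRel.vertex e he))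
  rwa [map_add, map_add] at h

variable (K) in
/-- The linear map that sends a monomial to the graph with legs. -/
def polyLegs (Γ : UTGraph) : MvPolynomial Γ.1.E K →ₗ[K] B K :=
  (MvPolynomial.basisMonomials Γ.1.E K).constr K fun n => legsM K Γ (Finsupp.toMultiset n)

theorem polyLegs_monomial (Γ : UTGraph) (n : Γ.1.E →₀ ℕ) :
    polyLegs K Γ (MvPolynomial.monomial n 1) = legsM K Γ (Finsupp.toMultiset n) := by
  exact (congrArg _ (congrFun (MvPolynomial.coe_basisMonomials Γ.1.E K) n).symm).trans
    (Module.Basis.constr_basis _ _ _ _)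

theorem polyLegs_monomial_mul (Γ : UTGraph) (n : Γ.1.E →₀ ℕ) (e : Γ.1.E) :
    polyLegs K Γ (MvPolynomial.monomial n 1 * MvPolynomial.X e) =
      legsM K Γ (e ::ₘ Finsupp.toMultiset n) := by
  rw [MvPolynomial.X, MvPolynomial.monomial_mul, mul_one, polyLegs_monomial, map_add, add_comm,
    Finsupp.toMultiset_single, one_smul, Multiset.singleton_add]

variable [CharZero K]

/-- Take the vertex relation at every dart with the weight `φ` and add up. As `φ` is constant on
vertices, the three parts have the same sum, so three times the claim results; $3$ is invertible. No
choice of one dart per vertex is needed. On free darts there is no vertex relation, but `φ`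
vanishes. -/
theorem EdgeAlg.sum_eq_zero (G : OGraph) (φ : G.E → K) (h1 : ∀ e, φ (G.σ e) = φ e)
    (h2 : ∀ e, G.free e → φ e = 0) : ∑ e, φ e • X K G e = 0 := by
  have s1 : ∀ ψ : G.E → EdgeAlg K G, ∑ e, ψ (G.σ e) = ∑ e, ψ e := fun ψ => Equiv.sum_comp G.σ ψ
  have a1 : ∑ e, φ e • X K G (G.σ e) = ∑ e, φ e • X K G e := by
    rw [← s1 fun e => φ e • X K G e]
    exact Finset.sum_congr rfl fun e _ => by rw [h1]
  have a2 : ∑ e, φ e • X K G (G.σ (G.σ e)) = ∑ e, φ e • X K G e := by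
    rw [← a1, ← s1 fun e => φ e • X K G (G.σ e)]
    exact Finset.sum_congr rfl fun e _ => by rw [h1]
  have a3 : ∑ e, φ e • (X K G e + X K G (G.σ e) + X K G (G.σ (G.σ e))) = 0 := by
    refine Finset.sum_eq_zero fun e _ => ?_
    by_cases he : G.free e
    · rw [h2 e he, zero_smul]
    · rw [EdgeAlg.X_vertex G he, smul_zero]
  simp only [smul_add, Finset.sum_add_distrib, a1, a2] at a3
  have a4 : (3 : K) • ∑ e, φ e • X K G e = 0 := by
    rw [← a3]
    module
  exact (smul_eq_zero_iff_right (by norm_num)).1 a4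

/-- The map from cochains to the algebra given by generators and relations. -/
def EdgeAlg.ofCochain (G : OGraph) : cochains K G →ₗ[K] EdgeAlg K G where
  -- The factor $1/2$ makes the cochain dual to `e` go to the generator of `e`, since both
  -- orientations of the edge contribute.
  toFun c := (2⁻¹ : K) • ∑ e, c.1 e • X K G e
  map_add' a b := by
    rw [← smul_add, ← Finset.sum_add_distrib]
    simp [add_smul]
  map_smul' r a := by
    have : ∑ e, (r • a).1 e • X K G e = r • ∑ e, a.1 e • X K G e := by
      rw [Finset.smul_sum]
      exact Finset.sum_congr rfl fun e _ => (smul_smul r (a.1 e) (X K G e)).symm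
    rw [RingHom.id_apply, this, smul_comm]

/-- Reindexing by `rev` changes the sign of the generators. So both halves of a coboundary reduce to
the weighted vertex sum of `EdgeAlg.sum_eq_zero`. -/
theorem EdgeAlg.ofCochain_coboundary (G : OGraph) (c : cochains K G)
    (hc : c.1 ∈ coboundaries K G) : ofCochain G c = 0 := by
  obtain ⟨φ, h1, h2, h3⟩ := hc
  change (2⁻¹ : K) • ∑ e, c.1 e • X K G e = 0
  have hr : ∑ e, φ (G.rev e) • X K G e = - ∑ e, φ e • X K G e := by
    let r : Equiv.Perm G.E := ⟨G.rev, G.rev, G.rev_rev, G.rev_rev⟩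
    rw [← Equiv.sum_comp r fun e => φ e • X K G e, ← Finset.sum_neg_distrib]
    refine Finset.sum_congr rfl fun e _ => ?_
    change _ = - (φ (G.rev e) • X K G (G.rev e))
    rw [EdgeAlg.X_rev, smul_neg, neg_neg]
  simp only [h3, sub_smul, Finset.sum_sub_distrib, hr, sum_eq_zero G φ h1 h2]
  simp

/-- The map from `H¹` to the algebra given by generators and relations. -/
def EdgeAlg.ofH1 (G : OGraph) : H1 K G →ₗ[K] EdgeAlg K G :=
  Submodule.liftQ _ (ofCochain G) fun c hc => ofCochain_coboundary G c hc

theorem EdgeAlg.ofH1_edgeClass (G : OGraph) (e : G.E) : ofH1 G (edgeClass K G e) = X K G e := by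
  change (2⁻¹ : K) • ∑ h, (Pi.single e 1 - Pi.single (G.rev e) 1 : G.E → K) h • X K G h = _
  simp only [Pi.sub_apply, sub_smul, Finset.sum_sub_distrib, Pi.single_apply, ite_smul, one_smul,
    zero_smul, Finset.sum_ite_eq', Finset.mem_univ, if_true, EdgeAlg.X_rev, sub_neg_eq_add,
    ← two_smul K (X K G e), smul_smul]
  simp

/-- The homomorphism from the symmetric algebra of `H¹` to the algebra given by generators and
relations. -/
def EdgeAlg.ofSH1 (G : OGraph) : SH1 K G →ₐ[K] EdgeAlg K G := SymmetricAlgebra.lift (ofH1 G)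

theorem EdgeAlg.ofSH1_edgeMonomial (G : OGraph) (s : Multiset G.E) :
    ofSH1 G (edgeMonomial K G s) = (s.map (X K G)).prod := by
  rw [edgeMonomial, map_multiset_prod, Multiset.map_map]
  congr 1
  refine Multiset.map_congr rfl fun e _ => ?_
  rw [← EdgeAlg.ofH1_edgeClass]
  exact SymmetricAlgebra.lift_ι_apply (A := EdgeAlg K G) (ofH1 G) _

/-- As `polyLegs` is not multiplicative, it must kill each relation times an arbitrary monomial,
that is, in the presence of any other legs. The relations between legs were proved in that
generality. -/
theorem polyLegs_mul_rel (Γ : UTGraph) (q : MvPolynomial Γ.1.E K) {p : MvPolynomial Γ.1.E K}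
    (hp : EdgeRel K Γ.1 p) : polyLegs K Γ (q * p) = 0 := by
  have : polyLegs K Γ ∘ₗ LinearMap.mulRight K p = 0 := by
    refine (MvPolynomial.basisMonomials Γ.1.E K).ext fun n => ?_
    rw [MvPolynomial.coe_basisMonomials, LinearMap.comp_apply, LinearMap.mulRight_apply,
      LinearMap.zero_apply]
    cases hp with
    | rev e => rw [mul_add, map_add, polyLegs_monomial_mul, polyLegs_monomial_mul, legsM_rev]
    | vertex e he =>
      rw [mul_add, mul_add, map_add, map_add, polyLegs_monomial_mul, polyLegs_monomial_mul,
        polyLegs_monomial_mul, legsM_vertex Γ he]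
  exact LinearMap.congr_fun this q

theorem polyLegs_of_mem (Γ : UTGraph) {p : MvPolynomial Γ.1.E K}
    (hp : p ∈ Ideal.span {p | EdgeRel K Γ.1 p}) : polyLegs K Γ p = 0 := by
  suffices ∀ q, polyLegs K Γ (q * p) = 0 by simpa using this 1
  refine Submodule.span_induction (p := fun p _ => ∀ q, polyLegs K Γ (q * p) = 0) ?_ ?_ ?_ ?_ hp
  · exact fun p hp q => polyLegs_mul_rel Γ q hp
  · simp
  · intro a b _ _ ha hb q
    rw [mul_add, map_add, ha, hb, add_zero]
  · intro r a _ ha q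
    rw [smul_eq_mul, ← mul_assoc, ha]

variable (K) in
/-- The linear map from the symmetric algebra of `H¹` to `B` that attaches legs to a graph. -/
def legsHom (Γ : UTGraph) : SH1 K Γ.1 →ₗ[K] B K :=
  (Submodule.liftQ ((Ideal.span {p | EdgeRel K Γ.1 p}).restrictScalars K) (polyLegs K Γ)
      fun _ hp => polyLegs_of_mem Γ hp) ∘ₗ
    (Submodule.Quotient.restrictScalarsEquiv K (Ideal.span {p | EdgeRel K Γ.1 p})).symm.toLinearMap ∘ₗ
    (EdgeAlg.ofSH1 Γ.1).toLinearMap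

theorem legsHom_edgeMonomial (Γ : UTGraph) (s : Multiset Γ.1.E) :
    legsHom K Γ (edgeMonomial K Γ.1 s) = legsM K Γ s := by
  have h1 : EdgeAlg.ofSH1 Γ.1 (edgeMonomial K Γ.1 s) =
      Ideal.Quotient.mk _ (MvPolynomial.monomial (Multiset.toFinsupp s) (1 : K)) := by
    rw [EdgeAlg.ofSH1_edgeMonomial]
    induction s using Multiset.induction with
    | empty => simp
    | cons e s ih =>
      rw [Multiset.map_cons, Multiset.prod_cons, ih, EdgeAlg.X, ← map_mul, MvPolynomial.X,
        MvPolynomial.monomial_mul, one_mul, ← Multiset.singleton_add, map_add,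
        Multiset.toFinsupp_singleton]
  have h2 : polyLegs K Γ (MvPolynomial.monomial (Multiset.toFinsupp s) (1 : K)) = legsM K Γ s := by
    rw [polyLegs_monomial, Multiset.toFinsupp_toMultiset]
  rw [← h2]
  rw [legsHom, LinearMap.comp_apply, LinearMap.comp_apply, AlgHom.toLinearMap_apply, h1]
  rfl

/-- Here and in the next lemmas the statement is checked on edge monomials, where it becomes the
corresponding statement about `legs`. -/
theorem legsHom_iso {Γ Γ' : UTGraph} (f : Iso Γ.1 Γ'.1) (x : SH1 K Γ.1) :
    legsHom K Γ' (isoS K f x) = legsHom K Γ x := by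
  have : legsHom K Γ' ∘ₗ (isoS K f).toLinearMap = legsHom K Γ := by
    refine SH1_linearMap_ext K fun s => ?_
    change legsHom K Γ' ((Collapse.ofIso K f).S _) = _
    rw [Collapse.S_edgeMonomial K _ f.toEquiv (fun e => (f.map_rev e).symm), legsHom_edgeMonomial,
      legsHom_edgeMonomial]
    · induction s using Quotient.inductionOn with
      | h L => exact (legs_iso f L).symm
    · intro e h
      change some (f.toEquiv.symm h) = some e ↔ _
      rw [Option.some_inj, Equiv.symm_apply_eq]
  exact LinearMap.congr_fun this x

theorem legsHom_flip {Γ : UTGraph} (e : Γ.1.E) (he : Γ.1.σ e ≠ e) (x : SH1 K Γ.1) :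
    legsHom K Γ x + legsHom K (Γ.flip e he) ((Collapse.flip K Γ.1 e).S x) = 0 := by
  have : legsHom K Γ + legsHom K (Γ.flip e he) ∘ₗ (Collapse.flip K Γ.1 e).S.toLinearMap = 0 := by
    refine SH1_linearMap_ext K fun s => ?_
    change _ + legsHom K (Γ.flip e he) ((Collapse.flip K Γ.1 e).S _) = 0
    rw [Collapse.S_edgeMonomial K (Collapse.flip K Γ.1 e) (fun h => h) (fun _ => rfl),
      legsHom_edgeMonomial]
    · rw [legsHom_edgeMonomial (Γ.flip e he)]
      induction s using Quotient.inductionOn with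
      | h L => exact legs_antiIso (Γ' := Γ.flip e he) (AntiIso.flip Γ.1 e he (Γ.2.1 e)) L
    · intro e h
      exact Option.some_inj
  exact LinearMap.congr_fun this x

theorem legsHom_resolve {G : OGraph} {v : G.E} (h : G.IsUniTriFour v) (x : SH1 K G) :
    legsHom K ⟨_, h.resolve 0⟩ ((Collapse.resolve K G v h.1 0).S x)
      - legsHom K ⟨_, h.resolve 1⟩ ((Collapse.resolve K G v h.1 1).S x)
      + legsHom K ⟨_, h.resolve 2⟩ ((Collapse.resolve K G v h.1 2).S x) = 0 := by
  have key : ∀ i s, legsHom K ⟨_, h.resolve i⟩ ((Collapse.resolve K G v h.1 i).S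
      (edgeMonomial K G s)) = legsM K ⟨_, h.resolve i⟩ (s.map .inl) := by
    intro i s
    rw [Collapse.S_edgeMonomial K _ Sum.inl (fun _ => rfl)]
    · exact legsHom_edgeMonomial ⟨_, h.resolve i⟩ _
    · rintro e (k | k)
      · exact ⟨fun hh => congrArg Sum.inl (Option.some_inj.1 hh),
          fun hh => congrArg some (Sum.inl_injective hh)⟩
      · exact ⟨(nomatch ·), (nomatch ·)⟩
  have : legsHom K ⟨_, h.resolve 0⟩ ∘ₗ (Collapse.resolve K G v h.1 0).S.toLinearMap
      - legsHom K ⟨_, h.resolve 1⟩ ∘ₗ (Collapse.resolve K G v h.1 1).S.toLinearMap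
      + legsHom K ⟨_, h.resolve 2⟩ ∘ₗ (Collapse.resolve K G v h.1 2).S.toLinearMap = 0 := by
    refine SH1_linearMap_ext K fun s => ?_
    rw [LinearMap.add_apply, LinearMap.sub_apply, LinearMap.comp_apply, LinearMap.comp_apply,
      LinearMap.comp_apply, AlgHom.toLinearMap_apply, AlgHom.toLinearMap_apply,
      AlgHom.toLinearMap_apply, key, key, key]
    induction s using Quotient.inductionOn with
    | h L => exact legs_resolve h L
  exact LinearMap.congr_fun this x

theorem legsHom_tens (Γ Γ' : UTGraph) (x : SH1 K Γ.1) (y : SH1 K Γ'.1) :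
    legsHom K (Γ.union Γ') (DTilde.tens K Γ.1 Γ'.1 x y) = legsHom K Γ x * legsHom K Γ' y := by
  have : (DTilde.tens K Γ.1 Γ'.1).compr₂ (legsHom K (Γ.union Γ')) =
      (LinearMap.mul K (B K)).compl₁₂ (legsHom K Γ) (legsHom K Γ') := by
    refine SH1_linearMap_ext K fun s => SH1_linearMap_ext K fun s' => ?_
    change legsHom K (Γ.union Γ') ((Collapse.inl K Γ.1 Γ'.1).S _ * (Collapse.inr K Γ.1 Γ'.1).S _) =
      legsHom K Γ _ * legsHom K Γ' _
    rw [Collapse.S_edgeMonomial K _ Sum.inl (fun _ => rfl),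
      Collapse.S_edgeMonomial K _ Sum.inr (fun _ => rfl)]
    · have : edgeMonomial K (Γ.1.union Γ'.1) (s.map .inl) *
          edgeMonomial K (Γ.1.union Γ'.1) (s'.map .inr) =
          edgeMonomial K (Γ.union Γ').1 (s.map .inl + s'.map .inr) := by
        simp [edgeMonomial]
      rw [this, legsHom_edgeMonomial, legsHom_edgeMonomial, legsHom_edgeMonomial]
      induction s using Quotient.inductionOn with
      | h L =>
        induction s' using Quotient.inductionOn with
        | h L' => exact (legs_mul_legs Γ Γ' L L').symm
    · rintro e (k | k)
      · exact ⟨(nomatch ·), (nomatch ·)⟩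
      · exact ⟨fun hh => congrArg Sum.inr (Option.some_inj.1 hh),
          fun hh => congrArg some (Sum.inr_injective hh)⟩
    · rintro e (k | k)
      · exact ⟨fun hh => congrArg Sum.inl (Option.some_inj.1 hh),
          fun hh => congrArg some (Sum.inl_injective hh)⟩
      · exact ⟨(nomatch ·), (nomatch ·)⟩
  exact LinearMap.congr_fun₂ this x y

/-! ### The homomorphism from `D` to `B` -/

variable (K) in
/-- Legs are attached to closed graphs. -/
def tildeToB : DTilde K →ₗ[K] B K :=
  DTilde.lift K fun c => legsHom K c.rep.toUT ∘ₗ (invS K c.rep.1).subtype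

/-- All terms of the average have the same image, because attaching legs is invariant under
isomorphisms. So neither the projector nor the chosen representative matters. -/
theorem tildeToB_proj (G : TriGraph) (x : SH1 K G.1) :
    tildeToB K (DTilde.proj K G x) = legsHom K G.toUT x := by
  change tildeToB K (DTilde.incl K _ (projS K _ (isoS K (TriClass.repIso G) x))) = _
  rw [tildeToB, DTilde.lift_incl]
  change legsHom K _ (avg K _ _) = _
  have h : ∀ g, legsHom K (TriClass.mk G).rep.toUT
      (isoS K g (isoS K (TriClass.repIso G) x)) = legsHom K G.toUT x := by
    intro g
    rw [← isoS_trans]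
    exact legsHom_iso (Γ := G.toUT) (Γ' := (TriClass.mk G).rep.toUT) _ x
  rw [avg_apply, map_smul, map_sum, Finset.sum_congr rfl fun g _ => h g, Finset.sum_const,
    Finset.card_univ, ← Nat.cast_smul_eq_nsmul K, smul_smul, inv_mul_cancel₀ (card_iso_ne_zero K _),
    one_smul]

theorem tildeToB_mul (a b : DTilde K) : tildeToB K (a * b) = tildeToB K a * tildeToB K b := by
  induction a using DTilde.induction_on K with
  | h0 => rw [zero_mul, map_zero, zero_mul]
  | hadd a a' ha ha' => rw [add_mul, map_add, ha, ha', map_add, add_mul]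
  | hp G x =>
    induction b using DTilde.induction_on K with
    | h0 => rw [mul_zero, map_zero, mul_zero]
    | hadd a a' ha ha' => rw [mul_add, map_add, ha, ha', map_add, mul_add]
    | hp H y =>
      rw [DTilde.proj_mul_proj, tildeToB_proj, tildeToB_proj, tildeToB_proj]
      exact legsHom_tens G.toUT H.toUT x y

theorem tildeToB_one : tildeToB K 1 = 1 := by
  change tildeToB K (DTilde.proj K TriGraph.empty 1) = 1
  rw [tildeToB_proj, ← edgeMonomial_zero]
  refine (legsHom_edgeMonomial TriGraph.empty.toUT 0).trans ?_
  exact legs_nil _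

theorem tildeToB_relIdeal {z : DTilde K} (hz : z ∈ DTilde.relIdeal K) : tildeToB K z = 0 := by
  have hle : DTilde.AS K ⊔ DTilde.IHX K ≤ LinearMap.ker (tildeToB K) := by
    refine sup_le (Submodule.span_le.2 ?_) (Submodule.span_le.2 ?_)
    · rintro _ ⟨G, e, he, x, rfl⟩
      change tildeToB K _ = 0
      rw [map_add, tildeToB_proj, tildeToB_proj]
      exact legsHom_flip (Γ := G.toUT) e he x
    · rintro _ ⟨G, v, h, x, rfl⟩
      change tildeToB K _ = 0
      rw [map_add, map_sub, tildeToB_proj, tildeToB_proj, tildeToB_proj]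
      exact legsHom_resolve ⟨h.1, fun e he h' => h.2 e he h'.1⟩ x
  exact hle hz

variable (K) in
/-- Legs are attached to closed graphs. -/
def toB : D K →ₐ[K] B K :=
  Ideal.Quotient.liftₐ (DTilde.relIdeal K)
    (AlgHom.ofLinearMap (tildeToB K) tildeToB_one tildeToB_mul) fun _ hz => tildeToB_relIdeal hz

theorem toB_cls (G : TriGraph) (x : SH1 K G.1) : toB K (D.cls K G x) = legsHom K G.toUT x :=
  tildeToB_proj G x

theorem toB_edgeMonomial (G : TriGraph) (L : List G.1.E) :
    toB K (D.cls K G (edgeMonomial K G.1 L)) = legs K G.toUT L := by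
  rw [toB_cls]
  exact legsHom_edgeMonomial G.toUT L

end LegsHom

end Jacobi
end

noncomputable section

namespace Jacobi

open scoped Classical

/-! ### Removing a leg -/

section Remove

variable {G : OGraph}

/-- The dart `rev t` is the stem of a leg at a 3-valent vertex. -/
structure OGraph.IsLeg (G : OGraph) (t : G.E) : Prop where
  tip : G.IsTip t
  ne : G.σ (G.rev t) ≠ G.rev t
  cube : G.σ (G.σ (G.σ (G.rev t))) = G.rev t

namespace OGraph.IsLeg

variable {t : G.E}

theorem tip_ne (h : G.IsLeg t) (k : G.E) (hk : G.σ k ≠ k) : k ≠ t := fun hh => hk (hh ▸ h.tip.2)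

theorem ne₁ (h : G.IsLeg t) : G.σ (G.σ (G.rev t)) ≠ G.σ (G.rev t) := fun hh => h.ne (G.σ.injective hh)

theorem ne₂ (h : G.IsLeg t) : G.σ (G.σ (G.rev t)) ≠ G.rev t := fun hh => by
  have := h.cube
  rw [hh] at this
  exact h.ne this

theorem tip_ne₁ (h : G.IsLeg t) : G.σ (G.rev t) ≠ t := h.tip_ne _ h.ne₁

theorem tip_ne₂ (h : G.IsLeg t) : G.σ (G.σ (G.rev t)) ≠ t := h.tip_ne _ fun hh => by
  rw [h.cube] at hh
  exact h.ne₂ hh.symm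

theorem rev_ne_tip₁ (h : G.IsLeg t) : G.rev (G.σ (G.rev t)) ≠ t := fun hh => h.ne (rev_eq_iff.1 hh)

theorem rev_ne_tip₂ (h : G.IsLeg t) : G.rev (G.σ (G.σ (G.rev t))) ≠ t := fun hh => h.ne₂ (rev_eq_iff.1 hh)

theorem rev_ne_stem₁ (h : G.IsLeg t) : G.rev (G.σ (G.rev t)) ≠ G.rev t := fun hh =>
  h.tip_ne₁ (G.rev_injective hh)

theorem rev_ne_stem₂ (h : G.IsLeg t) : G.rev (G.σ (G.σ (G.rev t))) ≠ G.rev t := fun hh =>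
  h.tip_ne₂ (G.rev_injective hh)

theorem not_free (h : G.IsLeg t) : ¬ G.free (G.rev t) := by rw [free_rev_iff]; exact h.tip.1

theorem not_free₁ (h : G.IsLeg t) : ¬ G.free (G.σ (G.rev t)) := not_free_σ h.not_free

theorem not_free₂ (h : G.IsLeg t) : ¬ G.free (G.σ (G.σ (G.rev t))) := not_free_σ h.not_free₁

end OGraph.IsLeg

/-- A leg at a 3-valent vertex is removed, and the two other edges at this vertex are joined. -/
abbrev OGraph.removeEdge (G : OGraph) (t : G.E) (h : G.IsLeg t)
    (hr : G.rev (G.σ (G.rev t)) ≠ G.σ (G.σ (G.rev t))) : OGraph where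
  E := {k : G.E // k ≠ t ∧ k ≠ G.rev t ∧ k ≠ G.σ (G.rev t) ∧ k ≠ G.σ (G.σ (G.rev t))}
  finite := inferInstance
  σ := G.σ.subtypePerm fun k => by
    have e1 : G.σ k = t ↔ k = t := by
      rw [← G.σ.injective.eq_iff (a := k) (b := t), h.tip.2]
    have e2 : G.σ k = G.rev t ↔ k = G.σ (G.σ (G.rev t)) := by
      rw [← G.σ.injective.eq_iff (a := k) (b := G.σ (G.σ (G.rev t))), h.cube]
    have e3 : G.σ k = G.σ (G.rev t) ↔ k = G.rev t := G.σ.injective.eq_iff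
    have e4 : G.σ k = G.σ (G.σ (G.rev t)) ↔ k = G.σ (G.rev t) := G.σ.injective.eq_iff
    simp only [ne_eq, e1, e2, e3, e4]
    tauto
  rev k :=
    -- The outer darts of the two edges that are joined become reverses of each other. If these two
    -- edges are the same loop, no outer dart remains, which is what `hr` excludes.
    if h1 : k.1 = G.rev (G.σ (G.rev t)) then
      ⟨G.rev (G.σ (G.σ (G.rev t))), h.rev_ne_tip₂, h.rev_ne_stem₂,
        fun hh => hr (rev_eq_iff.1 hh).symm, G.rev_ne _⟩
    else if h2 : k.1 = G.rev (G.σ (G.σ (G.rev t))) then ⟨G.rev (G.σ (G.rev t)), h.rev_ne_tip₁,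
      h.rev_ne_stem₁, G.rev_ne _, hr⟩
    else ⟨G.rev k, fun hh => k.2.2.1 (rev_eq_iff.1 hh), fun hh => k.2.1 (G.rev_injective hh),
      fun hh => h1 (rev_eq_iff.1 hh), fun hh => h2 (rev_eq_iff.1 hh)⟩
  rev_rev k := by
    apply Subtype.ext
    have hn : G.rev (G.σ (G.σ (G.rev t))) ≠ G.rev (G.σ (G.rev t)) := fun hh =>
      h.ne₁ (G.rev_injective hh)
    by_cases h1 : k.1 = G.rev (G.σ (G.rev t))
    · simp [h1, hn]
    by_cases h2 : k.1 = G.rev (G.σ (G.σ (G.rev t)))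
    · simp [h2, hn]
    have h3 : G.rev k.1 ≠ G.rev (G.σ (G.rev t)) := fun hh => k.2.2.2.1 (G.rev_injective hh)
    have h4 : G.rev k.1 ≠ G.rev (G.σ (G.σ (G.rev t))) := fun hh => k.2.2.2.2 (G.rev_injective hh)
    simp [h1, h2, h3, h4, G.rev_rev]
  rev_ne k := by
    have hn : G.rev (G.σ (G.σ (G.rev t))) ≠ G.rev (G.σ (G.rev t)) := fun hh =>
      h.ne₁ (G.rev_injective hh)
    intro hk
    have hk' := congrArg Subtype.val hk
    split_ifs at hk' with h1 h2
    · exact hn (hk'.trans h1)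
    · exact hn (h2.symm.trans hk'.symm)
    · exact G.rev_ne _ hk'
  free k := G.free k.1
  free_rev k hk := by
    have h1 : k.1 ≠ G.rev (G.σ (G.rev t)) := fun hh =>
      h.not_free₁ (by rw [← free_rev_iff, ← hh]; exact hk)
    have h2 : k.1 ≠ G.rev (G.σ (G.σ (G.rev t))) := fun hh =>
      h.not_free₂ (by rw [← free_rev_iff, ← hh]; exact hk)
    simpa [h1, h2] using G.free_rev _ hk
  σ_free k hk := Subtype.ext (G.σ_free k.1 hk)

/-- The leg is restored at the dart that arrives from the backward side, `rev (σ (rev t))`. It runs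
in the direction of the forward dart `σ (σ (rev t))`, so the leg comes to lie on its left. -/
def Iso.removeEdge (t : G.E) (h : G.IsLeg t)
    (hr : G.rev (G.σ (G.rev t)) ≠ G.σ (G.σ (G.rev t)))
    (he : ¬ (G.removeEdge t h hr).free
      ⟨G.rev (G.σ (G.rev t)), h.rev_ne_tip₁, h.rev_ne_stem₁, G.rev_ne _, hr⟩) :
    Iso ((G.removeEdge t h hr).attachEdge
      ⟨G.rev (G.σ (G.rev t)), h.rev_ne_tip₁, h.rev_ne_stem₁, G.rev_ne _, hr⟩ he) G where
  toEquiv := Equiv.ofBijective (Sum.elim Subtype.val (fun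
      | .back => G.σ (G.rev t) | .fwd => G.σ (G.σ (G.rev t)) | .stem => G.rev t | .tip => t)) <| by
    have d1 := h.ne
    have d2 := h.ne₁
    have d3 := h.ne₂
    have d4 := h.tip_ne₁
    have d5 := h.tip_ne₂
    have d6 := G.rev_ne t
    constructor
    · rintro (⟨a, a1, a2, a3, a4⟩ | a | a | a | a) (⟨b, b1, b2, b3, b4⟩ | b | b | b | b) hab <;>
        simp only [Sum.elim_inl, Sum.elim_inr] at hab <;>
        first
          | rfl
          | exact congrArg Sum.inl (Subtype.ext hab)
          | exact absurd hab ‹_›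
          | exact absurd hab.symm ‹_›
    · intro k
      by_cases k1 : k = t
      · exact ⟨.inr .tip, k1.symm⟩
      by_cases k2 : k = G.rev t
      · exact ⟨.inr .stem, k2.symm⟩
      by_cases k3 : k = G.σ (G.rev t)
      · exact ⟨.inr .back, k3.symm⟩
      by_cases k4 : k = G.σ (G.σ (G.rev t))
      · exact ⟨.inr .fwd, k4.symm⟩
      exact ⟨.inl ⟨k, k1, k2, k3, k4⟩, rfl⟩
  map_σ := by
    obtain ⟨s1, s2, s3, s4⟩ := (G.removeEdge t h hr).edgeσ_inr
    rintro (k | k | k | k | k)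
    · rfl
    · exact congrArg _ s3
    · exact (congrArg _ s1).trans h.cube.symm
    · exact congrArg _ s2
    · exact (congrArg _ s4).trans h.tip.2.symm
  map_rev := by
    have re : ((G.removeEdge t h hr).rev
        ⟨G.rev (G.σ (G.rev t)), h.rev_ne_tip₁, h.rev_ne_stem₁, G.rev_ne _, hr⟩).1
        = G.rev (G.σ (G.σ (G.rev t))) := by simp
    rintro (k | k | k | k | k)
    · by_cases k1 : k.1 = G.rev (G.σ (G.rev t))
      · obtain rfl : k = ⟨G.rev (G.σ (G.rev t)), h.rev_ne_tip₁, h.rev_ne_stem₁, G.rev_ne _, hr⟩ :=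
          Subtype.ext k1
        refine (congrArg (Equiv.ofBijective _ _)
          (OGraph.edgeRev_self (G := G.removeEdge t h hr) _)).trans ?_
        exact (G.rev_rev _).symm
      by_cases k2 : k.1 = G.rev (G.σ (G.σ (G.rev t)))
      · obtain rfl : k = (G.removeEdge t h hr).rev
            ⟨G.rev (G.σ (G.rev t)), h.rev_ne_tip₁, h.rev_ne_stem₁, G.rev_ne _, hr⟩ :=
          Subtype.ext (k2.trans re.symm)
        exact (congrArg (Equiv.ofBijective _ _)
          (OGraph.edgeRev_rev (G := G.removeEdge t h hr) _)).trans
          ((G.rev_rev _).symm.trans (congrArg G.rev re.symm))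
      refine (congrArg (Equiv.ofBijective _ _)
        (OGraph.edgeRev_of_ne (G := G.removeEdge t h hr) (fun hh => k1 (congrArg Subtype.val hh))
        fun hh => k2 ((congrArg Subtype.val hh).trans re))).trans ?_
      change ((G.removeEdge t h hr).rev k).1 = G.rev k.1
      simp [k1, k2]
    · rfl
    · exact re
    · exact (G.rev_rev t).symm
    · rfl
  map_free := by
    rintro (k | k | k | k | k)
    · exact Iff.rfl
    · exact iff_of_false h.not_free₁ id
    · exact iff_of_false h.not_free₂ id
    · exact iff_of_false h.not_free id
    · exact iff_of_false h.tip.1 id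

/-- A leg at a 3-valent vertex on a loop is removed, and the loop becomes a circle. -/
abbrev OGraph.removeCircle (G : OGraph) (t : G.E) (h : G.IsLeg t)
    (hr : G.rev (G.σ (G.rev t)) = G.σ (G.σ (G.rev t))) : OGraph where
  E := {k : G.E // k ≠ t ∧ k ≠ G.rev t}
  finite := inferInstance
  -- The two darts of the loop become the orientations of a circle, so `σ` has to fix them.
  σ := Equiv.ofBijective (fun k => if hk : k.1 = G.σ (G.rev t) ∨ k.1 = G.σ (G.σ (G.rev t)) then k
      else ⟨G.σ k, fun hh => k.2.1 (G.σ.injective (hh.trans h.tip.2.symm)),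
        fun hh => hk (.inr (G.σ.injective (hh.trans h.cube.symm)))⟩) <| by
    refine Finite.injective_iff_bijective.1 fun a b hab => Subtype.ext ?_
    have hab' := congrArg Subtype.val hab
    have key : ∀ k : {k : G.E // k ≠ t ∧ k ≠ G.rev t},
        ¬ (k.1 = G.σ (G.rev t) ∨ k.1 = G.σ (G.σ (G.rev t))) →
        G.σ k ≠ G.σ (G.rev t) ∧ G.σ k ≠ G.σ (G.σ (G.rev t)) := fun k hk =>
      ⟨fun hh => k.2.2 (G.σ.injective hh), fun hh => hk (.inl (G.σ.injective hh))⟩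
    beta_reduce at hab'
    split_ifs at hab' with h1 h2 h2
    · exact hab'
    · have hab'' : a.1 = G.σ b.1 := hab'
      have := key b h2
      rw [← hab''] at this
      tauto
    · have hab'' : G.σ a.1 = b.1 := hab'
      have := key a h1
      rw [hab''] at this
      tauto
    · exact G.σ.injective hab'
  rev k := ⟨G.rev k, fun hh => k.2.2 (rev_eq_iff.1 hh),
      fun hh => k.2.1 (G.rev_injective hh)⟩
  rev_rev k := Subtype.ext (G.rev_rev k.1)
  rev_ne k hk := G.rev_ne k.1 (congrArg Subtype.val hk)
  free k := G.free k.1 ∨ k.1 = G.σ (G.rev t) ∨ k.1 = G.σ (G.σ (G.rev t))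
  free_rev k hk := by
    rcases hk with hk | hk | hk
    · exact .inl (G.free_rev _ hk)
    · exact .inr (.inr (by rw [← hr]; exact congrArg G.rev hk))
    · exact .inr (.inl (by
        change G.rev k.1 = _
        rw [hk, ← hr, G.rev_rev]))
  σ_free k hk := by
    by_cases h1 : k.1 = G.σ (G.rev t) ∨ k.1 = G.σ (G.σ (G.rev t))
    · simp [h1]
    · have h2 := hk.resolve_right h1
      simp only [Equiv.ofBijective_apply, dif_neg h1]
      exact Subtype.ext (G.σ_free _ h2)

def Iso.removeCircle (t : G.E) (h : G.IsLeg t)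
    (hr : G.rev (G.σ (G.rev t)) = G.σ (G.σ (G.rev t)))
    (he : (G.removeCircle t h hr).free ⟨G.σ (G.σ (G.rev t)), h.tip_ne₂, h.ne₂⟩) :
    Iso ((G.removeCircle t h hr).attachCircle ⟨G.σ (G.σ (G.rev t)), h.tip_ne₂, h.ne₂⟩ he) G where
  toEquiv := Equiv.ofBijective (Sum.elim Subtype.val (fun b => bif b then t else G.rev t)) <| by
    have d6 := G.rev_ne t
    constructor
    · rintro (⟨a, a1, a2⟩ | a | a) (⟨b, b1, b2⟩ | b | b) hab <;>
        simp only [Sum.elim_inl, Sum.elim_inr, cond_true, cond_false] at hab <;>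
        first
          | rfl
          | exact congrArg Sum.inl (Subtype.ext hab)
          | exact absurd hab ‹_›
          | exact absurd hab.symm ‹_›
    · intro k
      by_cases k1 : k = t
      · exact ⟨.inr true, k1.symm⟩
      by_cases k2 : k = G.rev t
      · exact ⟨.inr false, k2.symm⟩
      exact ⟨.inl ⟨k, k1, k2⟩, rfl⟩
  map_rev := by
    rintro (k | k | k)
    · rfl
    · exact (G.rev_rev t).symm
    · rfl
  map_free := by
    have hr' : G.rev (G.σ (G.σ (G.rev t))) = G.σ (G.rev t) := by rw [← hr, G.rev_rev]
    rintro (k | k | k)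
    · change G.free k.1 ↔ (G.free k.1 ∨ k.1 = G.σ (G.rev t) ∨ k.1 = G.σ (G.σ (G.rev t))) ∧ _ ∧ _
      simp only [ne_eq, ← Subtype.val_inj, hr']
      constructor
      · intro hf
        exact ⟨.inl hf, fun hh => h.not_free₂ (hh ▸ hf), fun hh => h.not_free₁ (hh ▸ hf)⟩
      · tauto
    · exact iff_of_false h.not_free id
    · exact iff_of_false h.tip.1 id
  map_σ := by
    have hr' : G.rev (G.σ (G.σ (G.rev t))) = G.σ (G.rev t) := by rw [← hr, G.rev_rev]
    obtain ⟨s1, s2, s3, s4, s5⟩ := (G.removeCircle t h hr).circleσ_apply _ he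
    have er : (G.removeCircle t h hr).rev ⟨G.σ (G.σ (G.rev t)), h.tip_ne₂, h.ne₂⟩ =
      ⟨G.σ (G.rev t), h.tip_ne₁, h.ne⟩ := Subtype.ext hr'
    rw [er] at s2 s3 s5
    rintro (k | k | k)
    · by_cases k1 : k = ⟨G.σ (G.σ (G.rev t)), h.tip_ne₂, h.ne₂⟩
      · subst k1
        exact (congrArg _ s1).trans h.cube.symm
      by_cases k2 : k = ⟨G.σ (G.rev t), h.tip_ne₁, h.ne⟩
      · subst k2
        exact (congrArg _ s3)
      refine (congrArg _ (s5 k k1 k2)).trans ?_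
      have : ¬ (k.1 = G.σ (G.rev t) ∨ k.1 = G.σ (G.σ (G.rev t))) := by
        rintro (hh | hh)
        · exact k2 (Subtype.ext hh)
        · exact k1 (Subtype.ext hh)
      change ((G.removeCircle t h hr).σ k).1 = G.σ k.1
      simp [this]
    · exact congrArg _ s2
    · exact (congrArg _ s4).trans h.tip.2.symm

/-- A graph with a leg at a 3-valent vertex is obtained by attaching a leg. -/
theorem OGraph.IsLeg.exists_attach {t : G.E} (h : G.IsLeg t) :
    ∃ H : OGraph, (∃ e he, Nonempty (Iso (H.attachEdge e he) G)) ∨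
      ∃ e he, Nonempty (Iso (H.attachCircle e he) G) := by
  by_cases hr : G.rev (G.σ (G.rev t)) = G.σ (G.σ (G.rev t))
  · exact ⟨G.removeCircle t h hr, .inr ⟨_, .inr (.inr rfl), ⟨Iso.removeCircle t h hr _⟩⟩⟩
  · exact ⟨G.removeEdge t h hr, .inl ⟨_, fun hf => h.not_free₁ (free_rev_iff.1 hf),
      ⟨Iso.removeEdge t h hr _⟩⟩⟩

theorem OGraph.IsUniTri.isLeg (hG : G.IsUniTri) {t : G.E} (ht : G.IsTip t) : G.IsLeg t :=
  ⟨ht, fun h => hG.2 t ht.1 ⟨ht.2, h⟩, hG.1 _⟩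

theorem OGraph.IsUniTri.map_iso {H : OGraph} (hG : G.IsUniTri) (f : Iso H G) : H.IsUniTri := by
  refine ⟨fun e => f.toEquiv.injective ?_, fun e he h => hG.2 (f.toEquiv e) ?_ ⟨?_, ?_⟩⟩
  · rw [f.map_σ, f.map_σ, f.map_σ, hG.1]
  · rwa [f.map_free]
  · rw [← f.map_σ, h.1]
  · rw [← f.map_rev, ← f.map_σ, h.2]

/-- Removing a leg could leave an edge with two 1-valent ends, but only if the graph had a component
with three legs at one vertex, which contains a fork. -/
theorem OGraph.IsUniTri.of_attachEdge {e : G.E} {he : ¬ G.free e}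
    (h : (G.attachEdge e he).IsUniTri) (hf : ¬ (G.attachEdge e he).HasFork) : G.IsUniTri := by
  refine ⟨fun k => Sum.inl_injective (h.1 (.inl k)), fun k hk hs => h.2 (.inl k) hk ⟨?_, ?_⟩⟩
  · exact congrArg Sum.inl hs.1
  · have hl : ¬ (G.IsTip e ∨ G.IsTip (G.rev e)) := fun hl => hf (hasFork_attachEdge_of_leg he hl)
    have h1 : k ≠ e := fun hh => hl (.inl ⟨he, hh ▸ hs.1⟩)
    have h2 : k ≠ G.rev e := fun hh => hl (.inr ⟨free_rev_iff.not.2 he, hh ▸ hs.1⟩)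
    change G.edgeσ (G.edgeRev e (.inl k)) = G.edgeRev e (.inl k)
    rw [edgeRev_of_ne h1 h2, edgeσ_inl, hs.2]

theorem OGraph.IsUniTri.of_attachCircle {e : G.E} {he : G.free e}
    (h : (G.attachCircle e he).IsUniTri) : G.IsUniTri := by
  have c : ∀ k, ¬ G.free k → (G.attachCircle e he).σ (.inl k) = .inl (G.σ k) :=
    fun k hk => circleσ_of_not_free he hk
  refine ⟨fun k => ?_, fun k hk hs => ?_⟩
  · by_cases hk : G.free k
    · rw [G.σ_free k hk, G.σ_free k hk, G.σ_free k hk]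
    · have := h.1 (.inl k)
      rw [c k hk, c _ (not_free_σ hk), c _ (not_free_σ (not_free_σ hk))] at this
      exact Sum.inl_injective this
  · refine h.2 (.inl k) (fun hf => hk hf.1) ⟨?_, ?_⟩
    · rw [c k hk, hs.1]
    · exact (c _ (free_rev_iff.not.2 hk)).trans (congrArg Sum.inl hs.2)

end Remove

end Jacobi
end

noncomputable section

namespace Jacobi

open scoped Classical

/-! ### Degrees -/

section Degrees

theorem ncard_sum {A B : Type} [Finite A] [Finite B] (P : A ⊕ B → Prop) :
    Set.ncard {z | P z} = Set.ncard {a | P (.inl a)} + Set.ncard {b | P (.inr b)} := by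
  change Nat.card {z // P z} = Nat.card {a // P (.inl a)} + Nat.card {b // P (.inr b)}
  rw [← Nat.card_sum]
  exact Nat.card_congr Equiv.subtypeSum

namespace OGraph

variable {G H : OGraph}

theorem numLegs_congr (f : Iso G H) : G.numLegs = H.numLegs :=
  Nat.card_congr (f.toEquiv.subtypeEquiv fun _ => (IsTip.map_iso f).symm)

theorem numEdges_congr (f : Iso G H) : G.numEdges = H.numEdges :=
  congrArg (· / 2) (Nat.card_congr (f.toEquiv.subtypeEquiv fun e => (f.map_free e).symm.not))

theorem numTri_congr (f : Iso G H) : G.numTri = H.numTri :=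
  congrArg (· / 3) (Nat.card_congr (f.toEquiv.subtypeEquiv fun e => by
    rw [f.map_free, ← f.map_σ, ne_eq, ne_eq, f.toEquiv.injective.eq_iff]))

theorem deg₂_congr (f : Iso G H) : G.deg₂ = H.deg₂ := by
  rw [deg₂, deg₂, numEdges_congr f, numTri_congr f]

theorem chi_eq (G : OGraph) : G.chi = G.deg₂ - G.numLegs := by
  rw [chi, deg₂]
  ring

theorem IsTri.numLegs (h : G.IsTri) : G.numLegs = 0 := by
  have : IsEmpty {e : G.E // ¬ G.free e ∧ G.σ e = e} := ⟨fun e => h.2 e.1 e.2.1 e.2.2⟩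
  exact Nat.card_of_isEmpty

theorem numLegs_attachEdge (e : G.E) (he : ¬ G.free e) :
    (G.attachEdge e he).numLegs = G.numLegs + 1 := by
  refine (ncard_sum (A := G.E) (B := LegDart) (G.attachEdge e he).IsTip).trans ?_
  simp only [isTip_attachEdge_inl, isTip_attachEdge_inr, Set.ofPred_eq_eq_singleton,
    Set.ncard_singleton]
  rfl

/-- Four new darts make two new edges, and three of them form one new 3-valent vertex. -/
theorem deg₂_attachEdge (e : G.E) (he : ¬ G.free e) :
    (G.attachEdge e he).deg₂ = G.deg₂ + 1 := by
  obtain ⟨s1, s2, s3, s4⟩ := G.edgeσ_inr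
  have h4 : Set.ncard {b : LegDart | ¬ False} = 4 := by
    have : {b : LegDart | ¬ False} = {.back, .fwd, .stem, .tip} := by
      ext b
      cases b <;> simp
    rw [this, Set.ncard_eq_toFinset_card']
    simp
  have h3 : Set.ncard {b : LegDart | ¬ False ∧ G.edgeσ (.inr b) ≠ .inr b} = 3 := by
    have : {b : LegDart | ¬ False ∧ G.edgeσ (.inr b) ≠ .inr b} = {.back, .fwd, .stem} := by
      ext b
      cases b <;> simp [*]
    rw [this, Set.ncard_eq_toFinset_card']
    simp
  have e1 : Nat.card {z : (G.attachEdge e he).E // ¬ (G.attachEdge e he).free z} =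
      Nat.card {z : G.E // ¬ G.free z} + 4 := by
    refine (ncard_sum (A := G.E) (B := LegDart) fun z => ¬ (G.attachEdge e he).free z).trans ?_
    rw [← h4]
    rfl
  have e2 : Nat.card {z : (G.attachEdge e he).E // ¬ (G.attachEdge e he).free z ∧
      (G.attachEdge e he).σ z ≠ z} = Nat.card {z : G.E // ¬ G.free z ∧ G.σ z ≠ z} + 3 := by
    refine (ncard_sum (A := G.E) (B := LegDart) fun z => ¬ (G.attachEdge e he).free z ∧
      (G.attachEdge e he).σ z ≠ z).trans ?_
    rw [← h3]
    refine congrArg₂ (· + ·) (congrArg Set.ncard (Set.ext fun z => and_congr Iff.rfl ?_)) rfl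
    exact not_congr Sum.inl_injective.eq_iff
  rw [deg₂, deg₂, numEdges, numEdges, numTri, numTri, e1, e2]
  omega

theorem numLegs_attachCircle (e : G.E) (he : G.free e) :
    (G.attachCircle e he).numLegs = G.numLegs + 1 := by
  refine (ncard_sum (A := G.E) (B := Bool) (G.attachCircle e he).IsTip).trans ?_
  simp only [isTip_attachCircle_inl, isTip_attachCircle_inr, Set.ofPred_eq_eq_singleton,
    Set.ncard_singleton]
  rfl

/-- The circle, which was not counted, becomes an edge, and the leg is another one; both are offset
by one new vertex. -/
theorem deg₂_attachCircle (e : G.E) (he : G.free e) :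
    (G.attachCircle e he).deg₂ = G.deg₂ + 1 := by
  obtain ⟨s1, s2, s3, s4, s5⟩ := G.circleσ_apply e he
  have he' := G.free_rev e he
  have hn := G.rev_ne e
  have hp : Set.ncard {e, G.rev e} = 2 := Set.ncard_pair hn.symm
  have h4 : Set.ncard {b : Bool | ¬ False} = 2 := by
    rw [Set.ncard_eq_toFinset_card']
    simp
  have h3 : Set.ncard {b : Bool | ¬ False ∧ G.circleσ e (.inr b) ≠ .inr b} = 1 := by
    have : {b : Bool | ¬ False ∧ G.circleσ e (.inr b) ≠ .inr b} = {false} := by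
      ext b
      cases b <;> simp [*]
    rw [this, Set.ncard_singleton]
  have e1 : Nat.card {z : (G.attachCircle e he).E // ¬ (G.attachCircle e he).free z} =
      Nat.card {z : G.E // ¬ G.free z} + 4 := by
    refine (ncard_sum (A := G.E) (B := Bool) fun z => ¬ (G.attachCircle e he).free z).trans ?_
    have : {z : G.E | ¬ (G.free z ∧ z ≠ e ∧ z ≠ G.rev e)} = {z | ¬ G.free z} ∪ {e, G.rev e} := by
      ext z
      simp only [Set.mem_ofPred_eq, Set.mem_union, Set.mem_insert_iff, Set.mem_singleton_iff]
      tauto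
    refine (congrArg₂ (· + ·) (congrArg Set.ncard this) h4).trans ?_
    rw [Set.ncard_union_eq, hp]
    · rfl
    · rw [Set.disjoint_right]
      rintro z (rfl | rfl) hz
      · exact hz he
      · exact hz he'
  have e2 : Nat.card {z : (G.attachCircle e he).E // ¬ (G.attachCircle e he).free z ∧
      (G.attachCircle e he).σ z ≠ z} = Nat.card {z : G.E // ¬ G.free z ∧ G.σ z ≠ z} + 3 := by
    refine (ncard_sum (A := G.E) (B := Bool) fun z => ¬ (G.attachCircle e he).free z ∧
      (G.attachCircle e he).σ z ≠ z).trans ?_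
    have : {z : G.E | ¬ (G.free z ∧ z ≠ e ∧ z ≠ G.rev e) ∧ G.circleσ e (.inl z) ≠ .inl z} =
        {z | ¬ G.free z ∧ G.σ z ≠ z} ∪ {e, G.rev e} := by
      ext z
      by_cases h1 : z = e
      · simp [h1, s1]
      by_cases h2 : z = G.rev e
      · simp [h2, s3, hn.symm]
      simp [h1, h2, s5 z h1 h2]
    refine (congrArg₂ (· + ·) (congrArg Set.ncard this) h3).trans ?_
    rw [Set.ncard_union_eq, hp]
    · rfl
    · rw [Set.disjoint_right]
      rintro z (rfl | rfl) hz
      · exact hz.1 he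
      · exact hz.1 he'
  rw [deg₂, deg₂, numEdges, numEdges, numTri, numTri, e1, e2]
  omega

end OGraph

/-! ### Bidegrees and surjectivity of the homomorphism from $\mathcal D$ to $\mathcal B$. -/

variable {K : Type*} [Field K]

theorem legs_mem_deg {Γ : UTGraph} (L : List Γ.1.E) {m n : ℕ} (hm : Γ.1.numLegs + L.length = m)
    (hn : Γ.1.deg₂ + L.length = n) : legs K Γ L ∈ B.deg K m n := by
  induction hl : L.length generalizing Γ with
  | zero =>
    rw [List.length_eq_zero_iff] at hl
    subst hl
    rw [legs_nil]
    exact Submodule.subset_span ⟨Γ, by simpa using hm, by simpa using hn, rfl⟩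
  | succ k ih =>
    obtain _ | ⟨e, L⟩ := L
    · simp at hl
    rw [List.length_cons] at hm hn hl
    by_cases he : Γ.1.free e
    · rw [legs_circle he]
      refine ih (Γ := Γ.attachCircle e he) _ ?_ ?_ ?_
      · rw [OGraph.numLegs_attachCircle e he, List.length_map]
        omega
      · rw [OGraph.deg₂_attachCircle e he, List.length_map]
        push_cast at hn
        linarith
      · rw [List.length_map]
        omega
    · rw [legs_edge he]
      refine ih (Γ := Γ.attachEdge e he) _ ?_ ?_ ?_
      · rw [OGraph.numLegs_attachEdge e he, List.length_map]
        omega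
      · rw [OGraph.deg₂_attachEdge e he, List.length_map]
        push_cast at hn
        linarith
      · rw [List.length_map]
        omega

theorem isoS_edgeMonomial {G H : OGraph} (f : Iso G H) (s : Multiset G.E) :
    isoS K f (edgeMonomial K G s) = edgeMonomial K H (s.map f.toEquiv) := by
  refine Collapse.S_edgeMonomial K _ f.toEquiv (fun e => (f.map_rev e).symm) (fun e h => ?_) s
  change some (f.toEquiv.symm h) = some e ↔ _
  rw [Option.some_inj, Equiv.symm_apply_eq]

variable [CharZero K]

theorem edgeMonomial_mem_deg {G : OGraph} (s : Multiset G.E) :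
    edgeMonomial K G s ∈ SH1.deg K G s.card := by
  rw [deg_eq_span]
  exact Submodule.subset_span ⟨s, rfl, rfl⟩

/-- Isomorphisms permute the edge monomials of a given degree, so the average of such a monomial has
the same degree. -/
theorem D.cls_edgeMonomial_mem_deg (G : TriGraph) (s : Multiset G.1.E) :
    D.cls K G (edgeMonomial K G.1 s) ∈ D.deg K s.card G.1.chi := by
  have f := TriClass.repIso G
  refine Submodule.subset_span ⟨_, _, ?_, ?_, congrArg (Ideal.Quotient.mk _) (DTilde.proj_eq K f _)⟩
  · rw [OGraph.chi_eq, OGraph.chi_eq, OGraph.deg₂_congr f, OGraph.numLegs_congr f]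
  · rw [coe_projS, avg_apply]
    refine Submodule.smul_mem _ _ (Submodule.sum_mem _ fun g _ => ?_)
    rw [isoS_edgeMonomial, isoS_edgeMonomial]
    simpa using edgeMonomial_mem_deg (K := K) ((s.map f.toEquiv).map g.toEquiv)

/-- The list may use darts created by the leg at `e`. A leg on that leg gives zero. The darts `back`
and `fwd` are the reverses of `e` and of the old `rev e`, so moving the leg to the other side leads
back to an old dart, up to sign. Thus everything is expressed by legs on `Γ` itself, one of them at
`e`. -/
theorem legs_attachEdge_mem {Γ : UTGraph} {e : Γ.1.E} {he : ¬ Γ.1.free e} {n : ℕ}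
    {S : Submodule K (B K)} (hS : ∀ M : List Γ.1.E, M.length = n → legs K Γ (e :: M) ∈ S)
    (L : List (Γ.attachEdge e he).1.E) (hL : L.length = n) : legs K (Γ.attachEdge e he) L ∈ S := by
  -- The list `M` collects the old darts of entries that have been treated; permuting the legs moves
  -- each one there.
  suffices ∀ (L : List (Γ.attachEdge e he).1.E) (M : List Γ.1.E), M.length + L.length = n →
      legs K (Γ.attachEdge e he) (L ++ M.map .inl) ∈ S by
    simpa using this L [] (by simpa using hL)
  intro L
  induction L with
  | nil =>
    intro M hM
    rw [List.nil_append, ← legs_edge he]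
    exact hS M hM
  | cons h L ih =>
    have hinl : ∀ (k : Γ.1.E) (M : List Γ.1.E), M.length + (h :: L).length = n →
        legs K (Γ.attachEdge e he) (.inl k :: (L ++ M.map .inl)) ∈ S := by
      intro k M hM
      rw [legs_perm (L' := L ++ (k :: M).map .inl) List.perm_middle.symm]
      exact ih _ (by simp at hM ⊢; omega)
    have hneg : ∀ (k : Γ.1.E) (M : List Γ.1.E), M.length + (h :: L).length = n →
        (Γ.attachEdge e he).1.rev h = .inl k →
        legs K (Γ.attachEdge e he) (h :: (L ++ M.map .inl)) ∈ S := by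
      intro k M hM hk
      rw [eq_neg_of_add_eq_zero_left (legs_rev h _), hk]
      exact S.neg_mem (hinl k M hM)
    intro M hM
    rw [List.cons_append]
    rcases h with k | k | k | k | k
    · exact hinl k M hM
    · exact hneg e M hM rfl
    · exact hneg (Γ.1.rev e) M hM rfl
    · rw [legs_of_leg (.inr (OGraph.isTip_attachEdge_inr (he := he).2 rfl))]
      exact S.zero_mem
    · rw [legs_of_leg (.inl (OGraph.isTip_attachEdge_inr (he := he).2 rfl))]
      exact S.zero_mem

theorem legs_attachCircle_mem {Γ : UTGraph} {e : Γ.1.E} {he : Γ.1.free e} {n : ℕ}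
    {S : Submodule K (B K)} (hS : ∀ M : List Γ.1.E, M.length = n → legs K Γ (e :: M) ∈ S)
    (L : List (Γ.attachCircle e he).1.E) (hL : L.length = n) :
    legs K (Γ.attachCircle e he) L ∈ S := by
  suffices ∀ (L : List (Γ.attachCircle e he).1.E) (M : List Γ.1.E), M.length + L.length = n →
      legs K (Γ.attachCircle e he) (L ++ M.map .inl) ∈ S by
    simpa using this L [] (by simpa using hL)
  intro L
  induction L with
  | nil =>
    intro M hM
    rw [List.nil_append, ← legs_circle he]
    exact hS M hM
  | cons h L ih =>
    intro M hM
    rw [List.cons_append]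
    rcases h with k | k | k
    · rw [legs_perm (L' := L ++ (k :: M).map .inl) List.perm_middle.symm]
      exact ih _ (by simp at hM ⊢; omega)
    · rw [legs_of_leg (.inr (OGraph.isTip_attachCircle_inr (he := he).2 rfl))]
      exact S.zero_mem
    · rw [legs_of_leg (.inl (OGraph.isTip_attachCircle_inr (he := he).2 rfl))]
      exact S.zero_mem

/-- Induction on the number of darts. A leg of `Γ` is taken off and becomes one more entry of the
list, which changes neither the total number of legs nor `deg₂` minus the number of legs. A fork
makes the element vanish. When no legs are left, the graph is closed and the element is the image of
a monomial. -/
theorem legs_mem_map_deg {Γ : UTGraph} (L : List Γ.1.E) {m : ℕ} {k : ℤ}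
    (hm : Γ.1.numLegs + L.length = m) (hk : Γ.1.deg₂ - Γ.1.numLegs = k) :
    legs K Γ L ∈ (D.deg K m k).map (toB K).toLinearMap := by
  induction hn : Nat.card Γ.1.E using Nat.strong_induction_on generalizing Γ with
  | _ n ih =>
  by_cases hf : Γ.1.HasFork
  · rw [legs_of_hasFork hf]
    exact Submodule.zero_mem _
  by_cases ht : ∃ t, Γ.1.IsTip t
  · obtain ⟨t, ht⟩ := ht
    obtain ⟨H, ⟨e, he, ⟨f⟩⟩ | ⟨e, he, ⟨f⟩⟩⟩ := (Γ.2.isLeg ht).exists_attach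
    · have hH : H.IsUniTri := (Γ.2.map_iso f).of_attachEdge fun h => hf (h.map_iso f)
      have hc : Nat.card H.E < n := by
        rw [← hn, ← Nat.card_congr f.toEquiv, Nat.card_sum]
        have : Nonempty OGraph.LegDart := ⟨.tip⟩
        exact Nat.lt_add_of_pos_right Nat.card_pos
      rw [legs_iso (Γ' := UTGraph.attachEdge ⟨H, hH⟩ e he) f.symm]
      have l1 := OGraph.numLegs_congr f
      have l2 := OGraph.deg₂_congr f
      rw [OGraph.numLegs_attachEdge] at l1
      rw [OGraph.deg₂_attachEdge] at l2
      refine legs_attachEdge_mem (n := L.length) (fun M hM => ?_) _ (by simp)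
      refine ih _ hc (Γ := ⟨H, hH⟩) _ ?_ ?_ rfl
      · rw [List.length_cons]
        simp only at hM ⊢
        omega
      · simp only
        omega
    · have hH : H.IsUniTri := (Γ.2.map_iso f).of_attachCircle
      have hc : Nat.card H.E < n := by
        rw [← hn, ← Nat.card_congr f.toEquiv, Nat.card_sum]
        exact Nat.lt_add_of_pos_right Nat.card_pos
      rw [legs_iso (Γ' := UTGraph.attachCircle ⟨H, hH⟩ e he) f.symm]
      have l1 := OGraph.numLegs_congr f
      have l2 := OGraph.deg₂_congr f
      rw [OGraph.numLegs_attachCircle] at l1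
      rw [OGraph.deg₂_attachCircle] at l2
      refine legs_attachCircle_mem (n := L.length) (fun M hM => ?_) _ (by simp)
      refine ih _ hc (Γ := ⟨H, hH⟩) _ ?_ ?_ rfl
      · rw [List.length_cons]
        simp only at hM ⊢
        omega
      · simp only
        omega
  · have hT : Γ.1.IsTri := ⟨Γ.2.1, fun e he hs => ht ⟨e, he, hs⟩⟩
    have h0 := hT.numLegs
    refine ⟨D.cls K ⟨Γ.1, hT⟩ (edgeMonomial K Γ.1 L), ?_, toB_edgeMonomial ⟨Γ.1, hT⟩ L⟩
    have := D.cls_edgeMonomial_mem_deg (K := K) ⟨Γ.1, hT⟩ L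
    rw [OGraph.chi_eq, hk, Multiset.coe_card] at this
    rw [h0, zero_add] at hm
    rwa [hm] at this

/-- For a closed graph `chi` equals `deg₂`, and each leg raises both degrees by one. The reverse
inclusion is `legs_mem_map_deg` with the empty list. -/
theorem map_toB_deg (m n : ℕ) :
    (D.deg K m ((n : ℤ) - m)).map (toB K).toLinearMap = B.deg K m n := by
  apply le_antisymm
  · rw [D.deg, Submodule.map_span_le]
    rintro _ ⟨c, x, hc, hx, rfl⟩
    rw [DTilde.incl_eq_proj, AlgHom.toLinearMap_apply]
    change toB K (D.cls K c.rep x.1) ∈ B.deg K m n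
    rw [toB_cls]
    have h0 := c.rep.2.numLegs
    rw [OGraph.chi_eq, h0] at hc
    rw [deg_eq_span] at hx
    have hle : Submodule.span K {y | ∃ s : Multiset c.rep.1.E, s.card = m ∧
        y = edgeMonomial K c.rep.1 s} ≤ (B.deg K m n).comap (legsHom K c.rep.toUT) := by
      rw [Submodule.span_le]
      rintro _ ⟨s, hs, rfl⟩
      induction s using Quotient.inductionOn with
      | h L =>
        have hs : L.length = m := hs
        change legsHom K c.rep.toUT (edgeMonomial K c.rep.toUT.1 L) ∈ B.deg K m n
        rw [legsHom_edgeMonomial]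
        refine legs_mem_deg (Γ := c.rep.toUT) L ?_ ?_
        · rw [h0, hs, zero_add]
        · rw [hs]
          push_cast at hc
          linarith
    exact hle hx
  · rw [B.deg, Submodule.span_le]
    rintro _ ⟨Γ, h1, h2, rfl⟩
    rw [← legs_nil]
    exact legs_mem_map_deg [] (by simpa using h1) (by rw [h1, h2])

theorem toB_surjective : Function.Surjective (toB K) := by
  have hr : LinearMap.range (toB K).toLinearMap = ⊤ := by
    rw [eq_top_iff]
    rintro x -
    obtain ⟨y, rfl⟩ := Ideal.Quotient.mk_surjective x
    induction y using MonoidAlgebra.induction_on with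
    | of c =>
      induction c using Quotient.inductionOn with
      | h Γ =>
        obtain ⟨z, -, hz⟩ := legs_mem_map_deg (K := K) (Γ := Γ) [] rfl rfl
        rw [legs_nil] at hz
        exact ⟨z, hz⟩
    | add a b ha hb =>
      rw [map_add]
      exact Submodule.add_mem _ ha hb
    | smul r a ha =>
      exact Submodule.smul_mem _ r ha
  exact LinearMap.range_eq_top.1 hr

end Degrees

end Jacobi
end

noncomputable section

namespace Jacobi

open scoped Classical

/-! ### The closed graph that carries the legs -/

namespace OGraph

variable (Γ : OGraph)

/-- A dart that starts at a vertex without legs. -/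
def Plain (e : Γ.E) : Prop :=
  ¬ Γ.free e ∧ ∀ t, Γ.IsTip t →
    e ≠ t ∧ e ≠ Γ.rev t ∧ e ≠ Γ.σ (Γ.rev t) ∧ e ≠ Γ.σ (Γ.σ (Γ.rev t))

/-- A function on the darts that does not change when one passes a leg. -/
def Thru {α : Type} (φ : Γ.E → α) : Prop :=
  ∀ t, Γ.IsTip t → φ (Γ.rev (Γ.σ (Γ.rev t))) = φ (Γ.σ (Γ.σ (Γ.rev t))) ∧
    φ (Γ.rev (Γ.σ (Γ.σ (Γ.rev t)))) = φ (Γ.σ (Γ.rev t))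

end OGraph

/-- The graph `G` is obtained from `Γ` by removing all legs; `κ` maps a dart of `Γ` to the dart of
`G` of which it is a piece, and the darts of the legs to `none`. -/
structure CoreOf (Γ G : OGraph) (κ : Γ.E → Option G.E) : Prop where
  isLeg : ∀ t, Γ.IsTip t → Γ.IsLeg t
  none_iff : ∀ e, κ e = none ↔ Γ.IsTip e ∨ Γ.IsTip (Γ.rev e)
  map_rev : ∀ e, κ (Γ.rev e) = (κ e).map G.rev
  surj : ∀ d, ∃ e, κ e = some d
  thru : Γ.Thru κ
  ne_none : ∀ t, Γ.IsTip t → κ (Γ.σ (Γ.rev t)) ≠ none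
  -- This says that the labelled darts over one dart of `G` are connected by passing legs, phrased
  -- as a factorization property. In this form it directly yields the comparison of two cores.
  fiber : ∀ (α : Type) (φ : Γ.E → α), Γ.Thru φ → ∀ e e', κ e ≠ none → κ e = κ e' → φ e = φ e'
  map_σ : ∀ e, Γ.Plain e → κ (Γ.σ e) = (κ e).map G.σ
  -- A dart of the core lies on a circle exactly when no piece of it starts at a vertex without
  -- legs. Otherwise, by the next field, exactly one piece does, and it determines the cyclic order
  -- in the core.
  free_iff : ∀ d, G.free d ↔ ¬ ∃ e, Γ.Plain e ∧ κ e = some d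
  plain_inj : ∀ e e', Γ.Plain e → Γ.Plain e' → κ e = κ e' → e = e'

namespace OGraph

variable {Γ : OGraph}

theorem Plain.σ (hl : ∀ t, Γ.IsTip t → Γ.IsLeg t) {e : Γ.E} (h : Γ.Plain e) : Γ.Plain (Γ.σ e) := by
  refine ⟨not_free_σ h.1, fun t ht => ?_⟩
  obtain ⟨h1, h2, h3, h4⟩ := h.2 t ht
  refine ⟨fun hh => h1 (Γ.σ.injective (hh.trans ht.2.symm)), fun hh => h4 (Γ.σ.injective ?_),
    fun hh => h2 (Γ.σ.injective hh), fun hh => h3 (Γ.σ.injective hh)⟩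
  rw [hh, (hl t ht).cube]

end OGraph

namespace CoreOf

variable {Γ G : OGraph} {κ : Γ.E → Option G.E}

/-- The dart that follows a stem must carry a label, whereas in a fork one of the two stems follows
the other. -/
theorem not_hasFork (h : CoreOf Γ G κ) : ¬ Γ.HasFork := by
  rintro ⟨t, t', h0, h1, h2, h3⟩
  refine h.ne_none t h1 ((h.none_iff _).2 (.inr ?_))
  rwa [h3, Γ.rev_rev]

theorem plain_ne_none (h : CoreOf Γ G κ) {e : Γ.E} (he : Γ.Plain e) : κ e ≠ none := fun hn => by
  rcases (h.none_iff e).1 hn with ht | ht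
  · exact (he.2 e ht).1 rfl
  · exact (he.2 _ ht).2.1 (Γ.rev_rev e).symm

/-- The graph without legs has no legs. -/
theorem no_leg (h : CoreOf Γ G κ) (d : G.E) (hd : ¬ G.free d) : G.σ d ≠ d := fun hs => by
  rw [h.free_iff, not_not] at hd
  obtain ⟨e, he, hd⟩ := hd
  have h1 := h.map_σ e he
  rw [hd, Option.map_some, hs, ← hd] at h1
  have h2 := h.plain_inj _ _ (he.σ h.isLeg) he h1
  exact (he.2 e ⟨he.1, h2⟩).1 rfl

/-- Every dart of the core that is not free has a plain dart over it, and plain darts transport `σ`,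
so the cube relation descends. -/
theorem isTri (h : CoreOf Γ G κ) (hΓ : ∀ e, Γ.σ (Γ.σ (Γ.σ e)) = e) : G.IsTri := by
  refine ⟨fun d => ?_, h.no_leg⟩
  by_cases hd : G.free d
  · rw [G.σ_free d hd, G.σ_free d hd, G.σ_free d hd]
  · rw [h.free_iff, not_not] at hd
    obtain ⟨e, he, hd⟩ := hd
    have h1 := h.map_σ _ ((he.σ h.isLeg).σ h.isLeg)
    rw [h.map_σ _ (he.σ h.isLeg), h.map_σ _ he, hΓ, hd] at h1
    exact (Option.some_injective _ h1).symm

/-- A graph without legs. -/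
theorem of_no_leg (h : ∀ t, ¬ Γ.IsTip t) : CoreOf Γ Γ some where
  isLeg t ht := (h t ht).elim
  none_iff e := by simp [h]
  map_rev e := rfl
  surj d := ⟨d, rfl⟩
  thru t ht := (h t ht).elim
  ne_none t ht := (h t ht).elim
  fiber α φ _ e e' _ he := by rw [Option.some_injective _ he]
  map_σ e _ := rfl
  free_iff d := by
    constructor
    · rintro hd ⟨e, he, hed⟩
      exact he.1 (Option.some_injective _ hed ▸ hd)
    · intro hd
      by_contra hf
      exact hd ⟨d, ⟨hf, fun t ht => (h t ht).elim⟩, rfl⟩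
  plain_inj e e' _ _ he := Option.some_injective _ he

theorem plain_iso {Γ' : OGraph} (f : Iso Γ Γ') {e : Γ.E} (h : Γ.Plain e) :
    Γ'.Plain (f.toEquiv e) := by
  refine ⟨(f.map_free e).not.2 h.1, fun t ht => ?_⟩
  obtain ⟨t, rfl⟩ := f.toEquiv.surjective t
  obtain ⟨h1, h2, h3, h4⟩ := h.2 t ((OGraph.IsTip.map_iso f).1 ht)
  simp only [← f.map_rev, ← f.map_σ, ne_eq, f.toEquiv.injective.eq_iff]
  exact ⟨h1, h2, h3, h4⟩

theorem _root_.Jacobi.OGraph.IsLeg.map_iso {Γ' : OGraph} (f : Iso Γ Γ') {t : Γ.E} (h : Γ.IsLeg t) :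
    Γ'.IsLeg (f.toEquiv t) := by
  refine ⟨(OGraph.IsTip.map_iso f).2 h.tip, ?_, ?_⟩
  · rw [← f.map_rev, ← f.map_σ, f.toEquiv.injective.ne_iff]
    exact h.ne
  · rw [← f.map_rev, ← f.map_σ, ← f.map_σ, ← f.map_σ, h.cube]

theorem map_iso {Γ' : OGraph} (h : CoreOf Γ G κ) (f : Iso Γ Γ') :
    CoreOf Γ' G (κ ∘ f.toEquiv.symm) := by
  have hf : ∀ e, (κ ∘ f.toEquiv.symm) (f.toEquiv e) = κ e := fun e => by simp
  have hp : ∀ e, Γ'.Plain (f.toEquiv e) → Γ.Plain e := fun e he => by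
    have := plain_iso f.symm he
    rwa [show f.symm.toEquiv (f.toEquiv e) = e from f.toEquiv.symm_apply_apply e] at this
  constructor
  · intro t ht
    obtain ⟨t, rfl⟩ := f.toEquiv.surjective t
    exact (h.isLeg t ((OGraph.IsTip.map_iso f).1 ht)).map_iso f
  · intro e
    obtain ⟨e, rfl⟩ := f.toEquiv.surjective e
    rw [hf, h.none_iff, ← f.map_rev, OGraph.IsTip.map_iso, OGraph.IsTip.map_iso]
  · intro e
    obtain ⟨e, rfl⟩ := f.toEquiv.surjective e
    rw [← f.map_rev, hf, hf, h.map_rev]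
  · intro d
    obtain ⟨e, he⟩ := h.surj d
    exact ⟨f.toEquiv e, by rw [hf, he]⟩
  · intro t ht
    obtain ⟨t, rfl⟩ := f.toEquiv.surjective t
    simp only [← f.map_rev, ← f.map_σ, hf]
    exact h.thru t ((OGraph.IsTip.map_iso f).1 ht)
  · intro t ht
    obtain ⟨t, rfl⟩ := f.toEquiv.surjective t
    rw [← f.map_rev, ← f.map_σ, hf]
    exact h.ne_none t ((OGraph.IsTip.map_iso f).1 ht)
  · intro α φ hφ e e'
    obtain ⟨e, rfl⟩ := f.toEquiv.surjective e
    obtain ⟨e', rfl⟩ := f.toEquiv.surjective e'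
    rw [hf, hf]
    refine h.fiber α (φ ∘ f.toEquiv) (fun t ht => ?_) e e'
    simp only [Function.comp_apply, f.map_rev, f.map_σ]
    exact hφ _ ((OGraph.IsTip.map_iso f).2 ht)
  · intro e he
    obtain ⟨e, rfl⟩ := f.toEquiv.surjective e
    rw [← f.map_σ, hf, hf, h.map_σ _ (hp e he)]
  · intro d
    rw [h.free_iff, not_iff_not]
    constructor
    · rintro ⟨e, he, hd⟩
      exact ⟨_, plain_iso f he, by rw [hf, hd]⟩
    · rintro ⟨e, he, hd⟩
      obtain ⟨e, rfl⟩ := f.toEquiv.surjective e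
      exact ⟨e, hp e he, by rw [← hf, hd]⟩
  · intro e e' he he'
    obtain ⟨e, rfl⟩ := f.toEquiv.surjective e
    obtain ⟨e', rfl⟩ := f.toEquiv.surjective e'
    rw [hf, hf]
    exact fun hh => congrArg _ (h.plain_inj e e' (hp e he) (hp e' he') hh)

/-- The second labelling does not change along legs, so it factors through the first one by `fiber`.
-/
theorem exists_map {G' : OGraph} {κ' : Γ.E → Option G'.E} (h : CoreOf Γ G κ)
    (h' : CoreOf Γ G' κ') : ∃ g : G.E → G'.E, ∀ e, κ' e = (κ e).map g := by
  have : ∀ d, ∃ d', ∃ e, κ e = some d ∧ κ' e = some d' := by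
    intro d
    obtain ⟨e, he⟩ := h.surj d
    have : κ' e ≠ none := by
      rw [ne_eq, h'.none_iff, ← h.none_iff, he]
      simp
    obtain ⟨d', hd'⟩ := Option.ne_none_iff_exists'.1 this
    exact ⟨d', e, he, hd'⟩
  choose g e hg1 hg2 using this
  refine ⟨g, fun k => ?_⟩
  rcases hk : κ k with _ | d
  · rwa [Option.map_none, h'.none_iff, ← h.none_iff]
  · rw [Option.map_some, ← hg2]
    exact h.fiber _ κ' h'.thru _ _ (by simp [hk]) (by rw [hk, hg1])

/-- The graph without legs is unique. -/
theorem exists_iso {G' : OGraph} {κ' : Γ.E → Option G'.E} (h : CoreOf Γ G κ)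
    (h' : CoreOf Γ G' κ') : ∃ g : Iso G G', ∀ e, κ' e = (κ e).map g.toEquiv := by
  obtain ⟨g, hg⟩ := h.exists_map h'
  obtain ⟨g', hg'⟩ := h'.exists_map h
  have hs : ∀ {d e}, κ e = some d → κ' e = some (g d) := fun {d e} he => by rw [hg, he]; rfl
  have l1 : Function.LeftInverse g' g := fun d => by
    obtain ⟨e, he⟩ := h.surj d
    have := hg' e
    rw [hs he, he] at this
    exact (Option.some_injective _ this).symm
  have l2 : Function.RightInverse g' g := fun d => by
    obtain ⟨e, he⟩ := h'.surj d
    have := hg e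
    rw [hg' e, he] at this
    exact (Option.some_injective _ this).symm
  have hfree : ∀ d, G'.free (g d) ↔ G.free d := fun d => by
    rw [h.free_iff, h'.free_iff, not_iff_not]
    constructor
    · rintro ⟨e, he, hd⟩
      refine ⟨e, he, ?_⟩
      rw [hg' e, hd, Option.map_some, l1]
    · rintro ⟨e, he, hd⟩
      exact ⟨e, he, hs hd⟩
  refine ⟨⟨⟨g, g', l1, l2⟩, fun d => ?_, fun d => ?_, hfree⟩, hg⟩
  · change g (G.σ d) = G'.σ (g d)
    by_cases hd : G.free d
    · rw [G.σ_free _ hd, G'.σ_free _ ((hfree d).2 hd)]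
    · rw [h.free_iff, not_not] at hd
      obtain ⟨e, he, hd⟩ := hd
      have h1 := h'.map_σ e he
      rw [hs hd, hs (d := G.σ d) (by rw [h.map_σ e he, hd]; rfl)] at h1
      exact Option.some_injective _ h1
  · change g (G.rev d) = G'.rev (g d)
    obtain ⟨e, he⟩ := h.surj d
    have h1 := h'.map_rev e
    rw [hs he, hs (d := G.rev d) (by rw [h.map_rev e, he]; rfl)] at h1
    exact Option.some_injective _ h1

end CoreOf

end Jacobi
end

noncomputable section

namespace Jacobi

open scoped Classical

/-! ### Attaching a leg does not change the core; existence of the core. -/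

namespace CoreOf

open OGraph

variable {Γ G : OGraph} {κ : Γ.E → Option G.E}

/-- The same closed graph after attaching a leg to an edge. -/
theorem attachEdge (h : CoreOf Γ G κ) (e : Γ.E) (he : ¬ Γ.free e) (hd : κ e ≠ none) :
    CoreOf (Γ.attachEdge e he) G (Sum.elim κ (legLabel (κ e) (κ (Γ.rev e)))) := by
  obtain ⟨s1, s2, s3, s4⟩ := Γ.edgeσ_inr
  rw [ne_eq, h.none_iff, not_or] at hd
  have tne : ∀ t, Γ.IsTip t → t ≠ e ∧ t ≠ Γ.rev e := fun t ht =>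
    ⟨fun hh => hd.1 (hh ▸ ht), fun hh => hd.2 (hh ▸ ht)⟩
  have rt : ∀ t, Γ.IsTip t → (Γ.attachEdge e he).rev (.inl t) = .inl (Γ.rev t) := fun t ht =>
    edgeRev_of_ne (tne t ht).1 (tne t ht).2
  have σl : ∀ k, (Γ.attachEdge e he).σ (.inl k) = .inl (Γ.σ k) := fun k => rfl
  set κ' : (Γ.attachEdge e he).E → Option G.E := Sum.elim κ (legLabel (κ e) (κ (Γ.rev e))) with hκ'
  have κl : ∀ k, κ' (.inl k) = κ k := fun k => rfl
  -- The edge of `e` is cut, but the piece reverse to an old dart still carries the label of the old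
  -- reverse. This is what `legLabel` is designed for.
  have κr : ∀ k, κ' ((Γ.attachEdge e he).rev (.inl k)) = κ (Γ.rev k) := fun k => by
    change κ' (Γ.edgeRev e (.inl k)) = _
    by_cases h1 : k = e
    · rw [h1, edgeRev_self]; rfl
    by_cases h2 : k = Γ.rev e
    · rw [h2, edgeRev_rev, Γ.rev_rev]; rfl
    rw [edgeRev_of_ne h1 h2, κl]
  have pr : ∀ b, ¬ (Γ.attachEdge e he).Plain (.inr b) := by
    intro b hb
    obtain ⟨p1, p2, p3, p4⟩ := hb.2 (.inr .tip) (isTip_attachEdge_inr.2 rfl)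
    change _ ≠ Γ.edgeσ (Γ.edgeσ (.inr .stem)) at p4
    change _ ≠ Γ.edgeσ (.inr .stem) at p3
    change _ ≠ Sum.inr LegDart.stem at p2
    rw [s2, s3] at p4
    rw [s2] at p3
    cases b <;> contradiction
  have pl : ∀ k, (Γ.attachEdge e he).Plain (.inl k) ↔ Γ.Plain k := by
    refine fun k => and_congr Iff.rfl ⟨fun hk t ht => ?_, ?_⟩
    · have := hk (.inl t) (isTip_attachEdge_inl.2 ht)
      rw [rt t ht, σl, σl] at this
      simpa only [ne_eq, Sum.inl.injEq] using this
    · rintro hk (t | t) ht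
      · have ht := isTip_attachEdge_inl.1 ht
        rw [rt t ht, σl, σl]
        simpa only [ne_eq, Sum.inl.injEq] using hk t ht
      · obtain rfl := isTip_attachEdge_inr.1 ht
        refine ⟨by simp, ?_, ?_, ?_⟩
        · change _ ≠ Sum.inr LegDart.stem
          simp
        · change _ ≠ Γ.edgeσ (.inr .stem)
          simp [s2]
        · change _ ≠ Γ.edgeσ (Γ.edgeσ (.inr .stem))
          simp [s2, s3]
  constructor
  · rintro (t | t) ht
    · have ht' := isTip_attachEdge_inl.1 ht
      refine ⟨ht, ?_, ?_⟩
      · rw [rt t ht', σl]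
        simpa only [ne_eq, Sum.inl.injEq] using (h.isLeg t ht').ne
      · rw [rt t ht', σl, σl, σl, (h.isLeg t ht').cube]
    · obtain rfl := isTip_attachEdge_inr.1 ht
      refine ⟨ht, ?_, ?_⟩
      · change Γ.edgeσ (.inr .stem) ≠ .inr .stem
        simp [s2]
      · change Γ.edgeσ (Γ.edgeσ (Γ.edgeσ (.inr .stem))) = .inr .stem
        rw [s2, s3, s1]
  · rintro (k | k)
    · rw [κl, h.none_iff, isTip_attachEdge_inl]
      refine or_congr Iff.rfl ?_
      change _ ↔ (Γ.attachEdge e he).IsTip (Γ.edgeRev e (.inl k))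
      by_cases h1 : k = e
      · rw [h1, edgeRev_self, isTip_attachEdge_inr]
        simp [hd.2]
      by_cases h2 : k = Γ.rev e
      · rw [h2, edgeRev_rev, isTip_attachEdge_inr, Γ.rev_rev]
        simp [hd.1]
      rw [edgeRev_of_ne h1 h2, isTip_attachEdge_inl]
    · rcases k with k | k | k | k
      · change κ (Γ.rev e) = none ↔ _ ∨ (Γ.attachEdge e he).IsTip (.inl e)
        rw [h.none_iff, Γ.rev_rev, isTip_attachEdge_inr, isTip_attachEdge_inl]
        simp [hd.1, hd.2]
      · change κ e = none ↔ _ ∨ (Γ.attachEdge e he).IsTip (.inl (Γ.rev e))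
        rw [h.none_iff, isTip_attachEdge_inr, isTip_attachEdge_inl]
        simp [hd.1, hd.2]
      · exact iff_of_true rfl (.inr (isTip_attachEdge_inr (he := he).2 rfl))
      · exact iff_of_true rfl (.inl (isTip_attachEdge_inr.2 rfl))
  · rintro (k | k)
    · rw [κr, h.map_rev, κl]
    · rcases k with k | k | k | k
      · change κ e = (κ (Γ.rev e)).map G.rev
        rw [← h.map_rev, Γ.rev_rev]
      · exact h.map_rev e
      · rfl
      · rfl
  · intro d
    obtain ⟨k, hk⟩ := h.surj d
    exact ⟨.inl k, hk⟩
  · rintro (t | t) ht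
    · have ht := isTip_attachEdge_inl.1 ht
      rw [rt t ht, σl, σl, κr, κr]
      exact h.thru t ht
    · obtain rfl := isTip_attachEdge_inr.1 ht
      change κ' (Γ.edgeRev e (Γ.edgeσ (.inr .stem))) = κ' (Γ.edgeσ (Γ.edgeσ (.inr .stem))) ∧
        κ' (Γ.edgeRev e (Γ.edgeσ (Γ.edgeσ (.inr .stem)))) = κ' (Γ.edgeσ (.inr .stem))
      rw [s2, s3]
      exact ⟨rfl, rfl⟩
  · rintro (t | t) ht
    · have ht := isTip_attachEdge_inl.1 ht
      rw [rt t ht, σl]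
      exact h.ne_none t ht
    · obtain rfl := isTip_attachEdge_inr.1 ht
      change κ' (Γ.edgeσ (.inr .stem)) ≠ none
      rw [s2]
      change κ (Γ.rev e) ≠ none
      rw [ne_eq, h.none_iff, Γ.rev_rev]
      tauto
  · intro α φ hφ
    have t1 := hφ (.inr .tip) (isTip_attachEdge_inr.2 rfl)
    change φ (Γ.edgeRev e (Γ.edgeσ (.inr .stem))) = φ (Γ.edgeσ (Γ.edgeσ (.inr .stem))) ∧
        φ (Γ.edgeRev e (Γ.edgeσ (Γ.edgeσ (.inr .stem)))) = φ (Γ.edgeσ (.inr .stem)) at t1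
    rw [s2, s3] at t1
    have t2 : φ (.inl e) = φ (.inr .fwd) ∧ φ (.inl (Γ.rev e)) = φ (.inr .back) := t1
    have φr : ∀ k, φ ((Γ.attachEdge e he).rev (.inl k)) = φ (.inl (Γ.rev k)) := fun k => by
      change φ (Γ.edgeRev e (.inl k)) = _
      by_cases h1 : k = e
      · rw [h1, edgeRev_self, t2.2]
      by_cases h2 : k = Γ.rev e
      · rw [h2, edgeRev_rev, Γ.rev_rev, t2.1]
      rw [edgeRev_of_ne h1 h2]
    have hφ' : Γ.Thru (φ ∘ Sum.inl) := fun t ht => by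
      have := hφ (.inl t) (isTip_attachEdge_inl.2 ht)
      rwa [rt t ht, σl, σl, φr, φr] at this
    -- Each labelled new dart agrees, in its label and in the value of `φ`, with an old one: `fwd`
    -- with `e`, and `back` with `rev e`.
    have key : ∀ z, κ' z ≠ none → ∃ k, κ' z = κ k ∧ φ z = φ (.inl k) := by
      rintro (k | k) hz
      · exact ⟨k, rfl, rfl⟩
      · rcases k with k | k | k | k
        · exact ⟨Γ.rev e, rfl, t2.2.symm⟩
        · exact ⟨e, rfl, t2.1.symm⟩
        · exact absurd rfl hz
        · exact absurd rfl hz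
    intro z z' hz hzz
    obtain ⟨k, h1, h2⟩ := key z hz
    obtain ⟨k', h1', h2'⟩ := key z' (hzz ▸ hz)
    rw [h2, h2']
    exact h.fiber α _ hφ' k k' (h1 ▸ hz) (by rw [← h1, ← h1', hzz])
  · rintro (k | k) hk
    · exact h.map_σ k ((pl k).1 hk)
    · exact (pr k hk).elim
  · intro d
    rw [h.free_iff, not_iff_not]
    constructor
    · rintro ⟨k, hk, hd⟩
      exact ⟨.inl k, (pl k).2 hk, hd⟩
    · rintro ⟨k | k, hk, hd⟩
      · exact ⟨k, (pl k).1 hk, hd⟩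
      · exact (pr k hk).elim
  · rintro (k | k) (k' | k') hk hk' hh
    · exact congrArg _ (h.plain_inj k k' ((pl k).1 hk) ((pl k').1 hk') hh)
    · exact (pr k' hk').elim
    · exact (pr k hk).elim
    · exact (pr k hk).elim

/-- The same closed graph after attaching a leg to a circle. -/
theorem attachCircle (h : CoreOf Γ G κ) (e : Γ.E) (he : Γ.free e) :
    CoreOf (Γ.attachCircle e he) G (Sum.elim κ fun _ => none) := by
  obtain ⟨s1, s2, s3, s4, s5⟩ := Γ.circleσ_apply e he
  have he' := Γ.free_rev e he
  have σl : ∀ k, ¬ Γ.free k → (Γ.attachCircle e he).σ (.inl k) = .inl (Γ.σ k) := fun k hk =>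
    circleσ_of_not_free he hk
  have rt : ∀ t, (Γ.attachCircle e he).rev (.inl t) = .inl (Γ.rev t) := fun t => rfl
  have rn : ∀ t, Γ.IsTip t → ¬ Γ.free (Γ.rev t) := fun t ht => free_rev_iff.not.2 ht.1
  have fn : ∀ {k}, Γ.free k → κ k ≠ none := fun {k} hk hn => by
    rcases (h.none_iff k).1 hn with hh | hh
    · exact hh.1 hk
    · exact hh.1 (Γ.free_rev k hk)
  set κ' : (Γ.attachCircle e he).E → Option G.E := Sum.elim κ (fun _ => none) with hκ'
  have κl : ∀ k, κ' (.inl k) = κ k := fun k => rfl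
  have pr : ∀ b, ¬ (Γ.attachCircle e he).Plain (.inr b) := by
    intro b hb
    obtain ⟨p1, p2, p3, p4⟩ := hb.2 (.inr true) (isTip_attachCircle_inr.2 rfl)
    change _ ≠ Sum.inr false at p2
    cases b <;> contradiction
  have pl : ∀ k, (Γ.attachCircle e he).Plain (.inl k) ↔ Γ.Plain k := by
    -- The darts of the circle stop being free, but they now start at the vertex of the new leg, so
    -- they do not become plain.
    refine fun k => ⟨fun hk => ?_, fun hk => ⟨fun hf => hk.1 hf.1, ?_⟩⟩
    · obtain ⟨p1, p2, p3, p4⟩ := hk.2 (.inr true) (isTip_attachCircle_inr.2 rfl)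
      change _ ≠ Γ.circleσ e (Γ.circleσ e (.inr false)) at p4
      change _ ≠ Γ.circleσ e (.inr false) at p3
      rw [s2] at p3 p4
      rw [s3] at p4
      refine ⟨fun hf => hk.1 ⟨hf, fun hh => p4 (congrArg _ hh), fun hh => p3 (congrArg _ hh)⟩,
        fun t ht => ?_⟩
      have := hk.2 (.inl t) (isTip_attachCircle_inl.2 ht)
      rw [rt t, σl _ (rn t ht), σl _ (not_free_σ (rn t ht))] at this
      simpa only [ne_eq, Sum.inl.injEq] using this
    · rintro (t | t) ht
      · have ht := isTip_attachCircle_inl.1 ht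
        rw [rt t, σl _ (rn t ht), σl _ (not_free_σ (rn t ht))]
        simpa only [ne_eq, Sum.inl.injEq] using hk.2 t ht
      · obtain rfl := isTip_attachCircle_inr.1 ht
        refine ⟨by simp, ?_, ?_, ?_⟩
        · change _ ≠ Sum.inr false
          simp
        · change _ ≠ Γ.circleσ e (.inr false)
          rw [s2]
          exact fun hh => hk.1 (Sum.inl_injective hh ▸ he')
        · change _ ≠ Γ.circleσ e (Γ.circleσ e (.inr false))
          rw [s2, s3]
          exact fun hh => hk.1 (Sum.inl_injective hh ▸ he)
  constructor
  · rintro (t | t) ht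
    · have ht' := isTip_attachCircle_inl.1 ht
      have n0 := rn t ht'
      refine ⟨ht, ?_, ?_⟩
      · rw [rt t, σl _ n0]
        simpa only [ne_eq, Sum.inl.injEq] using (h.isLeg t ht').ne
      · rw [rt t, σl _ n0, σl _ (not_free_σ n0), σl _ (not_free_σ (not_free_σ n0)),
          (h.isLeg t ht').cube]
    · obtain rfl := isTip_attachCircle_inr.1 ht
      refine ⟨ht, ?_, ?_⟩
      · change Γ.circleσ e (.inr false) ≠ .inr false
        simp [s2]
      · change Γ.circleσ e (Γ.circleσ e (Γ.circleσ e (.inr false))) = .inr false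
        rw [s2, s3, s1]
  · rintro (k | k)
    · rw [κl, h.none_iff, isTip_attachCircle_inl, rt, isTip_attachCircle_inl]
    · cases k
      · exact iff_of_true rfl (.inr (isTip_attachCircle_inr (he := he).2 rfl))
      · exact iff_of_true rfl (.inl (isTip_attachCircle_inr.2 rfl))
  · rintro (k | k)
    · exact h.map_rev k
    · rfl
  · intro d
    obtain ⟨k, hk⟩ := h.surj d
    exact ⟨.inl k, hk⟩
  · rintro (t | t) ht
    · have ht := isTip_attachCircle_inl.1 ht
      rw [rt t, σl _ (rn t ht), σl _ (not_free_σ (rn t ht))]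
      exact h.thru t ht
    · obtain rfl := isTip_attachCircle_inr.1 ht
      change κ' (Sum.map Γ.rev not (Γ.circleσ e (.inr false))) =
          κ' (Γ.circleσ e (Γ.circleσ e (.inr false))) ∧
        κ' (Sum.map Γ.rev not (Γ.circleσ e (Γ.circleσ e (.inr false)))) =
          κ' (Γ.circleσ e (.inr false))
      rw [s2, s3]
      exact ⟨congrArg κ (Γ.rev_rev e), rfl⟩
  · rintro (t | t) ht
    · have ht := isTip_attachCircle_inl.1 ht
      rw [rt t, σl _ (rn t ht)]
      exact h.ne_none t ht
    · obtain rfl := isTip_attachCircle_inr.1 ht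
      change κ' (Γ.circleσ e (.inr false)) ≠ none
      rw [s2]
      exact fn he'
  · intro α φ hφ
    have hφ' : Γ.Thru (φ ∘ Sum.inl) := fun t ht => by
      have := hφ (.inl t) (isTip_attachCircle_inl.2 ht)
      rwa [rt t, σl _ (rn t ht), σl _ (not_free_σ (rn t ht))] at this
    rintro (k | k) (k' | k') hk hk'
    · exact h.fiber α _ hφ' k k' hk hk'
    · exact absurd hk' hk
    · exact absurd rfl hk
    · exact absurd rfl hk
  · rintro (k | k) hk
    · have hk' := (pl k).1 hk
      rw [σl _ hk'.1]
      exact h.map_σ k hk'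
    · exact (pr k hk).elim
  · intro d
    rw [h.free_iff, not_iff_not]
    constructor
    · rintro ⟨k, hk, hd⟩
      exact ⟨.inl k, (pl k).2 hk, hd⟩
    · rintro ⟨k | k, hk, hd⟩
      · exact ⟨k, (pl k).1 hk, hd⟩
      · exact (pr k hk).elim
  · rintro (k | k) (k' | k') hk hk' hh
    · exact congrArg _ (h.plain_inj k k' ((pl k).1 hk) ((pl k').1 hk') hh)
    · exact (pr k' hk').elim
    · exact (pr k hk).elim
    · exact (pr k hk).elim

end CoreOf

/-- A graph such that the legs are attached to different 3-valent vertices can be obtained by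
attaching legs to a closed graph. -/
theorem exists_coreOf {Γ : OGraph} (hl : ∀ t, Γ.IsTip t → Γ.IsLeg t) (hf : ¬ Γ.HasFork) :
    ∃ G κ, CoreOf Γ G κ := by
  induction hn : Nat.card Γ.E using Nat.strong_induction_on generalizing Γ with
  | _ n ih =>
  by_cases ht : ∃ t, Γ.IsTip t
  · obtain ⟨t, ht⟩ := ht
    obtain ⟨H, ⟨e, he, ⟨f⟩⟩ | ⟨e, he, ⟨f⟩⟩⟩ := (hl t ht).exists_attach
    · have hc : Nat.card H.E < n := by
        rw [← hn, ← Nat.card_congr f.toEquiv, Nat.card_sum]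
        have : Nonempty OGraph.LegDart := ⟨.tip⟩
        exact Nat.lt_add_of_pos_right Nat.card_pos
      have hf' : ¬ (H.attachEdge e he).HasFork := fun h => hf (h.map_iso f)
      have hd : ¬ (H.IsTip e ∨ H.IsTip (H.rev e)) := fun h =>
        hf' (OGraph.hasFork_attachEdge_of_leg he h)
      -- Only the stems have to start at 3-valent vertices. This weaker hypothesis is carried
      -- through the induction because the result is also needed for graphs with a 4-valent vertex.
      have hlH : ∀ t, H.IsTip t → H.IsLeg t := fun t ht => by
        have h1 := (hl (f.toEquiv (.inl t)) ((OGraph.IsTip.map_iso f).2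
          (OGraph.isTip_attachEdge_inl.2 ht))).map_iso f.symm
        rw [show f.symm.toEquiv (f.toEquiv (.inl t)) = .inl t from
          f.toEquiv.symm_apply_apply _] at h1
        have hr : (H.attachEdge e he).rev (.inl t) = .inl (H.rev t) := OGraph.edgeRev_of_ne
          (fun hh => hd (.inl (hh ▸ ht))) (fun hh => hd (.inr (hh ▸ ht)))
        have h2 := h1.ne
        have h3 := h1.cube
        rw [hr] at h2 h3
        exact ⟨ht, fun hh => h2 (congrArg Sum.inl hh), Sum.inl_injective h3⟩
      obtain ⟨G, κ, h⟩ := ih _ hc hlH (fun h => hf' (h.attachEdge e he)) rfl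
      exact ⟨G, _, (h.attachEdge e he ((h.none_iff e).not.2 hd)).map_iso f⟩
    · have hc : Nat.card H.E < n := by
        rw [← hn, ← Nat.card_congr f.toEquiv, Nat.card_sum]
        exact Nat.lt_add_of_pos_right Nat.card_pos
      have hlH : ∀ t, H.IsTip t → H.IsLeg t := fun t ht => by
        have h1 := (hl (f.toEquiv (.inl t)) ((OGraph.IsTip.map_iso f).2
          (OGraph.isTip_attachCircle_inl.2 ht))).map_iso f.symm
        rw [show f.symm.toEquiv (f.toEquiv (.inl t)) = .inl t from
          f.toEquiv.symm_apply_apply _] at h1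
        have n0 : ¬ H.free (H.rev t) := OGraph.free_rev_iff.not.2 ht.1
        have σl : ∀ k, ¬ H.free k → (H.attachCircle e he).σ (.inl k) = .inl (H.σ k) :=
          fun k hk => OGraph.circleσ_of_not_free he hk
        have h2 : (H.attachCircle e he).σ (.inl (H.rev t)) ≠ .inl (H.rev t) := h1.ne
        have h3 : (H.attachCircle e he).σ ((H.attachCircle e he).σ ((H.attachCircle e he).σ
          (.inl (H.rev t)))) = .inl (H.rev t) := h1.cube
        rw [σl _ n0] at h2 h3
        rw [σl _ (OGraph.not_free_σ n0), σl _ (OGraph.not_free_σ (OGraph.not_free_σ n0))] at h3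
        exact ⟨ht, fun hh => h2 (congrArg Sum.inl hh), Sum.inl_injective h3⟩
      obtain ⟨G, κ, h⟩ := ih _ hc hlH (fun h => hf ((h.attachCircle e he).map_iso f)) rfl
      exact ⟨G, _, (h.attachCircle e he).map_iso f⟩
  · exact ⟨Γ, some, CoreOf.of_no_leg fun t h => ht ⟨t, h⟩⟩

end Jacobi
end

noncomputable section

namespace Jacobi

open scoped Classical

/-! ### The element of `D` of a graph with legs -/

section Value

variable {K : Type*} [Field K]

variable (K) in
/-- The class dual to an oriented edge, and `0` for `none`. -/
def dartClass (G : OGraph) (o : Option G.E) : SH1 K G :=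
  o.elim 0 fun d => SH1.ι K G (edgeClass K G d)

theorem edgeMonomial_cons (G : OGraph) (d : G.E) (s : Multiset G.E) :
    edgeMonomial K G (d ::ₘ s) = dartClass K G (some d) * edgeMonomial K G s := by
  simp [edgeMonomial, dartClass]

theorem edgeMonomial_singleton (G : OGraph) (d : G.E) :
    edgeMonomial K G {d} = dartClass K G (some d) := by
  simp [edgeMonomial, dartClass]

theorem dartClass_rev (G : OGraph) (o : Option G.E) :
    dartClass K G (o.map G.rev) = - dartClass K G o := by
  cases o
  · simp [dartClass]
  · simp [dartClass, edgeClass_rev]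

theorem dartClass_vertex {G : OGraph} (h3 : ∀ d, G.σ (G.σ (G.σ d)) = d) (d : G.E)
    (hd : ¬ G.free d) : dartClass K G (some d) + dartClass K G (some (G.σ d))
      + dartClass K G (some (G.σ (G.σ d))) = 0 := by
  change SH1.ι K G _ + SH1.ι K G _ + SH1.ι K G _ = 0
  rw [← map_add, ← map_add, edgeClass_vertex K hd (h3 d), map_zero]

theorem isoS_dartClass {G H : OGraph} (f : Iso G H) (o : Option G.E) :
    isoS K f (dartClass K G o) = dartClass K H (o.map f.toEquiv) := by
  cases o with
  | none => simp [dartClass]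
  | some d => rw [← edgeMonomial_singleton, isoS_edgeMonomial, Multiset.map_singleton,
      edgeMonomial_singleton]; rfl

variable (K) in
/-- The product of the classes dual to the oriented edges on whose left-hand sides the legs are
attached. -/
def legMonomial {Γ G : OGraph} (κ : Γ.E → Option G.E) : SH1 K G :=
  -- At the vertex of a leg the cyclic order is (forward, leg, backward), so the forward dart is two
  -- steps after the stem `rev t`. Its label is the oriented edge with the leg on its left.
  ∏ t : Γ.E, if Γ.IsTip t then dartClass K G (κ (Γ.σ (Γ.σ (Γ.rev t)))) else 1

theorem legMonomial_no_leg {Γ G : OGraph} (h : ∀ t, ¬ Γ.IsTip t) (κ : Γ.E → Option G.E) :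
    legMonomial K κ = 1 := Finset.prod_eq_one fun t _ => if_neg (h t)

theorem legMonomial_iso {Γ Γ' G : OGraph} (f : Iso Γ Γ') (κ : Γ.E → Option G.E) :
    legMonomial K (Γ := Γ') (κ ∘ f.toEquiv.symm) = legMonomial K κ := by
  refine (Fintype.prod_equiv f.toEquiv _ _ fun t => ?_).symm
  rw [OGraph.IsTip.map_iso, ← f.map_rev, ← f.map_σ, ← f.map_σ, Function.comp_apply,
    Equiv.symm_apply_apply]

theorem isoS_legMonomial {Γ G G' : OGraph} (g : Iso G G') (κ : Γ.E → Option G.E) :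
    isoS K g (legMonomial K κ) = legMonomial K fun e => (κ e).map g.toEquiv := by
  rw [legMonomial, map_prod, legMonomial]
  refine Finset.prod_congr rfl fun t _ => ?_
  split_ifs
  · rw [isoS_dartClass]
  · rw [map_one]

theorem prod_sum {A B M : Type*} [CommMonoid M] [Fintype A] [Fintype B] {_ : Fintype (A ⊕ B)}
    (f : A ⊕ B → M) : ∏ z, f z = (∏ a, f (.inl a)) * ∏ b, f (.inr b) := by
  rw [← Fintype.prod_sum_type f]
  congr!

/-- The factors of the old legs are unchanged because the edge of `e` is not itself a leg. The new
leg contributes the label of `fwd`, which is that of `e`. -/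
theorem legMonomial_attachEdge {Γ G : OGraph} {κ : Γ.E → Option G.E} (h : CoreOf Γ G κ) (e : Γ.E)
    (he : ¬ Γ.free e) (hd : κ e ≠ none) :
    legMonomial K (Γ := Γ.attachEdge e he) (Sum.elim κ (legLabel (κ e) (κ (Γ.rev e)))) =
      dartClass K G (κ e) * legMonomial K κ := by
  have := Fintype.ofFinite OGraph.LegDart
  obtain ⟨s1, s2, s3, s4⟩ := Γ.edgeσ_inr
  rw [ne_eq, h.none_iff] at hd
  rw [legMonomial, legMonomial, prod_sum, mul_comm]
  congr 1
  · rw [Finset.prod_eq_single .tip]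
    · rw [if_pos (OGraph.isTip_attachEdge_inr.2 rfl)]
      change dartClass K G (Sum.elim κ _ (Γ.edgeσ (Γ.edgeσ (.inr .stem)))) = _
      rw [s2, s3]
      rfl
    · exact fun b _ hb => if_neg (OGraph.isTip_attachEdge_inr.not.2 hb)
    · simp
  · refine Finset.prod_congr rfl fun t _ => ?_
    rw [OGraph.isTip_attachEdge_inl]
    split_ifs with ht
    · have hr : (Γ.attachEdge e he).rev (.inl t) = .inl (Γ.rev t) := OGraph.edgeRev_of_ne
        (fun hh => hd (.inl (hh ▸ ht))) (fun hh => hd (.inr (hh ▸ ht)))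
      rw [hr]
      rfl
    · rfl

theorem legMonomial_attachCircle {Γ G : OGraph} {κ : Γ.E → Option G.E} (e : Γ.E)
    (he : Γ.free e) :
    legMonomial K (Γ := Γ.attachCircle e he) (Sum.elim κ fun _ => none) =
      dartClass K G (κ e) * legMonomial K κ := by
  obtain ⟨s1, s2, s3, s4, s5⟩ := Γ.circleσ_apply e he
  rw [legMonomial, legMonomial, prod_sum, mul_comm]
  congr 1
  · rw [Finset.prod_eq_single true]
    · rw [if_pos (OGraph.isTip_attachCircle_inr.2 rfl)]
      change dartClass K G (Sum.elim κ _ (Γ.circleσ e (Γ.circleσ e (.inr false)))) = _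
      rw [s2, s3]
      rfl
    · exact fun b _ hb => if_neg (OGraph.isTip_attachCircle_inr.not.2 hb)
    · simp
  · refine Finset.prod_congr rfl fun t _ => ?_
    rw [OGraph.isTip_attachCircle_inl]
    split_ifs with ht
    · have n0 : ¬ Γ.free (Γ.rev t) := OGraph.free_rev_iff.not.2 ht.1
      change dartClass K G (Sum.elim κ _ (Γ.circleσ e (Γ.circleσ e (.inl (Γ.rev t))))) = _
      rw [OGraph.circleσ_of_not_free he n0, OGraph.circleσ_of_not_free he (OGraph.not_free_σ n0)]
      rfl
    · rfl

/-- This ties the inductive description by attached legs to the intrinsic one. By uniqueness of the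
core, different ways of building the same graph then give the same value. -/
theorem LegsOn.coreOf {G : TriGraph} {Γ : UTGraph} {κ : Γ.1.E → Option G.1.E}
    {s : Multiset G.1.E} (h : LegsOn G Γ κ s) :
    CoreOf Γ.1 G.1 κ ∧ legMonomial K κ = edgeMonomial K G.1 s := by
  induction h with
  | core =>
    have h0 : ∀ t, ¬ G.1.IsTip t := fun t ht => G.2.2 t ht.1 ht.2
    refine ⟨CoreOf.of_no_leg h0, ?_⟩
    rw [edgeMonomial_zero, legMonomial_no_leg h0]
  | edge Γ κ s e he d hd _ ih =>
    have hn : κ e ≠ none := by rw [hd]; exact Option.some_ne_none d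
    refine ⟨ih.1.attachEdge e he hn, ?_⟩
    rw [legMonomial_attachEdge ih.1 e he hn, ih.2, hd, edgeMonomial_cons]
  | circle Γ κ s e he d hd _ ih =>
    refine ⟨ih.1.attachCircle e he, ?_⟩
    rw [legMonomial_attachCircle e he, ih.2, hd, edgeMonomial_cons]

variable [CharZero K]

theorem D.cls_iso {G H : TriGraph} (f : Iso G.1 H.1) (x : SH1 K G.1) :
    D.cls K H (isoS K f x) = D.cls K G x :=
  congrArg (Ideal.Quotient.mk _) (DTilde.proj_iso K f x)

theorem D.cls_add (G : TriGraph) (x y : SH1 K G.1) :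
    D.cls K G (x + y) = D.cls K G x + D.cls K G y := by
  rw [D.cls, D.cls, D.cls, ← map_add, map_add]

theorem D.cls_zero (G : TriGraph) : D.cls K G 0 = 0 := by
  rw [D.cls, map_zero, map_zero]

theorem D.cls_neg (G : TriGraph) (x : SH1 K G.1) : D.cls K G (-x) = - D.cls K G x := by
  rw [D.cls, D.cls, ← map_neg, map_neg]

theorem D.cls_flip (G : TriGraph) (e : G.1.E) (he : G.1.σ e ≠ e) (x : SH1 K G.1) :
    D.cls K G x + D.cls K (G.flip e he) ((Collapse.flip K G.1 e).S x) = 0 := by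
  rw [D.cls, D.cls, ← map_add, Ideal.Quotient.eq_zero_iff_mem]
  exact Submodule.mem_sup_left (Submodule.subset_span ⟨G, e, he, x, rfl⟩)

theorem D.cls_resolve {G : OGraph} {v : G.E} (h : G.IsTriFour v) (x : SH1 K G) :
    D.cls K ⟨G.resolve v h.1 0, h.resolve 0⟩ ((Collapse.resolve K G v h.1 0).S x)
      - D.cls K ⟨G.resolve v h.1 1, h.resolve 1⟩ ((Collapse.resolve K G v h.1 1).S x)
      + D.cls K ⟨G.resolve v h.1 2, h.resolve 2⟩ ((Collapse.resolve K G v h.1 2).S x) = 0 := by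
  rw [D.cls, D.cls, D.cls, ← map_sub, ← map_add, Ideal.Quotient.eq_zero_iff_mem]
  exact Submodule.mem_sup_right (Submodule.subset_span ⟨G, v, h, x, rfl⟩)

variable (K) in
/-- The element of `D` given by a graph with legs: the monomial of its legs if they are attached to
different vertices, and `0` otherwise. -/
def graphValue (Γ : OGraph) : D K :=
  if h : ∃ (G : TriGraph) (κ : Γ.E → Option G.1.E), CoreOf Γ G.1 κ then
    D.cls K h.choose (legMonomial K h.choose_spec.choose) else 0

/-- Two cores of the same graph differ by an isomorphism that respects the labels, and classes in
$\mathcal D$ do not see isomorphisms. -/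
theorem graphValue_eq {Γ : OGraph} {G : TriGraph} {κ : Γ.E → Option G.1.E}
    (h : CoreOf Γ G.1 κ) : graphValue K Γ = D.cls K G (legMonomial K κ) := by
  have hex : ∃ (G : TriGraph) (κ : Γ.E → Option G.1.E), CoreOf Γ G.1 κ := ⟨G, κ, h⟩
  rw [graphValue, dif_pos hex]
  obtain ⟨g, hg⟩ := hex.choose_spec.choose_spec.exists_iso h
  rw [← D.cls_iso g, isoS_legMonomial]
  simp only [← hg]

theorem graphValue_of_hasFork {Γ : OGraph} (h : Γ.HasFork) : graphValue K Γ = 0 :=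
  dif_neg fun ⟨_, _, hc⟩ => hc.not_hasFork h

theorem OGraph.IsUniTri.exists_coreOf {Γ : OGraph} (hΓ : Γ.IsUniTri) (hf : ¬ Γ.HasFork) :
    ∃ (G : TriGraph) (κ : Γ.E → Option G.1.E), CoreOf Γ G.1 κ := by
  obtain ⟨G, κ, h⟩ := Jacobi.exists_coreOf (fun t ht => hΓ.isLeg ht) hf
  exact ⟨⟨G, h.isTri hΓ.1⟩, κ, h⟩

theorem graphValue_iso {Γ Γ' : OGraph} (hΓ : Γ.IsUniTri) (f : Iso Γ Γ') :
    graphValue K Γ = graphValue K Γ' := by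
  by_cases hf : Γ.HasFork
  · rw [graphValue_of_hasFork hf, graphValue_of_hasFork (hf.map_iso f)]
  · obtain ⟨G, κ, h⟩ := hΓ.exists_coreOf hf
    rw [graphValue_eq h, graphValue_eq (h.map_iso f), legMonomial_iso]

/-- The formula also covers a leg attached to a leg: there the label is `none`, whose class is `0`,
and the graph has a fork. -/
theorem graphValue_attachEdge {Γ : OGraph} {G : TriGraph} {κ : Γ.E → Option G.1.E}
    (h : CoreOf Γ G.1 κ) (e : Γ.E) (he : ¬ Γ.free e) :
    graphValue K (Γ.attachEdge e he) = D.cls K G (dartClass K G.1 (κ e) * legMonomial K κ) := by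
  by_cases hd : κ e = none
  · rw [graphValue_of_hasFork (OGraph.hasFork_attachEdge_of_leg he ((h.none_iff e).1 hd)), hd]
    simp [dartClass, D.cls_zero]
  · rw [graphValue_eq (h.attachEdge e he hd), legMonomial_attachEdge h e he hd]

/-- The value of a graph that is obtained by attaching legs to a closed graph. -/
theorem LegsOn.graphValue {G : TriGraph} {Γ : UTGraph} {κ : Γ.1.E → Option G.1.E}
    {s : Multiset G.1.E} (h : LegsOn G Γ κ s) :
    graphValue K Γ.1 = D.cls K G (edgeMonomial K G.1 s) := by
  obtain ⟨h1, h2⟩ := h.coreOf (K := K)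
  rw [graphValue_eq h1, h2]

end Value

end Jacobi
end

noncomputable section

namespace Jacobi

open scoped Classical

/-! ### The antisymmetry relation for the element of `D` of a graph -/

/-- The same graph with different cyclic orders. -/
abbrev OGraph.withσ (G : OGraph) (τ : Equiv.Perm G.E) (hτ : ∀ e, G.free e → τ e = e) : OGraph :=
  { G with σ := τ, σ_free := hτ }

/-- At the vertex of a leg the order may be kept or reversed; both leave the same two edges joined
across the leg, so the labels remain valid. The core is affected only through the plain darts, where
`hσ` matches `τ` with `ρ`. -/
theorem CoreOf.withσ {Γ G : OGraph} {κ : Γ.E → Option G.E} (h : CoreOf Γ G κ)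
    {τ : Equiv.Perm Γ.E} (hτ : ∀ e, Γ.free e → τ e = e)
    {ρ : Equiv.Perm G.E} (hρ : ∀ e, G.free e → ρ e = e)
    (htip : ∀ t, τ t = t ↔ Γ.σ t = t)
    (hs : ∀ t, Γ.IsTip t →
      (τ (Γ.rev t) = Γ.σ (Γ.rev t) ∧ τ (Γ.σ (Γ.rev t)) = Γ.σ (Γ.σ (Γ.rev t)) ∧
        τ (Γ.σ (Γ.σ (Γ.rev t))) = Γ.rev t) ∨
      (τ (Γ.rev t) = Γ.σ (Γ.σ (Γ.rev t)) ∧ τ (Γ.σ (Γ.σ (Γ.rev t))) = Γ.σ (Γ.rev t) ∧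
        τ (Γ.σ (Γ.rev t)) = Γ.rev t))
    (hσ : ∀ e, Γ.Plain e → κ (τ e) = (κ e).map ρ) :
    CoreOf (Γ.withσ τ hτ) (G.withσ ρ hρ) κ := by
  have tip : ∀ t, (Γ.withσ τ hτ).IsTip t ↔ Γ.IsTip t := fun t => and_congr Iff.rfl (htip t)
  have plain : ∀ e, (Γ.withσ τ hτ).Plain e ↔ Γ.Plain e := by
    refine fun e => and_congr Iff.rfl (forall_congr' fun t => ?_)
    rw [tip]
    refine forall_congr' fun ht => ?_
    change e ≠ t ∧ e ≠ Γ.rev t ∧ e ≠ τ (Γ.rev t) ∧ e ≠ τ (τ (Γ.rev t)) ↔ _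
    rcases hs t ht with ⟨h1, h2, -⟩ | ⟨h1, h2, -⟩ <;> rw [h1, h2]
    tauto
  have thru : ∀ {α : Type} (φ : Γ.E → α), (Γ.withσ τ hτ).Thru φ ↔ Γ.Thru φ := by
    refine fun φ => forall_congr' fun t => ?_
    rw [tip]
    refine forall_congr' fun ht => ?_
    change φ (Γ.rev (τ (Γ.rev t))) = φ (τ (τ (Γ.rev t))) ∧
      φ (Γ.rev (τ (τ (Γ.rev t)))) = φ (τ (Γ.rev t)) ↔ _
    rcases hs t ht with ⟨h1, h2, -⟩ | ⟨h1, h2, -⟩ <;> rw [h1, h2]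
    tauto
  constructor
  · intro t ht
    have ht' := (tip t).1 ht
    have hl := h.isLeg t ht'
    refine ⟨ht, (htip _).not.2 hl.ne, ?_⟩
    change τ (τ (τ (Γ.rev t))) = Γ.rev t
    rcases hs t ht' with ⟨h1, h2, h3⟩ | ⟨h1, h2, h3⟩ <;> rw [h1, h2, h3]
  · intro e
    rw [h.none_iff, tip, tip]
  · exact h.map_rev
  · exact h.surj
  · exact (thru κ).2 h.thru
  · intro t ht
    have ht' := (tip t).1 ht
    change κ (τ (Γ.rev t)) ≠ none
    rcases hs t ht' with ⟨h1, -⟩ | ⟨h1, -⟩ <;> rw [h1]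
    · exact h.ne_none t ht'
    -- In the reversed case the dart after the stem is the former forward one. It carries a label
    -- because passing the leg identifies its reverse with the backward dart.
    · have := h.ne_none t ht'
      rw [← (h.thru t ht').2, h.map_rev] at this
      exact fun hh => this (by rw [hh]; rfl)
  · exact fun α φ hφ => h.fiber α φ ((thru φ).1 hφ)
  · exact fun e he => hσ e ((plain e).1 he)
  · intro d
    simp only [plain]
    exact h.free_iff d
  · exact fun e e' he he' => h.plain_inj e e' ((plain e).1 he) ((plain e').1 he')

namespace OGraph

variable {Γ : OGraph}

theorem flip_of_not_mem {v s : Γ.E} (h3 : Γ.σ (Γ.σ (Γ.σ v)) = v) (h0 : s ≠ v) (h1 : s ≠ Γ.σ v)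
    (h2 : s ≠ Γ.σ (Γ.σ v)) (hs : Γ.σ (Γ.σ (Γ.σ s)) = s) :
    (Γ.flip v).σ s = Γ.σ s ∧ (Γ.flip v).σ (Γ.σ s) = Γ.σ (Γ.σ s) ∧
      (Γ.flip v).σ (Γ.σ (Γ.σ s)) = s := by
  have key : ∀ k, k ≠ v → k ≠ Γ.σ v → k ≠ Γ.σ (Γ.σ v) →
      Γ.σ k ≠ v ∧ Γ.σ k ≠ Γ.σ v ∧ Γ.σ k ≠ Γ.σ (Γ.σ v) := fun k k0 k1 k2 =>
    ⟨fun hh => k2 (Γ.σ.injective (hh.trans h3.symm)), fun hh => k0 (Γ.σ.injective hh),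
      fun hh => k1 (Γ.σ.injective hh)⟩
  obtain ⟨a0, a1, a2⟩ := key s h0 h1 h2
  obtain ⟨b0, b1, b2⟩ := key _ a0 a1 a2
  exact ⟨flip_of_ne h3 h0 h1 h2, flip_of_ne h3 a0 a1 a2, (flip_of_ne h3 b0 b1 b2).trans hs⟩

end OGraph

section

variable {Γ G : OGraph} {κ : Γ.E → Option G.E}

theorem OGraph.Plain.rev_ne {v t : Γ.E} (hv : Γ.Plain v) (h3 : Γ.σ (Γ.σ (Γ.σ v)) = v)
    (ht : Γ.IsTip t) : Γ.rev t ≠ v ∧ Γ.rev t ≠ Γ.σ v ∧ Γ.rev t ≠ Γ.σ (Γ.σ v) := by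
  obtain ⟨-, p1, p2, p3⟩ := hv.2 t ht
  exact ⟨p1.symm, fun hh => p3 (by rw [hh, h3]), fun hh => p2 (by rw [hh, h3])⟩

/-- Reversal of the cyclic order at a vertex without legs. -/
theorem CoreOf.flip_plain (h : CoreOf Γ G κ) {v : Γ.E} (hv : Γ.Plain v)
    (h3 : Γ.σ (Γ.σ (Γ.σ v)) = v) {d : G.E} (hd : κ v = some d) :
    CoreOf (Γ.flip v) (G.flip d) κ := by
  have hn : Γ.σ v ≠ v := fun hh => (hv.2 v ⟨hv.1, hh⟩).1 rfl
  have hv1 := hv.σ h.isLeg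
  have hv2 := hv1.σ h.isLeg
  have hd1 : κ (Γ.σ v) = some (G.σ d) := by rw [h.map_σ v hv, hd]; rfl
  have hd2 : κ (Γ.σ (Γ.σ v)) = some (G.σ (G.σ d)) := by rw [h.map_σ _ hv1, hd1]; rfl
  have hd3 : G.σ (G.σ (G.σ d)) = d := by
    have := h.map_σ _ hv2
    rw [h3, hd2, hd] at this
    exact (Option.some_injective _ this).symm
  have hdn : G.σ d ≠ d := h.no_leg d (by rw [h.free_iff, not_not]; exact ⟨v, hv, hd⟩)
  obtain ⟨o0, o1, o2⟩ := OGraph.flip_orbit hn h3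
  obtain ⟨r0, r1, r2⟩ := OGraph.flip_orbit hdn hd3
  refine h.withσ (Γ.flip v).σ_free (G.flip d).σ_free (fun t => Γ.flip_σ_eq_iff v t hn)
    (fun t ht => ?_) fun e he => ?_
  · obtain ⟨n0, n1, n2⟩ := hv.rev_ne h3 ht
    exact .inl (OGraph.flip_of_not_mem h3 n0 n1 n2 (h.isLeg t ht).cube)
  · by_cases e0 : e = v
    · rw [e0, o0, hd, hd2, Option.map_some, r0]
    by_cases e1 : e = Γ.σ v
    · rw [e1, o1, hd1, hd, Option.map_some, r1]
    by_cases e2 : e = Γ.σ (Γ.σ v)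
    · rw [e2, o2, hd2, hd1, Option.map_some, r2]
    rw [OGraph.flip_of_ne h3 e0 e1 e2, h.map_σ e he]
    obtain ⟨k, hk⟩ := Option.ne_none_iff_exists'.1 (h.plain_ne_none he)
    rw [hk, Option.map_some, Option.map_some, OGraph.flip_of_ne hd3]
    · exact fun hh => e0 (h.plain_inj _ _ he hv (by rw [hk, hd, hh]))
    · exact fun hh => e1 (h.plain_inj _ _ he hv1 (by rw [hk, hd1, hh]))
    · exact fun hh => e2 (h.plain_inj _ _ he hv2 (by rw [hk, hd2, hh]))

theorem CoreOf.stem_ne (h : CoreOf Γ G κ) {t t' : Γ.E} (ht : Γ.IsTip t) (ht' : Γ.IsTip t')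
    (hne : t' ≠ t) : Γ.rev t' ≠ Γ.rev t ∧ Γ.rev t' ≠ Γ.σ (Γ.rev t) ∧
      Γ.rev t' ≠ Γ.σ (Γ.σ (Γ.rev t)) := by
  refine ⟨fun hh => hne (Γ.rev_injective hh), fun hh => h.not_hasFork ⟨t, t', hne.symm, ht, ht', hh.symm⟩,
    fun hh => h.not_hasFork ⟨t', t, hne, ht', ht, ?_⟩⟩
  rw [hh, (h.isLeg t ht).cube]

/-- Reversal of the cyclic order at a vertex with a leg. -/
theorem CoreOf.flip_leg (h : CoreOf Γ G κ) {t : Γ.E} (ht : Γ.IsTip t) :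
    CoreOf (Γ.flip (Γ.rev t)) G κ := by
  have hl := h.isLeg t ht
  obtain ⟨o0, o1, o2⟩ := OGraph.flip_orbit hl.ne hl.cube
  refine h.withσ (Γ.flip (Γ.rev t)).σ_free G.σ_free (fun k => Γ.flip_σ_eq_iff _ k hl.ne)
    (fun t' ht' => ?_) fun e he => ?_
  · by_cases hne : t' = t
    · rw [hne]
      exact .inr ⟨o0, o2, o1⟩
    · obtain ⟨n0, n1, n2⟩ := h.stem_ne ht ht' hne
      exact .inl (OGraph.flip_of_not_mem hl.cube n0 n1 n2 (h.isLeg t' ht').cube)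
  · obtain ⟨-, p1, p2, p3⟩ := he.2 t ht
    rw [OGraph.flip_of_ne hl.cube p1 p2 p3, h.map_σ e he]

variable {K : Type*} [Field K]

theorem legMonomial_flip_plain (h : CoreOf Γ G κ) {v : Γ.E} (hv : Γ.Plain v)
    (h3 : Γ.σ (Γ.σ (Γ.σ v)) = v) (d : G.E) :
    legMonomial K (Γ := Γ.flip v) (G := G.flip d) κ =
      (Collapse.flip K G d).S (legMonomial K κ) := by
  have hn : Γ.σ v ≠ v := fun hh => (hv.2 v ⟨hv.1, hh⟩).1 rfl
  rw [legMonomial, legMonomial, map_prod]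
  refine Finset.prod_congr rfl fun t _ => ?_
  have tip : (Γ.flip v).IsTip t ↔ Γ.IsTip t := and_congr Iff.rfl (Γ.flip_σ_eq_iff v t hn)
  by_cases ht : Γ.IsTip t
  · obtain ⟨n0, n1, n2⟩ := hv.rev_ne h3 ht
    obtain ⟨m0, m1, -⟩ := OGraph.flip_of_not_mem h3 n0 n1 n2 (h.isLeg t ht).cube
    rw [if_pos ht, if_pos (tip.2 ht)]
    change dartClass K (G.flip d) (κ ((Γ.flip v).σ ((Γ.flip v).σ (Γ.rev t)))) = _
    rw [m0, m1]
    cases κ (Γ.σ (Γ.σ (Γ.rev t))) with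
    | none => simp [dartClass]
    | some k =>
      rw [← edgeMonomial_singleton, ← edgeMonomial_singleton, Collapse.S_edgeMonomial K
        (Collapse.flip K G d) (fun h => h) (fun _ => rfl), Multiset.map_id']
      intro e h
      change some h = some e ↔ _
      rw [Option.some_inj]
  · rw [if_neg ht, if_neg (tip.not.2 ht), map_one]

/-- Forward and backward are exchanged at this leg, so its label is replaced by the reversed edge,
whose class is the negative; the other factors stay the same. -/
theorem legMonomial_flip_leg (h : CoreOf Γ G κ) {t : Γ.E} (ht : Γ.IsTip t) :
    legMonomial K (Γ := Γ.flip (Γ.rev t)) κ = - legMonomial K κ := by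
  have hl := h.isLeg t ht
  obtain ⟨o0, o1, o2⟩ := OGraph.flip_orbit hl.ne hl.cube
  have tip : ∀ k, (Γ.flip (Γ.rev t)).IsTip k ↔ Γ.IsTip k :=
    fun k => and_congr Iff.rfl (Γ.flip_σ_eq_iff _ k hl.ne)
  rw [legMonomial, legMonomial, ← Finset.mul_prod_erase _ _ (Finset.mem_univ t)]
  refine Eq.trans ?_ (congrArg Neg.neg (Finset.mul_prod_erase _ _ (Finset.mem_univ t)))
  rw [← neg_mul]
  congr 1
  · rw [if_pos ht, if_pos ((tip t).2 ht)]
    change dartClass K G (κ ((Γ.flip (Γ.rev t)).σ ((Γ.flip (Γ.rev t)).σ (Γ.rev t)))) = _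
    rw [o0, o2, ← (h.thru t ht).2, h.map_rev, dartClass_rev]
  · refine Finset.prod_congr rfl fun t' ht' => ?_
    have hne := (Finset.mem_erase.1 ht').1
    by_cases ht' : Γ.IsTip t'
    · obtain ⟨n0, n1, n2⟩ := h.stem_ne ht ht' hne
      obtain ⟨m0, m1, -⟩ := OGraph.flip_of_not_mem hl.cube n0 n1 n2 (h.isLeg t' ht').cube
      rw [if_pos ht', if_pos ((tip t').2 ht')]
      change dartClass K G (κ ((Γ.flip (Γ.rev t)).σ ((Γ.flip (Γ.rev t)).σ (Γ.rev t')))) = _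
      rw [m0, m1]
    · rw [if_neg ht', if_neg ((tip t').not.2 ht')]

/-- The vertex of a map that reverses a cyclic order can be given by any of its darts. -/
def AntiIso.rotate {H : OGraph} {v : Γ.E} (f : AntiIso Γ H v) : AntiIso Γ H (Γ.σ v) where
  toEquiv := f.toEquiv
  map_rev := f.map_rev
  map_free := f.map_free
  map_σ e h0 h1 h2 := f.map_σ e (by rwa [f.cube] at h2) h0 h1
  ne hh := f.ne (Γ.σ.injective hh)
  cube := congrArg Γ.σ f.cube
  orbit₀ := by rw [f.orbit₁, f.cube]
  orbit₁ := f.orbit₂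
  orbit₂ := by rw [f.cube, f.orbit₀]

/-- If the reversed vertex is that of the fork, the two stems follow each other in the opposite
order; otherwise nothing changes. -/
theorem OGraph.HasFork.flip (hΓ : Γ.IsUniTri) (h : Γ.HasFork) {v : Γ.E} (hv : Γ.σ v ≠ v) :
    (Γ.flip v).HasFork := by
  have tip : ∀ k, (Γ.flip v).IsTip k ↔ Γ.IsTip k :=
    fun k => and_congr Iff.rfl (Γ.flip_σ_eq_iff _ k hv)
  have h3 := hΓ.1 v
  obtain ⟨o0, o1, o2⟩ := OGraph.flip_orbit hv h3
  obtain ⟨t, t', h0, h1, h2, hs⟩ := h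
  have same : Γ.rev t = v ∨ Γ.rev t = Γ.σ v ∨ Γ.rev t = Γ.σ (Γ.σ v) →
      (Γ.flip v).σ (Γ.rev t') = Γ.rev t := by
    rw [← hs]
    rintro (hh | hh | hh)
    · rw [hh, o1]
    · rw [hh, o2]
    · rw [hh, h3, o0]
  by_cases hm : Γ.rev t = v ∨ Γ.rev t = Γ.σ v ∨ Γ.rev t = Γ.σ (Γ.σ v)
  · exact ⟨t', t, h0.symm, (tip _).2 h2, (tip _).2 h1, same hm⟩
  · push Not at hm
    exact ⟨t, t', h0, (tip _).2 h1, (tip _).2 h2,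
      (OGraph.flip_of_ne h3 hm.1 hm.2.1 hm.2.2).trans hs⟩

variable [CharZero K]

/-- A vertex without legs is a vertex of the core, and AS in $\mathcal D$ applies. At the vertex of
a leg the core stays the same and one factor of the monomial changes its sign. -/
theorem graphValue_flip (hΓ : Γ.IsUniTri) (v : Γ.E) (hv : Γ.σ v ≠ v) :
    graphValue K Γ + graphValue K (Γ.flip v) = 0 := by
  by_cases hf : Γ.HasFork
  · rw [graphValue_of_hasFork hf, graphValue_of_hasFork (hf.flip hΓ hv), add_zero]
  obtain ⟨G, κ, h⟩ := hΓ.exists_coreOf hf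
  by_cases hp : Γ.Plain v
  · obtain ⟨d, hd⟩ := Option.ne_none_iff_exists'.1 (h.plain_ne_none hp)
    have hdn : G.1.σ d ≠ d :=
      h.no_leg d (by rw [h.free_iff, not_not]; exact ⟨v, hp, hd⟩)
    rw [graphValue_eq h, graphValue_eq (G := G.flip d hdn) (h.flip_plain hp (hΓ.1 v) hd)]
    have := D.cls_flip G d hdn (legMonomial K κ)
    rwa [← legMonomial_flip_plain h hp (hΓ.1 v)] at this
  · have hex : ∃ t, Γ.IsTip t ∧ Nonempty (AntiIso Γ (Γ.flip v) (Γ.rev t)) := by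
      rw [OGraph.Plain, not_and] at hp
      have hp := hp (OGraph.not_free_of_σ_ne hv)
      push Not at hp
      obtain ⟨t, ht, hp⟩ := hp
      refine ⟨t, ht, ?_⟩
      -- The dart `v` is the stem or one of the other two darts at the vertex of the leg; rotating
      -- makes the stem the base dart.
      have f := AntiIso.flip Γ v hv (hΓ.1 v)
      by_cases p1 : v = Γ.rev t
      · exact ⟨p1 ▸ f⟩
      by_cases p2 : v = Γ.σ (Γ.rev t)
      · have := f.rotate.rotate
        rw [p2, hΓ.1, ← p2] at this
        exact ⟨this⟩
      · have p3 := hp (fun hh => hv (hh ▸ ht.2)) p1 p2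
        have := f.rotate
        rw [p3, hΓ.1, ← p3] at this
        exact ⟨this⟩
    obtain ⟨t, ht, ⟨f⟩⟩ := hex
    rw [← graphValue_iso (hΓ.flip _ (h.isLeg t ht).ne) f.iso, graphValue_eq h,
      graphValue_eq (h.flip_leg ht), legMonomial_flip_leg h ht, D.cls_neg, add_neg_cancel]

theorem graphValue_antiIso {Γ' : OGraph} (hΓ : Γ.IsUniTri) {v : Γ.E} (f : AntiIso Γ Γ' v) :
    graphValue K Γ + graphValue K Γ' = 0 := by
  rw [← graphValue_iso (hΓ.flip v f.ne) f.iso, graphValue_flip hΓ v f.ne]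

end

end Jacobi
end

noncomputable section

namespace Jacobi

open scoped Classical

/-! ### The IHX relation for the element of `D` of a graph -/

section ResolveMaps

open OGraph

variable {G H : OGraph}

theorem OGraph.IsFourAt.exists_arm {x e : G.E} (he : ∃ j, G.arm x j = e) :
    e = G.arm x 0 ∨ e = G.arm x 1 ∨ e = G.arm x 2 ∨ e = G.arm x 3 :=
  IsFourAt.exists_split 0 he

/-- Isomorphic graphs have isomorphic resolutions. -/
def Iso.resolve (f : Iso G H) {x : G.E} {y : H.E} (hxy : f.toEquiv x = y) (hx : G.IsFourAt x)
    (hy : H.IsFourAt y) (i : Fin 3) : Iso (G.resolve x hx i) (H.resolve y hy i) where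
  toEquiv := Equiv.sumCongr f.toEquiv (Equiv.refl _)
  map_rev := by
    rintro (e | b)
    · exact congrArg Sum.inl (f.map_rev e)
    · rfl
  map_free := by
    rintro (e | b)
    · exact f.map_free e
    · exact Iff.rfl
  map_σ := by
    subst hxy
    have ha : ∀ j, H.arm (f.toEquiv x) j = f.toEquiv (G.arm x j) := by
      intro j
      fin_cases j <;> simp [arm, f.map_σ]
    obtain ⟨a1, a2, a3, a4, a5, a6⟩ := hx.resolveσ_split i
    obtain ⟨b1, b2, b3, b4, b5, b6⟩ := hy.resolveσ_split i
    simp only [ha] at b1 b2 b3 b4 b5 b6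
    change ∀ z, Equiv.sumCongr f.toEquiv (Equiv.refl _) (G.resolveσ x i z) =
      H.resolveσ (f.toEquiv x) i (Equiv.sumCongr f.toEquiv (Equiv.refl _) z)
    rintro (e | b)
    · by_cases he : ∃ j, G.arm x j = e
      · rcases IsFourAt.exists_split i he with rfl | rfl | rfl | rfl
        · exact (congrArg _ a1).trans b1.symm
        · exact (congrArg _ a2).trans b2.symm
        · exact (congrArg _ a5).trans b5.symm
        · exact (congrArg _ a6).trans b6.symm
      · refine (congrArg _ (resolveσ_of_not i he)).trans (Eq.symm ?_)
        refine (resolveσ_of_not i ?_).trans (congrArg _ (f.map_σ e).symm)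
        simpa only [ha, f.toEquiv.injective.eq_iff] using he
    · cases b
      · exact (congrArg _ a3).trans b3.symm
      · exact (congrArg _ a4).trans b4.symm

variable {x : G.E}

theorem OGraph.IsFourAt.arm_rotate (h : G.IsFourAt x) (j : Fin 4) :
    G.arm (G.σ x) j = G.arm x (j + 1) := by
  rw [← h.σ_arm]
  fin_cases j <;> rfl

theorem OGraph.IsFourAt.rotate (h : G.IsFourAt x) : G.IsFourAt (G.σ x) :=
  ⟨congrArg G.σ h.1, fun hh => h.2.1 (G.σ.injective hh), fun e e0 e1 e2 e3 =>
    h.2.2 e (by rwa [h.1] at e3) e0 e1 e2⟩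

theorem OGraph.IsUniTriFour.rotate (h : G.IsUniTriFour x) : G.IsUniTriFour (G.σ x) :=
  ⟨h.1.rotate, h.2⟩

theorem OGraph.IsFourAt.not_arm_rotate (h : G.IsFourAt x) {e : G.E} (he : ¬ ∃ j, G.arm x j = e) :
    ¬ ∃ j, G.arm (G.σ x) j = e := by
  rintro ⟨j, hj⟩
  exact he ⟨j + 1, by rw [← h.arm_rotate, hj]⟩

theorem OGraph.IsFourAt.resolveσ_eq (h : G.IsFourAt x) (i : Fin 3) (a b c d : Fin 4)
    (hs : split i = ![a, b, c, d]) :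
    G.resolveσ x i (.inl (G.arm x a)) = .inl (G.arm x b) ∧
    G.resolveσ x i (.inl (G.arm x b)) = .inr false ∧
    G.resolveσ x i (.inr false) = .inl (G.arm x a) ∧
    G.resolveσ x i (.inr true) = .inl (G.arm x c) ∧
    G.resolveσ x i (.inl (G.arm x c)) = .inl (G.arm x d) ∧
    G.resolveσ x i (.inl (G.arm x d)) = .inr true := by
  have := h.resolveσ_split i
  rw [hs] at this
  exact this

/-- The first resolution after a rotation. -/
def Iso.resolveRotate₀ (h : G.IsFourAt x) (h' : G.IsFourAt (G.σ x)) :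
    Iso (G.resolve (G.σ x) h' 0) (G.resolve x h 1) where
  toEquiv := Equiv.refl _
  map_rev _ := rfl
  map_free _ := Iff.rfl
  map_σ := by
    obtain ⟨a1, a2, a3, a4, a5, a6⟩ := h'.resolveσ_eq 0 0 1 2 3 rfl
    obtain ⟨b1, b2, b3, b4, b5, b6⟩ := h.resolveσ_eq 1 1 2 3 0 rfl
    simp only [h.arm_rotate] at a1 a2 a3 a4 a5 a6
    change ∀ z, G.resolveσ (G.σ x) 0 z = G.resolveσ x 1 z
    rintro (e | b)
    · by_cases he : ∃ j, G.arm x j = e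
      · rcases IsFourAt.exists_arm he with rfl | rfl | rfl | rfl
        · exact a6.trans b6.symm
        · exact a1.trans b1.symm
        · exact a2.trans b2.symm
        · exact a5.trans b5.symm
      · rw [resolveσ_of_not 1 he, resolveσ_of_not 0 (h.not_arm_rotate he)]
    · cases b
      · exact a3.trans b3.symm
      · exact a4.trans b4.symm

/-- The second resolution after a rotation. -/
def Iso.resolveRotate₁ (h : G.IsFourAt x) (h' : G.IsFourAt (G.σ x)) :
    Iso (G.resolve (G.σ x) h' 1) (G.resolve x h 0) where
  toEquiv := Equiv.sumCongr (Equiv.refl _) Equiv.boolNot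
  map_rev := by rintro (e | b) <;> rfl
  map_free := by rintro (e | b) <;> exact Iff.rfl
  map_σ := by
    obtain ⟨a1, a2, a3, a4, a5, a6⟩ := h'.resolveσ_eq 1 1 2 3 0 rfl
    obtain ⟨b1, b2, b3, b4, b5, b6⟩ := h.resolveσ_eq 0 0 1 2 3 rfl
    simp only [h.arm_rotate] at a1 a2 a3 a4 a5 a6
    change ∀ z, Sum.map id not (G.resolveσ (G.σ x) 1 z) = G.resolveσ x 0 (Sum.map id not z)
    rintro (e | b)
    · by_cases he : ∃ j, G.arm x j = e
      · rcases IsFourAt.exists_arm he with rfl | rfl | rfl | rfl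
        · exact (congrArg _ a5).trans b1.symm
        · exact (congrArg _ a6).trans b2.symm
        · exact (congrArg _ a1).trans b5.symm
        · exact (congrArg _ a2).trans b6.symm
      · rw [resolveσ_of_not 1 (h.not_arm_rotate he), Sum.map_inl, id, Sum.map_inl, id,
          resolveσ_of_not 0 he]
    · cases b
      · exact (congrArg _ a3).trans b4.symm
      · exact (congrArg _ a4).trans b3.symm

/-- The third resolution after a rotation. -/
def AntiIso.resolveRotate (h : G.IsFourAt x) (h' : G.IsFourAt (G.σ x)) :
    AntiIso (G.resolve (G.σ x) h' 2) (G.resolve x h 2) (.inr false) := by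
  -- For arms $a,b,c,d$ the rotated vertex resolves to $(d,b,p),(q,c,a)$, while the original one
  -- gives $(c,a,p),(q,b,d)$. After exchanging $p$ and $q$ they differ only by reversing the vertex
  -- with the arms $b,d$.
  have a := h'.resolveσ_eq 2 2 0 1 3 rfl
  have b := h.resolveσ_eq 2 2 0 1 3 rfl
  simp only [h.arm_rotate] at a
  have c0 : (G.resolve (G.σ x) h' 2).σ (.inr false) = .inl (G.arm x 3) := a.2.2.1
  have c1 : (G.resolve (G.σ x) h' 2).σ (.inl (G.arm x 3)) = .inl (G.arm x 1) := a.1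
  have c2 : (G.resolve (G.σ x) h' 2).σ (.inl (G.arm x 1)) = .inr false := a.2.1
  exact
  { toEquiv := Equiv.sumCongr (Equiv.refl _) Equiv.boolNot
    map_rev := by rintro (e | b) <;> rfl
    map_free := by rintro (e | b) <;> exact Iff.rfl
    ne := by
      rw [c0]
      simp
    cube := by rw [c0, c1, c2]
    orbit₀ := by
      rw [c0, c1]
      exact b.2.2.2.1
    orbit₁ := by
      rw [c0]
      exact b.2.2.2.2.2
    orbit₂ := by
      rw [c0, c1]
      exact b.2.2.2.2.1
    map_σ := by
      rw [c0, c1]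
      obtain ⟨a1, a2, a3, a4, a5, a6⟩ := a
      obtain ⟨b1, b2, b3, b4, b5, b6⟩ := b
      change ∀ z, z ≠ .inr false → z ≠ .inl (G.arm x 3) → z ≠ .inl (G.arm x 1) →
        Sum.map id not (G.resolveσ (G.σ x) 2 z) = G.resolveσ x 2 (Sum.map id not z)
      rintro (e | b) z0 z1 z2
      · by_cases he : ∃ j, G.arm x j = e
        · rcases IsFourAt.exists_arm he with rfl | rfl | rfl | rfl
          · exact (congrArg _ a6).trans b2.symm
          · exact absurd rfl z2
          · exact (congrArg _ a5).trans b1.symm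
          · exact absurd rfl z1
        · rw [resolveσ_of_not 2 (h.not_arm_rotate he), Sum.map_inl, id, Sum.map_inl, id,
            resolveσ_of_not 2 he]
      · cases b
        · exact absurd rfl z0
        · exact (congrArg _ a4).trans b3.symm }

/-- A leg at a 4-valent vertex is removed. -/
abbrev OGraph.removeAtFour (G : OGraph) {x t : G.E} (h : G.IsFourAt x) (ht : G.IsTip t)
    (hx : G.rev t = G.σ (G.σ (G.σ x))) : OGraph where
  E := {k : G.E // k ≠ t ∧ k ≠ G.rev t}
  finite := inferInstance
  σ := Equiv.ofBijective (fun k => if hk : k.1 = G.σ (G.σ x) then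
        ⟨x, fun hh => h.2.1 (by rw [hh, ht.2, ht.2]), fun hh => h.2.1 (by
          have h4 := h.1
          rw [← hx, ← hh] at h4
          rw [h4, h4])⟩
      else ⟨G.σ k, fun hh => k.2.1 (G.σ.injective (hh.trans ht.2.symm)),
        fun hh => hk (G.σ.injective (hh.trans hx))⟩) <| by
    refine Finite.injective_iff_bijective.1 fun a b hab => Subtype.ext ?_
    have hab' := congrArg Subtype.val hab
    have key : ∀ k : {k : G.E // k ≠ t ∧ k ≠ G.rev t}, x ≠ G.σ k.1 := fun k hk =>
      k.2.2 ((G.σ.injective (hk.symm.trans h.1.symm)).trans hx.symm)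
    beta_reduce at hab'
    split_ifs at hab' with h1 h2 h2
    · exact h1.trans h2.symm
    · exact absurd hab' (key b)
    · exact absurd hab'.symm (key a)
    · exact G.σ.injective hab'
  rev k := ⟨G.rev k, fun hh => k.2.2 (rev_eq_iff.1 hh), fun hh => k.2.1 (G.rev_injective hh)⟩
  rev_rev k := Subtype.ext (G.rev_rev k.1)
  rev_ne k hk := G.rev_ne k.1 (congrArg Subtype.val hk)
  free k := G.free k.1
  free_rev k hk := G.free_rev k.1 hk
  σ_free k hk := by
    have : k.1 ≠ G.σ (G.σ x) := fun hh =>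
      h.not_free 2 (show G.free (G.σ (G.σ x)) from hh ▸ hk)
    simp only [Equiv.ofBijective_apply, dif_neg this]
    exact Subtype.ext (G.σ_free _ hk)

theorem removeAtFour_σ {t : G.E} (h : G.IsFourAt x) (ht : G.IsTip t)
    (hx : G.rev t = G.σ (G.σ (G.σ x))) (k : (G.removeAtFour h ht hx).E) :
    ((G.removeAtFour h ht hx).σ k).1 = if k.1 = G.σ (G.σ x) then x else G.σ k.1 := by
  simp only [Equiv.ofBijective_apply]
  split_ifs <;> rfl

/-- A leg at a 4-valent vertex comes from a leg attached to a 3-valent vertex. -/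
theorem exists_legAtVertex {t : G.E} (h : G.IsUniTriFour x) (ht : G.IsTip t)
    (hx : G.rev t = G.σ (G.σ (G.σ x))) :
    ∃ (H : OGraph) (_ : H.IsUniTri) (v : H.E) (hv : H.σ v ≠ v) (f : Iso (H.legAtVertex v hv) G),
      f.toEquiv (.inl v) = x := by
  have h1 := h.1
  have n0 : x ≠ G.σ (G.σ x) := h1.2.1.symm
  have n1 : G.σ x ≠ G.σ (G.σ x) := fun hh => h1.2.1 (by rw [← hh]; exact (G.σ.injective hh).symm)
  have nx : x ≠ t ∧ x ≠ G.rev t := by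
    refine ⟨fun hh => h1.2.1 (by rw [hh, ht.2, ht.2]), fun hh => ?_⟩
    have h4 := h1.1
    rw [← hx, ← hh] at h4
    exact h1.2.1 (by rw [h4, h4])
  have sσ := removeAtFour_σ h1 ht hx
  let v : (G.removeAtFour h1 ht hx).E := ⟨x, nx⟩
  have v1 : ((G.removeAtFour h1 ht hx).σ v).1 = G.σ x := by rw [sσ, if_neg n0]
  have v2 : ((G.removeAtFour h1 ht hx).σ ((G.removeAtFour h1 ht hx).σ v)).1 = G.σ (G.σ x) := by
    rw [sσ, v1, if_neg n1]
  have v3 : (G.removeAtFour h1 ht hx).σ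
      ((G.removeAtFour h1 ht hx).σ ((G.removeAtFour h1 ht hx).σ v)) = v :=
    Subtype.ext (by rw [sσ, v2, if_pos rfl])
  have hv : (G.removeAtFour h1 ht hx).σ v ≠ v := fun hh => h1.2.1 (by
    have := v1
    rw [hh] at this
    rw [← this]
    exact this.symm)
  have hH : (G.removeAtFour h1 ht hx).IsUniTri := by
    constructor
    · intro k
      by_cases k0 : k = v
      · rw [k0, v3]
      by_cases k1 : k = (G.removeAtFour h1 ht hx).σ v
      · rw [k1, v3]
      by_cases k2 : k = (G.removeAtFour h1 ht hx).σ ((G.removeAtFour h1 ht hx).σ v)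
      · rw [k2, v3]
      have m0 : k.1 ≠ x := fun hh => k0 (Subtype.ext hh)
      have m1 : k.1 ≠ G.σ x := fun hh => k1 (Subtype.ext (hh.trans v1.symm))
      have m2 : k.1 ≠ G.σ (G.σ x) := fun hh => k2 (Subtype.ext (hh.trans v2.symm))
      have c := h1.2.2 k.1 m0 m1 m2 (by rw [← hx]; exact k.2.2)
      have e1 : ((G.removeAtFour h1 ht hx).σ k).1 = G.σ k.1 := by rw [sσ, if_neg m2]
      have e2 : ((G.removeAtFour h1 ht hx).σ ((G.removeAtFour h1 ht hx).σ k)).1 =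
          G.σ (G.σ k.1) := by rw [sσ, e1, if_neg fun hh => m1 (G.σ.injective hh)]
      apply Subtype.ext
      rw [sσ, e2, if_neg fun hh => m0 (G.σ.injective (G.σ.injective hh)), c]
    · have key : ∀ k, (G.removeAtFour h1 ht hx).σ k = k → G.σ k.1 = k.1 := by
        intro k hk
        have := congrArg Subtype.val hk
        rw [sσ] at this
        split_ifs at this with hc
        · exact absurd (this.trans hc) n0
        · exact this
      exact fun k hk hs => h.2 k.1 hk ⟨key k hs.1, key _ hs.2⟩
  obtain ⟨s1, s2, s3, s4⟩ := legAtVertex_σ hv v3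
  refine ⟨_, hH, v, hv, ⟨Equiv.ofBijective
    (Sum.elim Subtype.val (fun b => bif b then t else G.rev t)) ?_, ?_, ?_, ?_⟩, rfl⟩
  · have d6 := G.rev_ne t
    constructor
    · rintro (⟨a, a1, a2⟩ | a | a) (⟨b, b1, b2⟩ | b | b) hab <;>
        simp only [Sum.elim_inl, Sum.elim_inr, cond_true, cond_false] at hab <;>
        first
          | rfl
          | exact congrArg Sum.inl (Subtype.ext hab)
          | exact absurd hab ‹_›
          | exact absurd hab.symm ‹_›
    · intro k
      by_cases k1 : k = t
      · exact ⟨.inr true, k1.symm⟩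
      by_cases k2 : k = G.rev t
      · exact ⟨.inr false, k2.symm⟩
      exact ⟨.inl ⟨k, k1, k2⟩, rfl⟩
  · rintro (k | k | k)
    · by_cases k2 : k = (G.removeAtFour h1 ht hx).σ ((G.removeAtFour h1 ht hx).σ v)
      · subst k2
        refine (congrArg _ s3).trans ?_
        exact hx.trans (congrArg G.σ v2.symm)
      · refine (congrArg _ (s4 k k2)).trans ?_
        exact (sσ k).trans (if_neg fun hh => k2 (Subtype.ext (hh.trans v2.symm)))
    · refine (congrArg _ s1).trans ?_
      exact (h1.1.symm.trans (congrArg G.σ hx.symm))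
    · refine (congrArg _ s2).trans ?_
      exact ht.2.symm
  · rintro (k | k | k)
    · rfl
    · exact (G.rev_rev t).symm
    · rfl
  · rintro (k | k | k)
    · exact Iff.rfl
    · exact iff_of_false (free_rev_iff.not.2 ht.1) id
    · exact iff_of_false ht.1 id

end ResolveMaps

end Jacobi
end

noncomputable section

namespace Jacobi

open scoped Classical

/-! ### Cores of resolutions, and the vanishing of the IHX combination. -/

section IHXValue

open OGraph

variable {Γ G : OGraph} {κ : Γ.E → Option G.E} {x : Γ.E}

theorem resolve_isTip_inl (hx : Γ.IsFourAt x) (i : Fin 3) {t : Γ.E} :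
    (Γ.resolve x hx i).IsTip (.inl t) ↔ Γ.IsTip t := by
  refine and_congr Iff.rfl ⟨fun h => ?_, fun h => ?_⟩
  · obtain ⟨e, he, hs⟩ := resolve_σ_fixed hx i _ h
    rwa [← Sum.inl_injective he] at hs
  · change Γ.resolveσ x i (.inl t) = _
    rw [resolveσ_of_not, h]
    rintro ⟨j, rfl⟩
    rw [hx.σ_arm] at h
    have := hx.arm_injective h
    revert this
    fin_cases j <;> simp

theorem resolve_not_isTip_inr (hx : Γ.IsFourAt x) (i : Fin 3) (b : Bool) :
    ¬ (Γ.resolve x hx i).IsTip (.inr b) := fun h => by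
  obtain ⟨e, he, -⟩ := resolve_σ_fixed hx i _ h.2
  simp at he

/-- The stems of the legs that are not attached to the 4-valent vertex. -/
theorem resolve_σ_stem (hx : Γ.IsFourAt x) (i : Fin 3) {t : Γ.E}
    (ht : ¬ ∃ j, Γ.arm x j = Γ.rev t) :
    Γ.resolveσ x i (.inl (Γ.rev t)) = .inl (Γ.σ (Γ.rev t)) ∧
    Γ.resolveσ x i (.inl (Γ.σ (Γ.rev t))) = .inl (Γ.σ (Γ.σ (Γ.rev t))) ∧
    Γ.resolveσ x i (.inl (Γ.σ (Γ.σ (Γ.rev t)))) = .inl (Γ.σ (Γ.σ (Γ.σ (Γ.rev t)))) :=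
  ⟨resolveσ_of_not i ht, resolveσ_of_not i (by rwa [hx.σ_mem_arm]),
    resolveσ_of_not i (by rwa [hx.σ_mem_arm, hx.σ_mem_arm])⟩

theorem plain_arm (hx : Γ.IsFourAt x) (hna : ∀ t, Γ.IsTip t → ¬ ∃ j, Γ.arm x j = Γ.rev t)
    (j : Fin 4) : Γ.Plain (Γ.arm x j) := by
  refine ⟨hx.not_free j, fun t ht => ⟨fun hh => hx.not_free j ?_, fun hh => hna t ht ⟨j, hh⟩,
    fun hh => hna t ht ((hx.σ_mem_arm _).1 ⟨j, hh⟩),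
    fun hh => hna t ht ((hx.σ_mem_arm _).1 ((hx.σ_mem_arm _).1 ⟨j, hh⟩))⟩⟩
  have h1 := ht.2
  rw [← hh, hx.σ_arm] at h1
  have := hx.arm_injective h1
  revert this
  fin_cases j <;> simp

theorem CoreOf.map_arm (h : CoreOf Γ G κ) (hx : Γ.IsFourAt x)
    (hna : ∀ t, Γ.IsTip t → ¬ ∃ j, Γ.arm x j = Γ.rev t) {y : G.E} (hy : κ x = some y) (j : Fin 4) :
    κ (Γ.arm x j) = some (G.arm y j) := by
  have p := plain_arm hx hna
  have p0 : Γ.Plain x := p 0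
  have p1 : Γ.Plain (Γ.σ x) := p 1
  have p2 : Γ.Plain (Γ.σ (Γ.σ x)) := p 2
  have a1 : κ (Γ.σ x) = some (G.σ y) := by rw [h.map_σ _ p0, hy]; rfl
  have a2 : κ (Γ.σ (Γ.σ x)) = some (G.σ (G.σ y)) := by
    rw [h.map_σ _ p1, a1]; rfl
  have a3 : κ (Γ.σ (Γ.σ (Γ.σ x))) = some (G.σ (G.σ (G.σ y))) := by
    rw [h.map_σ _ p2, a2]; rfl
  fin_cases j
  exacts [hy, a1, a2, a3]

/-- All arms are plain, so the 4-valent vertex is carried over to the core. Its labels stay distinct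
because plain darts are determined by their labels. -/
theorem CoreOf.isTriFour (h : CoreOf Γ G κ) (hx : Γ.IsFourAt x)
    (hna : ∀ t, Γ.IsTip t → ¬ ∃ j, Γ.arm x j = Γ.rev t) {y : G.E} (hy : κ x = some y) :
    G.IsTriFour y := by
  have p := plain_arm hx hna
  have a := h.map_arm hx hna hy
  refine ⟨⟨?_, fun hh => hx.2.1 ?_, fun d d0 d1 d2 d3 => ?_⟩, h.no_leg⟩
  · have a4 := h.map_σ _ (p 3)
    rw [a 3, hx.σ_arm, show (3 + 1 : Fin 4) = 0 from rfl, a 0] at a4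
    exact (Option.some_injective _ a4).symm
  · refine h.plain_inj _ _ (p 2) (p 0) ?_
    exact (a 2).trans ((congrArg some hh).trans (a 0).symm)
  · by_cases hd : G.free d
    · rw [G.σ_free d hd, G.σ_free d hd, G.σ_free d hd]
    · rw [h.free_iff, not_not] at hd
      obtain ⟨e, he, hd⟩ := hd
      have hc := hx.σ_cube (e := e) (by
        intro hj
        rcases IsFourAt.exists_arm hj with rfl | rfl | rfl | rfl
        · exact d0 (Option.some_injective _ (hd.symm.trans (a 0)))
        · exact d1 (Option.some_injective _ (hd.symm.trans (a 1)))
        · exact d2 (Option.some_injective _ (hd.symm.trans (a 2)))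
        · exact d3 (Option.some_injective _ (hd.symm.trans (a 3))))
      have h1 := h.map_σ _ ((he.σ h.isLeg).σ h.isLeg)
      rw [h.map_σ _ (he.σ h.isLeg), h.map_σ _ he, hc, hd] at h1
      exact (Option.some_injective _ h1).symm

/-- The resolutions of a 4-valent vertex without legs. -/
theorem CoreOf.resolve (h : CoreOf Γ G κ) (hx : Γ.IsFourAt x)
    (hna : ∀ t, Γ.IsTip t → ¬ ∃ j, Γ.arm x j = Γ.rev t) {y : G.E} (hy : κ x = some y)
    (hy' : G.IsFourAt y) (i : Fin 3) :
    CoreOf (Γ.resolve x hx i) (G.resolve y hy' i)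
      (Sum.elim (fun e => (κ e).map Sum.inl) fun b => some (.inr b)) := by
  have p := plain_arm hx hna
  have a := h.map_arm hx hna hy
  set κ' : (Γ.resolve x hx i).E → Option (G.resolve y hy' i).E :=
    Sum.elim (fun e => (κ e).map Sum.inl) fun b => some (.inr b) with hκ'
  have κl : ∀ k, κ' (.inl k) = (κ k).map Sum.inl := fun k => rfl
  have κr : ∀ b, κ' (.inr b) = some (.inr b) := fun b => rfl
  have ki : ∀ {o o' : Option G.E}, o.map (Sum.inl (β := Bool)) = o'.map Sum.inl → o = o' :=
    fun hh => Option.map_injective Sum.inl_injective hh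
  have stem := fun t ht => resolve_σ_stem hx i (hna t ht)
  have tipl : ∀ {t}, (Γ.resolve x hx i).IsTip (.inl t) ↔ Γ.IsTip t := resolve_isTip_inl hx i
  have tipr := resolve_not_isTip_inr hx i
  have σr : (Γ.resolve x hx i).σ = Γ.resolveσ x i := rfl
  have rl : ∀ t, (Γ.resolve x hx i).rev (.inl t) = .inl (Γ.rev t) := fun t => rfl
  have pr : ∀ b, (Γ.resolve x hx i).Plain (.inr b) := by
    refine fun b => ⟨id, ?_⟩
    rintro (t | t) ht
    · obtain ⟨s1, s2, -⟩ := stem t (tipl.1 ht)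
      rw [rl, σr, s1, s2]
      simp
    · exact (tipr t ht).elim
  have pl : ∀ k, (Γ.resolve x hx i).Plain (.inl k) ↔ Γ.Plain k := by
    refine fun k => and_congr Iff.rfl ⟨fun hk t ht => ?_, ?_⟩
    · have := hk (.inl t) (tipl.2 ht)
      obtain ⟨s1, s2, -⟩ := stem t ht
      rw [rl, σr, s1, s2] at this
      simpa only [ne_eq, Sum.inl.injEq] using this
    · rintro hk (t | t) ht
      · have ht := tipl.1 ht
        obtain ⟨s1, s2, -⟩ := stem t ht
        rw [rl, σr, s1, s2]
        simpa only [ne_eq, Sum.inl.injEq] using hk t ht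
      · exact (tipr t ht).elim
  constructor
  · rintro (t | t) ht
    · have ht' := tipl.1 ht
      obtain ⟨s1, s2, s3⟩ := stem t ht'
      refine ⟨ht, ?_, ?_⟩
      · rw [rl, σr, s1]
        simpa only [ne_eq, Sum.inl.injEq] using (h.isLeg t ht').ne
      · rw [rl, σr, s1, s2, s3, (h.isLeg t ht').cube]
    · exact (tipr t ht).elim
  · rintro (k | k)
    · rw [κl, Option.map_eq_none_iff, h.none_iff, rl, tipl, tipl]
    · refine iff_of_false (Option.some_ne_none _) ?_
      rintro (hh | hh)
      · exact tipr _ hh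
      · exact tipr _ hh
  · rintro (k | k)
    · rw [rl, κl, κl, h.map_rev, Option.map_map, Option.map_map]
      rfl
    · rfl
  · rintro (d | b)
    · obtain ⟨k, hk⟩ := h.surj d
      exact ⟨.inl k, by rw [κl, hk]; rfl⟩
    · exact ⟨.inr b, rfl⟩
  · rintro (t | t) ht
    · have ht := tipl.1 ht
      obtain ⟨s1, s2, -⟩ := stem t ht
      rw [rl, σr, s1, s2, rl, rl, κl, κl, κl, κl, (h.thru t ht).1, (h.thru t ht).2]
      exact ⟨rfl, rfl⟩
    · exact (tipr t ht).elim
  · rintro (t | t) ht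
    · have ht := tipl.1 ht
      obtain ⟨s1, -⟩ := stem t ht
      rw [rl, σr, s1, κl, ne_eq, Option.map_eq_none_iff]
      exact h.ne_none t ht
    · exact (tipr t ht).elim
  · intro α φ hφ
    have hφ' : Γ.Thru (φ ∘ Sum.inl) := fun t ht => by
      have := hφ (.inl t) (tipl.2 ht)
      obtain ⟨s1, s2, -⟩ := stem t ht
      rwa [rl, σr, s1, s2] at this
    rintro (k | k) (k' | k') hk hk'
    · refine h.fiber α _ hφ' k k' ?_ (ki hk')
      rwa [κl, ne_eq, Option.map_eq_none_iff] at hk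
    · exfalso
      rw [κl] at hk'
      obtain ⟨d, -, hd⟩ := Option.map_eq_some_iff.1 hk'
      simp at hd
    · exfalso
      rw [κl] at hk'
      obtain ⟨d, -, hd⟩ := Option.map_eq_some_iff.1 hk'.symm
      simp at hd
    · rw [Sum.inr_injective (Option.some_injective _ hk')]
  · obtain ⟨a1, a2, a3, a4, a5, a6⟩ := hx.resolveσ_split i
    obtain ⟨b1, b2, b3, b4, b5, b6⟩ := hy'.resolveσ_split i
    have ka : ∀ j, κ' (.inl (Γ.arm x j)) = some (.inl (G.arm y j)) := fun j => by
      rw [κl, a]; rfl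
    rw [σr]
    change ∀ e, _ → κ' (Γ.resolveσ x i e) = (κ' e).map (G.resolveσ y i)
    rintro (k | k) hk
    · by_cases hj : ∃ j, Γ.arm x j = k
      · rcases IsFourAt.exists_split i hj with rfl | rfl | rfl | rfl
        · rw [a1, ka, ka, Option.map_some, b1]
        · rw [a2, ka, Option.map_some, b2, κr]
        · rw [a5, ka, ka, Option.map_some, b5]
        · rw [a6, ka, Option.map_some, b6, κr]
      · have hk' := (pl k).1 hk
        obtain ⟨d, hd⟩ := Option.ne_none_iff_exists'.1 (h.plain_ne_none hk')
        rw [resolveσ_of_not i hj, κl, κl, h.map_σ k hk', hd]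
        refine congrArg some (resolveσ_of_not i ?_).symm
        rintro ⟨j, hj'⟩
        exact hj ⟨j, h.plain_inj _ _ (p j) hk' (by rw [a, hd, hj'])⟩
    · cases k
      · rw [a3, ka]
        exact congrArg some b3.symm
      · rw [a4, ka]
        exact congrArg some b4.symm
  · rintro (d | b)
    · change G.free d ↔ _
      rw [h.free_iff, not_iff_not]
      constructor
      · rintro ⟨k, hk, hd⟩
        exact ⟨.inl k, (pl k).2 hk, by rw [κl, hd]; rfl⟩
      · rintro ⟨k | k, hk, hd⟩
        · exact ⟨k, (pl k).1 hk, ki hd⟩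
        · exact absurd (Option.some_injective _ hd) (by simp)
    · exact iff_of_false id (not_not.2 ⟨.inr b, pr b, rfl⟩)
  · rintro (k | k) (k' | k') hk hk' hh
    · exact congrArg _ (h.plain_inj k k' ((pl k).1 hk) ((pl k').1 hk') (ki hh))
    · exfalso
      rw [κl] at hh
      obtain ⟨d, -, hd⟩ := Option.map_eq_some_iff.1 hh
      simp at hd
    · exfalso
      rw [κl] at hh
      obtain ⟨d, -, hd⟩ := Option.map_eq_some_iff.1 hh.symm
      simp at hd
    · rw [κr, κr] at hh
      exact congrArg Sum.inr (Sum.inr_injective (Option.some_injective _ hh))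

variable {K : Type*} [Field K]

theorem legMonomial_resolve (hx : Γ.IsFourAt x)
    (hna : ∀ t, Γ.IsTip t → ¬ ∃ j, Γ.arm x j = Γ.rev t) {y : G.E} (hy : G.IsFourAt y) (i : Fin 3) :
    legMonomial K (Γ := Γ.resolve x hx i) (G := G.resolve y hy i)
      (Sum.elim (fun e => (κ e).map Sum.inl) fun b => some (.inr b)) =
      (Collapse.resolve K G y hy i).S (legMonomial K κ) := by
  have tipl : ∀ {t}, (Γ.resolve x hx i).IsTip (.inl t) ↔ Γ.IsTip t := resolve_isTip_inl hx i
  rw [legMonomial, legMonomial, map_prod, prod_sum]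
  refine (congrArg₂ (· * ·) (Finset.prod_congr rfl fun t _ => ?_)
    (Finset.prod_eq_one fun b _ => if_neg (resolve_not_isTip_inr hx i b))).trans (mul_one _)
  by_cases ht : Γ.IsTip t
  · obtain ⟨s1, s2, -⟩ := resolve_σ_stem hx i (hna t ht)
    rw [if_pos ht, if_pos (tipl.2 ht)]
    change dartClass K (G.resolve y hy i) (Sum.elim (fun e => (κ e).map Sum.inl)
      (fun b => some (.inr b)) (Γ.resolveσ x i (Γ.resolveσ x i (.inl (Γ.rev t))))) = _
    rw [s1, s2, Sum.elim_inl]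
    cases κ (Γ.σ (Γ.σ (Γ.rev t))) with
    | none => simp [dartClass]
    | some k =>
      rw [Option.map_some, ← edgeMonomial_singleton, ← edgeMonomial_singleton,
        Collapse.S_edgeMonomial K (Collapse.resolve K G y hy i) Sum.inl (fun _ => rfl),
        Multiset.map_singleton]
      rintro e (k | k)
      · change some k = some e ↔ _
        rw [Option.some_inj, Sum.inl_injective.eq_iff]
      · change none = some e ↔ _
        simp
  · rw [if_neg ht, if_neg (tipl.not.2 ht), map_one]

/-- At a plain vertex this is the vertex relation in $H^1$ of the core. At the vertex of a leg the
stem contributes zero, and the other two darts are opposite pieces of the same edge, so they cancel.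
-/
theorem dartClass_sum {G : TriGraph} {κ : Γ.E → Option G.1.E} (h : CoreOf Γ G.1 κ)
    (hΓ : Γ.IsUniTri) {v : Γ.E} (hv : Γ.σ v ≠ v) :
    dartClass K G.1 (κ v) + dartClass K G.1 (κ (Γ.σ v)) + dartClass K G.1 (κ (Γ.σ (Γ.σ v))) = 0 := by
  by_cases hp : Γ.Plain v
  · obtain ⟨d, hd⟩ := Option.ne_none_iff_exists'.1 (h.plain_ne_none hp)
    rw [h.map_σ _ (hp.σ h.isLeg), h.map_σ v hp, hd]
    refine dartClass_vertex G.2.1 d ?_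
    rw [h.free_iff, not_not]
    exact ⟨v, hp, hd⟩
  · have key : ∀ t, Γ.IsTip t → dartClass K G.1 (κ (Γ.rev t)) +
        dartClass K G.1 (κ (Γ.σ (Γ.rev t))) + dartClass K G.1 (κ (Γ.σ (Γ.σ (Γ.rev t)))) = 0 := by
      intro t ht
      rw [(h.none_iff (Γ.rev t)).2 (.inr (by rwa [Γ.rev_rev])), ← (h.thru t ht).1, h.map_rev,
        dartClass_rev]
      simp [dartClass]
    rw [OGraph.Plain, not_and] at hp
    have hp := hp (OGraph.not_free_of_σ_ne hv)
    push Not at hp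
    obtain ⟨t, ht, hp⟩ := hp
    have hk := key t ht
    by_cases p1 : v = Γ.rev t
    · rw [p1, hk]
    by_cases p2 : v = Γ.σ (Γ.rev t)
    · rw [p2, hΓ.1, ← hk]
      ring
    · rw [hp (fun hh => hv (hh ▸ ht.2)) p1 p2, hΓ.1, ← hk]
      ring

variable [CharZero K]

variable (K) in
/-- The left-hand side of the IHX relation. -/
def ihxValue (Γ : OGraph) (x : Γ.E) (h : Γ.IsFourAt x) : D K :=
  graphValue K (Γ.resolve x h 0) - graphValue K (Γ.resolve x h 1) + graphValue K (Γ.resolve x h 2)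

/-- A rotation exchanges the first two resolutions and reverses one vertex of the third, so the
alternating sum changes its sign. -/
theorem ihxValue_rotate (h : Γ.IsUniTriFour x) :
    ihxValue K Γ (Γ.σ x) h.rotate.1 = - ihxValue K Γ x h.1 := by
  rw [ihxValue, ihxValue, graphValue_iso (h.rotate.resolve 0) (Iso.resolveRotate₀ h.1 h.rotate.1),
    graphValue_iso (h.rotate.resolve 1) (Iso.resolveRotate₁ h.1 h.rotate.1),
    eq_neg_of_add_eq_zero_left (graphValue_antiIso (h.rotate.resolve 2)
      (AntiIso.resolveRotate h.1 h.rotate.1))]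
  ring

/-- The resolutions are the leg on the three edges at `v`, the middle one on the opposite side.
Without forks, the total is the monomial of the other legs times the sum of the three classes at
`v`. -/
theorem ihxValue_legAtVertex (hΓ : Γ.IsUniTri) {v : Γ.E} (hv : Γ.σ v ≠ v) :
    ihxValue K (Γ.legAtVertex v hv) (.inl v) (hΓ.legAtVertex hv).1 = 0 := by
  have n0 := OGraph.not_free_of_σ_ne hv
  have n1 := OGraph.not_free_σ n0
  have n2 := OGraph.not_free_σ n1
  rw [ihxValue, ← graphValue_iso (hΓ.attachEdge _ n2)
      (Iso.legAtVertex hv hΓ 0 _ n2 (.inl ⟨rfl, rfl⟩)),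
    ← graphValue_iso (hΓ.attachEdge _ n1) (Iso.legAtVertex hv hΓ 2 _ n1 (.inr ⟨rfl, rfl⟩)),
    eq_neg_of_add_eq_zero_right (graphValue_antiIso (hΓ.attachEdge _ n0)
      (AntiIso.legAtVertex hv hΓ n0)), sub_neg_eq_add]
  by_cases hf : Γ.HasFork
  · rw [graphValue_of_hasFork (hf.attachEdge _ n0), graphValue_of_hasFork (hf.attachEdge _ n1),
      graphValue_of_hasFork (hf.attachEdge _ n2), add_zero, add_zero]
  · obtain ⟨G, κ, h⟩ := hΓ.exists_coreOf hf
    rw [graphValue_attachEdge h, graphValue_attachEdge h, graphValue_attachEdge h, ← D.cls_add,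
      ← D.cls_add, ← add_mul, ← add_mul, add_assoc, add_comm, dartClass_sum h hΓ hv, zero_mul,
      D.cls_zero]

theorem ihxValue_iso {Γ' : OGraph} (h : Γ.IsUniTriFour x) (f : Iso Γ Γ') {x' : Γ'.E}
    (hx : f.toEquiv x = x') (h' : Γ'.IsFourAt x') :
    ihxValue K Γ x h.1 = ihxValue K Γ' x' h' := by
  rw [ihxValue, ihxValue, graphValue_iso (h.resolve 0) (f.resolve hx h.1 h' 0),
    graphValue_iso (h.resolve 1) (f.resolve hx h.1 h' 1),
    graphValue_iso (h.resolve 2) (f.resolve hx h.1 h' 2)]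

theorem ihxValue_of_leg (h : Γ.IsUniTriFour x) {t : Γ.E} (ht : Γ.IsTip t)
    (hx : Γ.rev t = Γ.σ (Γ.σ (Γ.σ x))) : ihxValue K Γ x h.1 = 0 := by
  obtain ⟨H, hH, v, hv, f, hf⟩ := exists_legAtVertex h ht hx
  rw [← ihxValue_iso (hH.legAtVertex hv) f hf h.1, ihxValue_legAtVertex hH]

theorem OGraph.HasFork.resolve (hf : Γ.HasFork) (hx : Γ.IsFourAt x)
    (hna : ∀ t, Γ.IsTip t → ¬ ∃ j, Γ.arm x j = Γ.rev t) (i : Fin 3) :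
    (Γ.resolve x hx i).HasFork := by
  obtain ⟨t, t', h0, h1, h2, h3⟩ := hf
  refine ⟨.inl t, .inl t', fun hh => h0 (Sum.inl_injective hh), (resolve_isTip_inl hx i).2 h1,
    (resolve_isTip_inl hx i).2 h2, ?_⟩
  exact (resolve_σ_stem hx i (hna t h1)).1.trans (congrArg Sum.inl h3)

/-- If no leg ends at the 4-valent vertex, then taking the core commutes with resolving, and IHX in
$\mathcal D$ applies (forks, if any, survive in all three terms). If a leg ends there, the vertex is
a 3-valent vertex with a leg pushed into it. -/
theorem ihxValue_eq_zero (h : Γ.IsUniTriFour x) : ihxValue K Γ x h.1 = 0 := by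
  by_cases hna : ∀ t, Γ.IsTip t → ¬ ∃ j, Γ.arm x j = Γ.rev t
  · by_cases hf : Γ.HasFork
    · rw [ihxValue, graphValue_of_hasFork (hf.resolve h.1 hna 0),
        graphValue_of_hasFork (hf.resolve h.1 hna 1),
        graphValue_of_hasFork (hf.resolve h.1 hna 2), sub_zero, add_zero]
    -- The core exists although `Γ` has a 4-valent vertex, since no stem starts there.
    · have hl : ∀ t, Γ.IsTip t → Γ.IsLeg t := fun t ht =>
        ⟨ht, fun hh => h.2 t ht.1 ⟨ht.2, hh⟩, h.1.σ_cube (hna t ht)⟩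
      obtain ⟨G, κ, hc⟩ := exists_coreOf hl hf
      obtain ⟨y, hy⟩ := Option.ne_none_iff_exists'.1 (hc.plain_ne_none (plain_arm h.1 hna 0))
      have hG := hc.isTriFour h.1 hna hy
      have key : ∀ i, graphValue K (Γ.resolve x h.1 i) = D.cls K ⟨G.resolve y hG.1 i, hG.resolve i⟩
          ((Collapse.resolve K G y hG.1 i).S (legMonomial K κ)) := fun i => by
        rw [graphValue_eq (G := ⟨G.resolve y hG.1 i, hG.resolve i⟩)
          (hc.resolve h.1 hna hy hG.1 i), legMonomial_resolve h.1 hna hG.1 i]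
      rw [ihxValue, key, key, key, D.cls_resolve hG]
  · push Not at hna
    obtain ⟨t, ht, hj⟩ := hna
    have r1 := h.rotate
    have r2 := r1.rotate
    have r3 := r2.rotate
    have e1 := ihxValue_rotate (K := K) h
    have e2 := ihxValue_rotate (K := K) r1
    have e3 := ihxValue_rotate (K := K) r2
    have c := h.1.1
    -- Up to sign, rotations make the stem the last of the four arms.
    rcases IsFourAt.exists_arm hj with hj | hj | hj | hj
    · have z := ihxValue_of_leg (K := K) r1 ht (hj.trans c.symm)
      rwa [e1, neg_eq_zero] at z
    · have z := ihxValue_of_leg (K := K) r2 ht (hj.trans (congrArg Γ.σ c.symm))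
      rwa [e2, neg_eq_zero, e1, neg_eq_zero] at z
    · have z := ihxValue_of_leg (K := K) r3 ht (hj.trans (congrArg (fun k => Γ.σ (Γ.σ k)) c.symm))
      rwa [e3, neg_eq_zero, e2, neg_eq_zero, e1, neg_eq_zero] at z
    · exact ihxValue_of_leg h ht hj

end IHXValue

end Jacobi
end

noncomputable section

namespace Jacobi

open scoped Classical

/-! ### The inverse map -/

section Inverse

variable {K : Type*} [Field K]

/-- Attaching legs to a closed graph with legs. -/
theorem LegsOn.exists_legs {G : TriGraph} {Γ : UTGraph} {κ : Γ.1.E → Option G.1.E}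
    {s : Multiset G.1.E} (h : LegsOn G Γ κ s) (M : List Γ.1.E) (N : List G.1.E)
    (hM : M.map κ = N.map some) :
    ∃ (Γ' : UTGraph) (κ' : Γ'.1.E → Option G.1.E),
      LegsOn G Γ' κ' (N + s) ∧ legs K Γ M = B.graph K Γ' := by
  induction N generalizing Γ s with
  | nil =>
    rw [List.map_nil, List.map_eq_nil_iff] at hM
    subst hM
    refine ⟨Γ, κ, ?_, legs_nil Γ⟩
    rwa [Multiset.coe_nil, zero_add]
  | cons d N ih =>
    obtain _ | ⟨e, M⟩ := M
    · simp at hM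
    rw [List.map_cons, List.map_cons, List.cons.injEq] at hM
    have hs : ((d :: N : List G.1.E) : Multiset G.1.E) + s = N + (d ::ₘ s) := by
      rw [← Multiset.cons_coe, Multiset.cons_add, Multiset.add_cons]
    rw [hs]
    by_cases he : Γ.1.free e
    · rw [legs_circle he]
      refine ih (LegsOn.circle Γ κ s e he d hM.1 h) _ ?_
      rw [List.map_map, ← hM.2]
      rfl
    · rw [legs_edge he]
      refine ih (LegsOn.edge Γ κ s e he d hM.1 h) _ ?_
      rw [List.map_map, ← hM.2]
      rfl

variable [CharZero K]

theorem exists_legsOn (G : TriGraph) (s : Multiset G.1.E) :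
    ∃ (Γ : UTGraph) (κ : Γ.1.E → Option G.1.E),
      LegsOn G Γ κ s ∧ toB K (D.cls K G (edgeMonomial K G.1 s)) = B.graph K Γ := by
  induction s using Quotient.inductionOn with
  | h L =>
    obtain ⟨Γ, κ, h1, h2⟩ := (LegsOn.core (G := G)).exists_legs (K := K) L L rfl
    refine ⟨Γ, κ, ?_, (toB_edgeMonomial G L).trans h2⟩
    rwa [add_zero] at h1

/-- Classes of projected edge monomials span $\mathcal D$. Together with surjectivity of `toB` this
gives both the left inverse property and the uniqueness. -/
theorem D.linearMap_ext {M : Type*} [AddCommGroup M] [Module K M] {f g : D K →ₗ[K] M}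
    (h : ∀ G s, f (D.cls K G (edgeMonomial K G.1 s)) = g (D.cls K G (edgeMonomial K G.1 s))) :
    f = g := by
  refine LinearMap.ext fun z => ?_
  obtain ⟨z, rfl⟩ := Ideal.Quotient.mk_surjective z
  induction z using DTilde.induction_on K with
  | h0 => rw [map_zero, map_zero, map_zero]
  | hadd a b ha hb => rw [map_add, map_add, map_add, ha, hb]
  | hp G x =>
    have : f ∘ₗ (Ideal.Quotient.mkₐ K (DTilde.relIdeal K)).toLinearMap ∘ₗ DTilde.proj K G =
        g ∘ₗ (Ideal.Quotient.mkₐ K (DTilde.relIdeal K)).toLinearMap ∘ₗ DTilde.proj K G :=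
      SH1_linearMap_ext K fun s => h G s
    exact LinearMap.congr_fun this x

variable (K) in
/-- The linear map given by `graphValue`. -/
def tildeValue : BTilde K →ₗ[K] D K :=
  (MonoidAlgebra.basis UTClass K).constr K fun c =>
    Quotient.liftOn c (fun Γ => graphValue K Γ.1) fun Γ _ h => graphValue_iso Γ.2 h.some

theorem tildeValue_graph (Γ : UTGraph) : tildeValue K (BTilde.graph K Γ) = graphValue K Γ.1 :=
  Module.Basis.constr_basis (MonoidAlgebra.basis UTClass K) K _ (UTClass.mk Γ)

theorem tildeValue_relIdeal {z : BTilde K} (hz : z ∈ BTilde.relIdeal K) : tildeValue K z = 0 := by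
  have hle : BTilde.AS K ⊔ BTilde.IHX K ≤ LinearMap.ker (tildeValue K) := by
    refine sup_le (Submodule.span_le.2 ?_) (Submodule.span_le.2 ?_)
    · rintro _ ⟨Γ, e, he, rfl⟩
      change tildeValue K _ = 0
      rw [map_add, tildeValue_graph, tildeValue_graph]
      exact graphValue_flip Γ.2 e he
    · rintro _ ⟨Γ, x, h, rfl⟩
      change tildeValue K _ = 0
      rw [map_add, map_sub, tildeValue_graph, tildeValue_graph, tildeValue_graph]
      exact ihxValue_eq_zero h
  exact hle hz

variable (K) in
/-- The linear map `B → D` given by `graphValue`. -/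
def value : B K →ₗ[K] D K :=
  (Submodule.liftQ ((BTilde.relIdeal K).restrictScalars K) (tildeValue K)
      fun _ hz => tildeValue_relIdeal hz) ∘ₗ
    (Submodule.Quotient.restrictScalarsEquiv K (BTilde.relIdeal K)).symm.toLinearMap

theorem value_graph (Γ : UTGraph) : value K (B.graph K Γ) = graphValue K Γ.1 :=
  tildeValue_graph Γ

/-- On a monomial, `toB` attaches legs and `graphValue` reads off the same monomial. Only linearity
of `value` is needed; the isomorphism inherits its multiplicativity from `toB`. -/
theorem value_toB (z : D K) : value K (toB K z) = z := by
  have : value K ∘ₗ (toB K).toLinearMap = LinearMap.id := by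
    refine D.linearMap_ext fun G s => ?_
    obtain ⟨Γ, κ, h1, h2⟩ := exists_legsOn (K := K) G s
    rw [LinearMap.comp_apply, AlgHom.toLinearMap_apply, h2, value_graph, h1.graphValue,
      LinearMap.id_apply]
  exact LinearMap.congr_fun this z

variable (K) in
/-- The algebras `B` and `D` are isomorphic. -/
def equivD : B K ≃ₐ[K] D K :=
  (AlgEquiv.ofBijective (toB K)
    ⟨Function.LeftInverse.injective value_toB, toB_surjective⟩).symm

theorem equivD_toB (z : D K) : equivD K (toB K z) = z :=
  (AlgEquiv.ofBijective (toB K)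
    ⟨Function.LeftInverse.injective value_toB, toB_surjective⟩).symm_apply_apply z

theorem equivD_eq_value (b : B K) : equivD K b = value K b := by
  obtain ⟨z, rfl⟩ := toB_surjective b
  rw [equivD_toB, value_toB]

theorem equivD_map_deg (m n : ℕ) :
    (B.deg K m n).map (equivD K).toLinearMap = D.deg K m ((n : ℤ) - m) := by
  rw [← map_toB_deg, ← Submodule.map_comp]
  have : (equivD K).toLinearMap ∘ₗ (toB K).toLinearMap = LinearMap.id :=
    LinearMap.ext fun z => equivD_toB z
  rw [this, Submodule.map_id]

theorem equivD_legsOn {G : TriGraph} {Γ : UTGraph} {κ : Γ.1.E → Option G.1.E}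
    {s : Multiset G.1.E} (h : LegsOn G Γ κ s) :
    equivD K (B.graph K Γ) = D.cls K G (edgeMonomial K G.1 s) := by
  rw [equivD_eq_value, value_graph, h.graphValue]

/-- An isomorphism with the values of `equivD` on closed graphs with legs is equal to it. -/
theorem eq_equivD {A : B K ≃ₐ[K] D K}
    (h : ∀ (G : TriGraph) (Γ : UTGraph) (κ : Γ.1.E → Option G.1.E) (s : Multiset G.1.E),
      LegsOn G Γ κ s → A (B.graph K Γ) = D.cls K G (edgeMonomial K G.1 s)) : A = equivD K := by
  have key : A.toLinearMap ∘ₗ (toB K).toLinearMap = LinearMap.id := by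
    refine D.linearMap_ext fun G s => ?_
    obtain ⟨Γ, κ, h1, h2⟩ := exists_legsOn (K := K) G s
    rw [LinearMap.comp_apply, AlgHom.toLinearMap_apply, h2, LinearMap.id_apply]
    exact h G Γ κ s h1
  refine AlgEquiv.ext fun b => ?_
  obtain ⟨z, rfl⟩ := toB_surjective b
  rw [equivD_toB]
  exact LinearMap.congr_fun key z

end Inverse

end Jacobi
end

/-- The algebra `B` of (1,3)-valent graphs and the algebra `D` are isomorphic, by a unique algebra
isomorphism that maps `B_{m,n}` onto `D_{m,n-m}` and sends a closed graph with legs attached to its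
edges to the corresponding monomial in the classes dual to the edges. -/
theorem theorem3p1 (K : Type*) [Field K] [CharZero K] :
    ∃! A : Jacobi.B K ≃ₐ[K] Jacobi.D K,
      (∀ m n : ℕ, (Jacobi.B.deg K m n).map A.toLinearMap = Jacobi.D.deg K m ((n : ℤ) - m)) ∧
      ∀ (G : Jacobi.TriGraph) (Γ : Jacobi.UTGraph) (κ : Γ.1.E → Option G.1.E)
        (s : Multiset G.1.E), Jacobi.LegsOn G Γ κ s →
          A (Jacobi.B.graph K Γ) = Jacobi.D.cls K G (Jacobi.edgeMonomial K G.1 s) :=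
  ⟨Jacobi.equivD K, ⟨Jacobi.equivD_map_deg, fun _ _ _ _ h => Jacobi.equivD_legsOn h⟩,
    fun _ hA => Jacobi.eq_equivD hA.2⟩
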